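/- \textbf{Conventions.} A $3$-polytope is the convex hull of finitely many points of $\mathbb R^3$, with non-empty interior. A point is \emph{beyond} a facet $F$ of a polytope $P$ if it strictly violates the inequality defining $F$ and strictly satisfies the inequalities defining all other facets of $P$; a set is beyond $F$ if all its points are. A \emph{triangular cone} is a set $\{p+t_1r_1+t_2r_2+t_3r_3 : t_i\ge 0\}$ with $r_1,r_2,r_3$ linearly independent. Indices of $A_i,B_i$ are cyclic modulo $3$. A \emph{Schönhardt polytope} is a (non-convex) polytope with six vertices $A_1,A_2,A_3,B_1,B_2,B_3$ whose boundary is the simplicial complex with the eight facets $(A_1,A_2,A_3)$, $(B_1,B_2,B_3)$, $(A_i,B_i,A_{i+1})$, $(B_i,A_{i+1},B_{i+1})$ ($i=1,2,3$), the interior angle being greater than $\pi$ at the three edges $(B_i,A_{i+1})$ and less than $\pi$ at the other nine edges; its six vertices are then said to be in \emph{Schönhardt position}. For a positive integer $m$, an \emph{$m$-cupola} is a $3$-polytope $C$ such that: (1) its vertices are the $3m+6$ distinct points $A_i$, $B_i$ ($i=1,2,3$) and $q^i_k$ ($i=1,2,3$, $1\le k\le m$); put $q^i_0=A_i$, $q^i_{m+1}=B_{i+1}$;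 (2) $A_1,A_2,A_3,B_1,B_2,B_3$ are in Schönhardt position; (3) its facets are exactly the bottom facet $(A_1,A_2,A_3)$, the skylight $(B_1,B_2,B_3)$, and the triangles $(B_i,q^i_k,q^i_{k+1})$ and $(A_{i+1},q^i_k,q^i_{k+1})$ for $i=1,2,3$, $0\le k\le m$; (4) for $1\le k\le m$, the point $q^i_k$ lies strictly on the side of the plane $B_iA_{i+1}B_{i+2}$ opposite to $B_{i+1}$. The \emph{visibility cone} of $C$ is the set of points that, for each $i=1,2,3$, lie on the same closed side of the plane $B_iB_{i+1}A_{i+1}$ as $B_{i+2}$. The encoding length of a polytope with rational vertices is the total binary length of the coordinates of its vertices; that of a triangular cone given by a rational apex and three rational ray directions is the total binary length of these four vectors. \textbf{Theorem (Cupola Construction from a Given Visibility Cone).} There is a polynomial $f$ with non-negative integer coefficients such that the following holds. Let $F$ be a facet of a $3$-polytope $P\subset\mathbb R^3$, let $V$ be a triangular cone such that $F\cap V$ is a (non-degenerate) triangle contained in the relative interior of $F$, and let $m$ be a positive integer. Then there is an $m$-cupola $C$ which is beyond the facet $F$ of $P$, such that $P$ is beyond the bottom facet $(A_1,A_2,A_3)$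 of $C$, and such that the visibility cone of $C$ is exactly $V$. Moreover, $C$ can be chosen so that, whenever $P$ has rational vertices and encoding length $a$ and $V$ can be given by a rational apex and rational ray directions with encoding length $b$, the cupola $C$ has rational vertices and encoding length at most $f(a+b+m)$. -/

import Mathlib

open scoped Topology

namespace Cupola

/-- The ambient space `ℝ³`. -/
abbrev Space := EuclideanSpace ℝ (Fin 3)

/-! ### Polytopes, facets, points beyond a facet -/

/-- A (convex, full-dimensional) `3`-polytope in `ℝ³`. -/
def IsPolytope3 (P : Set Space) : Prop :=
  (∃ s : Set Space, s.Finite ∧ P = convexHull ℝ s) ∧ (interior P).Nonempty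

/-- `G` is a facet of the `3`-polytope `P`: a face of dimension `2`. -/
def IsFacet (P G : Set Space) : Prop :=
  IsExposed ℝ P G ∧ Module.finrank ℝ (vectorSpan ℝ G) = 2

/-- The point `p` is beyond the face `F` of `P`: it strictly violates every inequality `l x ≤ c`
defining a facet of `P` that contains `F`, and strictly satisfies every inequality defining
another facet of `P`. -/
def IsBeyond (P F : Set Space) (p : Space) : Prop :=
  ∀ G : Set Space, IsFacet P G → ∀ (l : Space →L[ℝ] ℝ) (c : ℝ),
    (∀ x ∈ P, l x ≤ c) → G = {x ∈ P | l x = c} →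
      (F ⊆ G → c < l p) ∧ (¬ F ⊆ G → l p < c)

/-- A nondegenerate (closed) triangle. -/
def IsTriangle (T : Set Space) : Prop :=
  ∃ D : Fin 3 → Space, AffineIndependent ℝ D ∧ T = convexHull ℝ (Set.range D)

/-- The cone with apex `p` and ray directions `r 0`, `r 1`, `r 2`. -/
def coneOf (p : Space) (r : Fin 3 → Space) : Set Space :=
  {x | ∃ t : Fin 3 → ℝ, (∀ i, 0 ≤ t i) ∧ x = p + ∑ i, t i • r i}

/-- A triangular cone: an apex and three linearly independent ray directions. -/
def IsTriangularCone (V : Set Space) : Prop :=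
  ∃ (p : Space) (r : Fin 3 → Space), LinearIndependent ℝ r ∧ V = coneOf p r

/-! ### Schönhardt polytopes

Indices are taken in `Fin 3`, so `i + 1` and `i + 2` are cyclic. -/

/-- The eight triangles bounding a Schönhardt polytope: the bottom `A`, the skylight `B`, and
`(Aᵢ, Bᵢ, Aᵢ₊₁)`, `(Bᵢ, Aᵢ₊₁, Bᵢ₊₁)` for the three indices `i`. -/
def schonhardtFacets (A B : Fin 3 → Space) : Set (Fin 3 → Space) :=
  {A, B} ∪ Set.range (fun i => ![A i, B i, A (i + 1)])
    ∪ Set.range (fun i => ![B i, A (i + 1), B (i + 1)])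

/-- The solid `S`, two of whose facets are the triangles `u v c` and `u v d`, has interior angle
less than `π` at their common edge `u v`: from every relative interior point `x` of the edge, the
direction `(c - x) + (d - x)`, which lies between the two facets on the side of the angle less
than `π`, points into the interior of `S`. -/
def AngleLtPi (S : Set Space) (u v c d : Space) : Prop :=
  ∀ x ∈ openSegment ℝ u v, ∀ᶠ t in 𝓝[>] (0 : ℝ), x + t • ((c - x) + (d - x)) ∈ interior S

/-- The solid `S`, two of whose facets are the triangles `u v c` and `u v d`, has interior angle
greater than `π` at their common edge `u v` (the edge is reflex): from every relative interior
point `x` of the edge, the direction `(c - x) + (d - x)`, which lies between the two facets on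
the side of the angle less than `π`, points out of `S`. -/
def AngleGtPi (S : Set Space) (u v c d : Space) : Prop :=
  ∀ x ∈ openSegment ℝ u v, ∀ᶠ t in 𝓝[>] (0 : ℝ), x + t • ((c - x) + (d - x)) ∉ S

/-- `S` is a Schönhardt polytope with vertices `A₁, A₂, A₃, B₁, B₂, B₃`: a solid (non-convex)
polytope with six vertices whose boundary complex consists of the eight triangles
`schonhardtFacets A B`, and whose reflex edges are exactly the diagonals `(Bᵢ, Aᵢ₊₁)`. -/
structure IsSchonhardtPolytope (S : Set Space) (A B : Fin 3 → Space) : Prop where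
  isCompact : IsCompact S
  closure_interior : closure (interior S) = S
  isConnected_interior : IsConnected (interior S)
  vertices_injective : Function.Injective (Sum.elim A B)
  facets_nondegenerate : ∀ T ∈ schonhardtFacets A B, AffineIndependent ℝ T
  facets_inter : ∀ T ∈ schonhardtFacets A B, ∀ T' ∈ schonhardtFacets A B,
    convexHull ℝ (Set.range T) ∩ convexHull ℝ (Set.range T') =
      convexHull ℝ (Set.range T ∩ Set.range T')
  frontier_eq : frontier S = ⋃ T ∈ schonhardtFacets A B, convexHull ℝ (Set.range T)
  angle_bottom : ∀ i, AngleLtPi S (A i) (A (i + 1)) (A (i + 2)) (B i)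
  angle_skylight : ∀ i, AngleLtPi S (B i) (B (i + 1)) (B (i + 2)) (A (i + 1))
  angle_side : ∀ i, AngleLtPi S (A i) (B i) (A (i + 1)) (B (i + 2))
  angle_diagonal : ∀ i, AngleGtPi S (B i) (A (i + 1)) (A i) (B (i + 1))

/-- Six points in Schönhardt position: they are the vertices of a Schönhardt polytope. -/
def SchonhardtPosition (A B : Fin 3 → Space) : Prop :=
  ∃ S : Set Space, IsSchonhardtPolytope S A B

/-- The visibility cone: the cone bounded by the planes `Bᵢ Bᵢ₊₁ Aᵢ₊₁` that contains the skylight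
`(B₁, B₂, B₃)`, i.e. that is on the side of `Bᵢ₊₂` of each of these planes. -/
def visibilityCone (A B : Fin 3 → Space) : Set Space :=
  {x | ∀ i, (affineSpan ℝ {B i, B (i + 1), A (i + 1)}).WSameSide x (B (i + 2))}

/-! ### Cupolas -/

/-- `C` is an `m`-cupola with bottom facet `A`, skylight `B` and vertex-edge chains
`q i 0 = Aᵢ, q i 1, …, q i m, q i (m + 1) = Bᵢ₊₁`. -/
structure IsCupola (m : ℕ) (C : Set Space) (A B : Fin 3 → Space)
    (q : Fin 3 → Fin (m + 2) → Space) : Prop where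
  isPolytope3 : IsPolytope3 C
  chain_zero : ∀ i, q i 0 = A i
  chain_last : ∀ i, q i (Fin.last (m + 1)) = B (i + 1)
  /-- The vertices of `C` are the points `Aᵢ`, `Bᵢ` and `q i k`. -/
  vertices : C.extremePoints ℝ = Set.range A ∪ Set.range B ∪ ⋃ i, Set.range (q i)
  /-- Apart from the identified ends of the chains, these points are pairwise distinct. -/
  ncard_vertices : (C.extremePoints ℝ).ncard = 3 * m + 6
  schonhardt : SchonhardtPosition A B
  facets : {G | IsFacet C G} =
    {convexHull ℝ (Set.range A), convexHull ℝ (Set.range B)} ∪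
      {G | ∃ (i : Fin 3) (k : Fin (m + 1)),
        G = convexHull ℝ {B i, q i k.castSucc, q i k.succ} ∨
        G = convexHull ℝ {A (i + 1), q i k.castSucc, q i k.succ}}
  /-- The inner chain vertices lie on the side of the plane `Bᵢ Aᵢ₊₁ Bᵢ₊₂` opposite to `Bᵢ₊₁`. -/
  chain_side : ∀ (i : Fin 3) (k : Fin (m + 2)), k ≠ 0 → k ≠ Fin.last (m + 1) →
    (affineSpan ℝ {B i, A (i + 1), B (i + 2)}).SOppSide (q i k) (B (i + 1))

/-! ### Binary encoding lengths -/

/-- The binary encoding length of a rational number. -/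
def ratLength (x : ℚ) : ℕ := 1 + Nat.size x.num.natAbs + Nat.size x.den

/-- The binary encoding length of a rational vector. -/
def vecLength (v : Fin 3 → ℚ) : ℕ := ∑ i, ratLength (v i)

/-- The point of `ℝ³` with the given rational coordinates. -/
noncomputable def ofRat (v : Fin 3 → ℚ) : Space := WithLp.toLp 2 (fun i => (v i : ℝ))

/-- The polytope `P` has rational vertices and encoding length `a` (it is encoded by the list of
its vertices). -/
def PolytopeHasLength (P : Set Space) (a : ℕ) : Prop :=
  ∃ s : Finset (Fin 3 → ℚ), P.extremePoints ℝ = ofRat '' (s : Set (Fin 3 → ℚ)) ∧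
    a = ∑ v ∈ s, vecLength v

/-- `V` is a triangular cone that can be encoded in length `b` by a rational apex and three
rational ray directions. -/
def ConeHasLength (V : Set Space) (b : ℕ) : Prop :=
  ∃ (p : Fin 3 → ℚ) (r : Fin 3 → Fin 3 → ℚ),
    LinearIndependent ℝ (fun i => ofRat (r i)) ∧
    V = coneOf (ofRat p) (fun i => ofRat (r i)) ∧
    b = vecLength p + ∑ i, vecLength (r i)

end Cupola

open scoped Topology

namespace Cupola

/-! ### Affine functionals on space -/

/-- Affine functionals on `ℝ³`. -/
abbrev Fn := Space →ᵃ[ℝ] ℝ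

theorem Fn.combo (f : Fn) {a b : ℝ} (h : a + b = 1) (x y : Space) :
    f (a • x + b • y) = a * f x + b * f y := by
  simpa using Convex.combo_affine_apply (f := f) (x := x) (y := y) h

theorem Fn.cont (f : Fn) : Continuous f := AffineMap.continuous_of_finiteDimensional f

theorem Fn.linear_sub (f : Fn) (x y : Space) : f.linear (x - y) = f x - f y := by
  simpa using f.linearMap_vsub x y

theorem Fn.add_smul_sub (f : Fn) (x y z : Space) (c : ℝ) :
    f (x + c • (y - z)) = f x + c * (f y - f z) := by
  have := f.map_vadd x (c • (y - z))
  simp only [vadd_eq_add] at this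
  rw [add_comm, this, map_smul, Fn.linear_sub]
  simp [add_comm]

theorem Fn.convex_nonneg (f : Fn) : Convex ℝ {x | 0 ≤ f x} := by
  intro x hx y hy a b ha hb hab
  simp only [Set.mem_ofPred_eq] at *
  rw [f.combo hab]
  positivity

theorem Fn.nonneg_of_mem_convexHull (f : Fn) {W : Set Space} (h : ∀ w ∈ W, 0 ≤ f w)
    {x : Space} (hx : x ∈ convexHull ℝ W) : 0 ≤ f x :=
  convexHull_min (s := W) (t := {x | 0 ≤ f x}) h f.convex_nonneg hx

theorem Fn.eq_zero_of_mem_convexHull (f : Fn) {W : Set Space} (h : ∀ w ∈ W, f w = 0)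
    {x : Space} (hx : x ∈ convexHull ℝ W) : f x = 0 := by
  apply le_antisymm
  · have := (-f).nonneg_of_mem_convexHull (W := W) (fun w hw => by simp [h w hw]) hx
    simpa using this
  · exact f.nonneg_of_mem_convexHull (fun w hw => (h w hw).ge) hx

/-- The zeros on `conv W` of a functional nonnegative on `W` are the hull of its zeros on `W`. -/
theorem Fn.mem_convexHull_zeros (f : Fn) {W : Set Space} (h : ∀ w ∈ W, 0 ≤ f w)
    {x : Space} (hx : x ∈ convexHull ℝ W) (h0 : f x = 0) :
    x ∈ convexHull ℝ {w ∈ W | f w = 0} := by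
  have key : convexHull ℝ W ⊆
      {x | 0 ≤ f x ∧ (f x = 0 → x ∈ convexHull ℝ {w ∈ W | f w = 0})} := by
    apply convexHull_min
    · intro w hw
      exact ⟨h w hw, fun h0 => subset_convexHull ℝ _ ⟨hw, h0⟩⟩
    · intro x hx y hy a b ha hb hab
      refine ⟨f.convex_nonneg hx.1 hy.1 ha hb hab, fun h0 => ?_⟩
      rw [f.combo hab] at h0
      have h1 : a * f x = 0 := by nlinarith [mul_nonneg ha hx.1, mul_nonneg hb hy.1]
      have h2 : b * f y = 0 := by nlinarith [mul_nonneg ha hx.1, mul_nonneg hb hy.1]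
      rcases mul_eq_zero.1 h1 with h1 | h1
      · subst h1
        have : b = 1 := by linarith
        subst this
        simp only [zero_smul, one_smul, zero_add]
        exact hy.2 (by simpa using h2)
      · rcases mul_eq_zero.1 h2 with h2 | h2
        · subst h2
          have : a = 1 := by linarith
          subst this
          simp only [zero_smul, one_smul, add_zero]
          exact hx.2 (by simpa using h1)
        · exact (convex_convexHull ℝ _) (hx.2 h1) (hy.2 h2) ha hb hab
  exact (key hx).2 h0

theorem Fn.convexHull_inter_zeros (f : Fn) {W : Set Space} (h : ∀ w ∈ W, 0 ≤ f w) :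
    {x ∈ convexHull ℝ W | f x = 0} = convexHull ℝ {w ∈ W | f w = 0} := by
  ext x
  constructor
  · rintro ⟨hx, h0⟩
    exact f.mem_convexHull_zeros h hx h0
  · intro hx
    exact ⟨convexHull_mono (Set.sep_subset _ _) hx,
      f.eq_zero_of_mem_convexHull (fun w hw => hw.2) hx⟩

/-- The convex hulls of two sets separated by `f` meet in the hull of their common points, if all
zeros of `f` on the second set are common. -/
theorem Fn.convexHull_inter_of_separates (f : Fn) {T T' : Set Space} (h : ∀ w ∈ T, 0 ≤ f w)
    (h' : ∀ w ∈ T', f w ≤ 0) (h0 : ∀ w ∈ T', f w = 0 → w ∈ T) :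
    convexHull ℝ T ∩ convexHull ℝ T' = convexHull ℝ (T ∩ T') := by
  apply subset_antisymm
  · rintro x ⟨hx, hx'⟩
    have h1 := f.nonneg_of_mem_convexHull h hx
    have h2 := (-f).nonneg_of_mem_convexHull (W := T') (by simpa using h') hx'
    have h3 : (-f) x = 0 := by simp at h2 ⊢; linarith
    have h4 := (-f).mem_convexHull_zeros (W := T') (by simpa using h') hx' h3
    refine convexHull_mono ?_ h4
    rintro w ⟨hw, hw0⟩
    exact ⟨h0 w hw (by simpa using hw0), hw⟩
  · exact Set.subset_inter (convexHull_mono Set.inter_subset_left)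
      (convexHull_mono Set.inter_subset_right)

/-- A continuous linear functional minus a constant, as an affine functional. -/
noncomputable def Fn.ofDual (l : Space →L[ℝ] ℝ) (c : ℝ) : Fn :=
  l.toLinearMap.toAffineMap - AffineMap.const ℝ Space c

@[simp] theorem Fn.ofDual_apply (l : Space →L[ℝ] ℝ) (c : ℝ) (x : Space) :
    Fn.ofDual l c x = l x - c := by
  simp [Fn.ofDual]

/-- The linear part of an affine functional, as a continuous functional. -/
noncomputable def Fn.dual (f : Fn) : Space →L[ℝ] ℝ := LinearMap.toContinuousLinearMap f.linear

theorem Fn.dual_sub (f : Fn) (x y : Space) : f.dual x - f.dual y = f x - f y := by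
  rw [← map_sub, ← f.linear_sub]; rfl

theorem finrank_ker_linear (f : Fn) {x y : Space} (h : f x ≠ f y) :
    Module.finrank ℝ (LinearMap.ker f.linear) = 2 := by
  have h0 : f.linear ≠ 0 := by
    intro h0
    apply h
    have := f.linear_sub x y
    rw [h0] at this
    simp at this
    linarith
  have h1 := Module.Dual.finrank_ker_add_one_of_ne_zero (f := f.linear) h0
  have h2 : Module.finrank ℝ Space = 3 := by simp
  omega

theorem vectorSpan_le_ker (f : Fn) {G : Set Space} (hf : ∀ x ∈ G, f x = 0) :
    vectorSpan ℝ G ≤ LinearMap.ker f.linear := by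
  rw [vectorSpan, Submodule.span_le]
  rintro _ ⟨x, hx, y, hy, rfl⟩
  simp [Fn.linear_sub, hf x hx, hf y hy]

theorem vectorSpan_eq_ker (f : Fn) {G : Set Space} (hG : Module.finrank ℝ (vectorSpan ℝ G) = 2)
    (hf : ∀ x ∈ G, f x = 0) {x y : Space} (h : f x ≠ f y) :
    vectorSpan ℝ G = LinearMap.ker f.linear :=
  Submodule.eq_of_le_of_finrank_eq (vectorSpan_le_ker f hf) (by rw [hG, finrank_ker_linear f h])

theorem nonempty_of_finrank {G : Set Space} (hG : Module.finrank ℝ (vectorSpan ℝ G) = 2) :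
    G.Nonempty := by
  by_contra h
  rw [Set.not_nonempty_iff_eq_empty] at h
  rw [h, vectorSpan_empty, finrank_bot] at hG
  omega

/-- Functionals vanishing on a common two-dimensional set are proportional. -/
theorem Fn.proportional (f g : Fn) {G : Set Space}
    (hG : Module.finrank ℝ (vectorSpan ℝ G) = 2) (hf : ∀ x ∈ G, f x = 0)
    (hg : ∀ x ∈ G, g x = 0) {y : Space} (hy : f y ≠ 0) (x : Space) :
    g x = (g y / f y) * f x := by
  obtain ⟨z, hz⟩ := nonempty_of_finrank hG
  have h1 := vectorSpan_eq_ker f hG hf (x := y) (y := z) (by rwa [hf z hz])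
  have h2 := vectorSpan_le_ker g hg
  rw [h1] at h2
  have h3 : (x - z) - (f x / f y) • (y - z) ∈ LinearMap.ker f.linear := by
    rw [LinearMap.mem_ker, map_sub, map_smul, Fn.linear_sub, Fn.linear_sub, hf z hz]
    simp [hy]
  have h4 := h2 h3
  rw [LinearMap.mem_ker, map_sub, map_smul, Fn.linear_sub, Fn.linear_sub, hg z hz] at h4
  simp at h4
  field_simp
  field_simp at h4
  linarith

/-! ### Sides of a plane -/

theorem affineSpan_eq_zeros (f : Fn) {G : Set Space}
    (hG : Module.finrank ℝ (vectorSpan ℝ G) = 2) (hf : ∀ x ∈ G, f x = 0)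
    {y : Space} (hy : f y ≠ 0) (x : Space) : x ∈ affineSpan ℝ G ↔ f x = 0 := by
  obtain ⟨z, hz⟩ := nonempty_of_finrank hG
  have h1 := vectorSpan_eq_ker f hG hf (x := y) (y := z) (by rwa [hf z hz])
  have hz' : z ∈ affineSpan ℝ G := subset_affineSpan ℝ G hz
  rw [← AffineSubspace.vsub_right_mem_direction_iff_mem hz', direction_affineSpan, h1,
    LinearMap.mem_ker, vsub_eq_sub, Fn.linear_sub, hf z hz, sub_zero]

theorem wSameSide_iff_nonneg (f : Fn) {G : Set Space}
    (hG : Module.finrank ℝ (vectorSpan ℝ G) = 2) (hf : ∀ x ∈ G, f x = 0)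
    {y : Space} (hy : 0 < f y) (x : Space) :
    (affineSpan ℝ G).WSameSide x y ↔ 0 ≤ f x := by
  have hs := affineSpan_eq_zeros f hG hf hy.ne'
  constructor
  · rintro ⟨p, hp, p', hp', h⟩
    have := h.map f.linear
    simp only [vsub_eq_sub, Fn.linear_sub, (hs p).1 hp, (hs p').1 hp', sub_zero] at this
    rcases this with h | h | ⟨r, s, hr, hs, h⟩
    · exact h.ge
    · exact absurd h hy.ne'
    · simp only [smul_eq_mul] at h
      by_contra! hx
      nlinarith [mul_pos hs hy, mul_pos_of_neg_of_neg hx (neg_lt_zero.2 hr)]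
  · intro hx
    obtain ⟨z, hz⟩ := nonempty_of_finrank hG
    rw [AffineSubspace.wSameSide_comm, AffineSubspace.wSameSide_iff_exists_left
      (subset_affineSpan ℝ G hz)]
    refine Or.inr ⟨x + (-(f x / f y)) • (y - z), ?_, ?_⟩
    · rw [hs, Fn.add_smul_sub, hf z hz]
      field_simp; ring
    · have : x -ᵥ (x + (-(f x / f y)) • (y - z)) = (f x / f y) • (y -ᵥ z) := by
        simp
      rw [this]
      exact SameRay.sameRay_nonneg_smul_right _ (by positivity)

theorem sOppSide_of_neg_of_pos (f : Fn) {G : Set Space}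
    (hG : Module.finrank ℝ (vectorSpan ℝ G) = 2) (hf : ∀ x ∈ G, f x = 0)
    {x y : Space} (hx : f x < 0) (hy : 0 < f y) : (affineSpan ℝ G).SOppSide x y := by
  have hs := affineSpan_eq_zeros f hG hf hy.ne'
  refine ⟨?_, by rw [hs]; exact hx.ne, by rw [hs]; exact hy.ne'⟩
  rw [AffineSubspace.wOppSide_iff_exists_wbtw]
  have hd : 0 < f y - f x := by linarith
  refine ⟨AffineMap.lineMap x y (-f x / (f y - f x)), ?_, ⟨_, ⟨?_, ?_⟩, rfl⟩⟩
  · rw [hs, AffineMap.lineMap_apply]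
    simp only [vsub_eq_sub, vadd_eq_add]
    rw [add_comm, Fn.add_smul_sub]
    field_simp; ring
  · apply div_nonneg <;> linarith
  · rw [div_le_one hd]; linarith

/-! ### Facets of polytopes given by inequalities -/

theorem mem_interior_of_pos {𝓕 : Set Fn} (hfin : 𝓕.Finite) {x : Space}
    (hx : ∀ f ∈ 𝓕, 0 < f x) : x ∈ interior {x | ∀ f ∈ 𝓕, 0 ≤ f x} := by
  rw [mem_interior_iff_mem_nhds]
  have : ∀ᶠ y in 𝓝 x, ∀ f ∈ 𝓕, 0 ≤ f y := by
    rw [Filter.eventually_all_finite hfin]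
    intro f hf
    filter_upwards [(f.cont.tendsto x).eventually (lt_mem_nhds (hx f hf))] with y hy using hy.le
  exact this

theorem dual_eq_zero_of_max_interior {C : Set Space} {x : Space} (hx : x ∈ interior C)
    (l : Space →L[ℝ] ℝ) (hl : ∀ y ∈ C, l y ≤ l x) : l = 0 := by
  ext v
  have hc : Filter.Tendsto (fun t : ℝ => x + t • v) (𝓝 0) (𝓝 x) := by
    have : Continuous (fun t : ℝ => x + t • v) := by fun_prop
    simpa using this.tendsto 0
  have h1 : ∀ᶠ t in 𝓝 (0 : ℝ), x + t • v ∈ C :=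
    hc.eventually (mem_interior_iff_mem_nhds.1 hx)
  obtain ⟨ε, hε, h2⟩ := Metric.eventually_nhds_iff.1 h1
  have h3 := hl _ (h2 (y := ε / 2) (by simp [abs_of_pos hε]; linarith))
  have h4 := hl _ (h2 (y := -(ε / 2)) (by simp [abs_of_pos hε]; linarith))
  simp only [map_add, map_smul, smul_eq_mul] at h3 h4
  simp only [zero_apply]
  nlinarith

theorem finrank_vectorSpan_of_interior {C : Set Space} (hC : (interior C).Nonempty) :
    Module.finrank ℝ (vectorSpan ℝ C) = 3 := by
  have h := (isOpen_interior (s := C)).affineSpan_eq_top hC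
  have h2 : affineSpan ℝ C = ⊤ := top_le_iff.1 (h ▸ affineSpan_mono ℝ interior_subset)
  rw [← direction_affineSpan, h2, AffineSubspace.direction_top]
  simp

theorem exists_dual_of_isFacet {C G : Set Space} (hG : IsFacet C G) :
    ∃ l : Space →L[ℝ] ℝ, G = {x ∈ C | ∀ y ∈ C, l y ≤ l x} :=
  hG.1 (nonempty_of_finrank hG.2)

/-- A facet is the zero set of a functional that is nonnegative on the polytope. -/
theorem exists_fn_of_isFacet {C G : Set Space} (hG : IsFacet C G) (hC : (interior C).Nonempty) :
    ∃ f : Fn, (∀ x ∈ C, 0 ≤ f x) ∧ G = {x ∈ C | f x = 0} ∧ ∃ y ∈ C, 0 < f y := by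
  obtain ⟨l, hl⟩ := exists_dual_of_isFacet hG
  obtain ⟨g, hg⟩ := nonempty_of_finrank hG.2
  have hg' := hg
  rw [hl] at hg'
  have h1 : ∀ x ∈ C, 0 ≤ (-Fn.ofDual l (l g)) x := by
    intro x hx
    have := hg'.2 x hx
    simpa using this
  have h2 : G = {x ∈ C | (-Fn.ofDual l (l g)) x = 0} := by
    ext x
    rw [hl]
    constructor
    · rintro ⟨hx, h⟩
      refine ⟨hx, ?_⟩
      have := hg'.2 x hx
      have := h g hg'.1
      simp; linarith
    · rintro ⟨hx, h⟩
      refine ⟨hx, fun y hy => ?_⟩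
      simp at h
      have := hg'.2 y hy
      linarith
  refine ⟨_, h1, h2, ?_⟩
  by_contra! h
  have : G = C := by
    rw [h2]
    ext x
    exact ⟨fun hx => hx.1, fun hx => ⟨hx, le_antisymm (h x hx) (h1 x hx)⟩⟩
  have h3 := hG.2
  rw [this, finrank_vectorSpan_of_interior hC] at h3
  omega

theorem isExposed_of_fn {C : Set Space} (f : Fn) (hf : ∀ x ∈ C, 0 ≤ f x) :
    IsExposed ℝ C {x ∈ C | f x = 0} := by
  rintro ⟨g, hg, hg0⟩
  refine ⟨-f.dual, ?_⟩
  ext x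
  simp only [Set.mem_ofPred_eq, neg_apply, neg_le_neg_iff]
  refine and_congr_right fun hx => ⟨fun h y hy => ?_, fun h => ?_⟩
  · have := f.dual_sub y x
    have := hf y hy
    linarith
  · have := f.dual_sub g x
    have := h g hg
    have := hf x hx
    linarith

/-- If two functionals are nonnegative on `C`, vanish on a common two-dimensional subset and are
not identically zero on `C`, they are positive multiples of each other. -/
theorem Fn.pos_proportional (f g : Fn) {C G : Set Space} (hC : (interior C).Nonempty)
    (hG : Module.finrank ℝ (vectorSpan ℝ G) = 2)
    (hf : ∀ x ∈ C, 0 ≤ f x) (hg : ∀ x ∈ C, 0 ≤ g x) (hf0 : ∀ x ∈ G, f x = 0)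
    (hg0 : ∀ x ∈ G, g x = 0) {y z : Space} (hy : f y ≠ 0) (hz : g z ≠ 0) :
    ∃ k : ℝ, 0 < k ∧ ∀ x, g x = k * f x := by
  have hprop := f.proportional g hG hf0 hg0 hy
  obtain ⟨w, hw⟩ : ∃ w ∈ C, f w ≠ 0 := by
    by_contra! h
    have h1 := vectorSpan_le_ker f h
    have h2 := Submodule.finrank_mono h1
    obtain ⟨u, hu⟩ := nonempty_of_finrank hG
    rw [finrank_vectorSpan_of_interior hC,
      finrank_ker_linear f (x := y) (y := u) (by rwa [hf0 u hu])] at h2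
    omega
  refine ⟨g y / f y, ?_, hprop⟩
  have h1 := hprop w
  have h2 : 0 < f w := lt_of_le_of_ne (hf w hw.1) (Ne.symm hw.2)
  have h3 := hg w hw.1
  have h4 : g y / f y ≠ 0 := by
    intro h
    apply hz
    rw [hprop z, h, zero_mul]
  refine lt_of_le_of_ne ?_ (Ne.symm h4)
  by_contra h
  push Not at h
  nlinarith [mul_pos_of_neg_of_neg h (neg_lt_zero.2 h2)]

theorem isFacet_eq_of_inequalities {C G : Set Space} {𝓕 : Set Fn} (hfin : 𝓕.Finite)
    (hC : C = {x | ∀ f ∈ 𝓕, 0 ≤ f x}) (hint : (interior C).Nonempty)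
    (hne : ∀ f ∈ 𝓕, ∃ x, f x ≠ 0) (hG : IsFacet C G) : ∃ f ∈ 𝓕, G = {x ∈ C | f x = 0} := by
  obtain ⟨g, hg, hGg, y, hyC, hy⟩ := exists_fn_of_isFacet hG hint
  have hconv : Convex ℝ G := by
    have hCc : Convex ℝ C := by
      rw [hC]
      intro x hx y hy a b ha hb hab f hf
      exact f.convex_nonneg (hx f hf) (hy f hf) ha hb hab
    rw [hGg]
    intro x hx y hy a b ha hb hab
    refine ⟨hCc hx.1 hy.1 ha hb hab, ?_⟩
    rw [g.combo hab, hx.2, hy.2]; simp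
  have hGC : G ⊆ C := by rw [hGg]; exact Set.sep_subset _ _
  obtain ⟨f, hf, hfG⟩ : ∃ f ∈ 𝓕, ∀ x ∈ G, f x = 0 := by
    by_contra! h
    have key : ∀ 𝓕' : Set Fn, 𝓕'.Finite → 𝓕' ⊆ 𝓕 → ∃ x ∈ G, ∀ f ∈ 𝓕', 0 < f x := by
      intro 𝓕' h'
      induction 𝓕', h' using Set.Finite.induction_on with
      | empty =>
        intro _
        obtain ⟨z, hz⟩ := nonempty_of_finrank hG.2
        exact ⟨z, hz, by simp⟩
      | @insert f s _ _ ih =>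
        intro hs
        obtain ⟨x, hx, hxs⟩ := ih ((Set.subset_insert _ _).trans hs)
        obtain ⟨z, hz, hfz⟩ := h f (hs (Set.mem_insert _ _))
        have hnn : ∀ w ∈ G, ∀ f ∈ 𝓕, 0 ≤ f w := fun w hw => by
          have := hGC hw; rw [hC] at this; exact this
        refine ⟨(1 / 2 : ℝ) • x + (1 / 2 : ℝ) • z,
          hconv hx hz (by norm_num) (by norm_num) (by norm_num), ?_⟩
        intro f' hf'
        rw [f'.combo (by norm_num)]
        have h1 := hnn x hx f' (hs hf')
        have h2 := hnn z hz f' (hs hf')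
        rcases Set.mem_insert_iff.1 hf' with rfl | hf''
        · have := lt_of_le_of_ne h2 (Ne.symm hfz)
          linarith
        · have := hxs f' hf''
          linarith
    obtain ⟨x, hxG, hx⟩ := key 𝓕 hfin subset_rfl
    have hxi : x ∈ interior C := by rw [hC]; exact mem_interior_of_pos hfin hx
    have hx0 : g x = 0 := by rw [hGg] at hxG; exact hxG.2
    have h0 := dual_eq_zero_of_max_interior hxi (-g.dual) (fun w hw => by
      have := g.dual_sub w x
      have := hg w hw
      simp; linarith)
    have h1 := g.dual_sub y x
    have h2 : g.dual = 0 := neg_eq_zero.1 h0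
    rw [h2, hx0] at h1
    simp at h1
    linarith
  refine ⟨f, hf, subset_antisymm (fun x hx => ⟨hGC hx, hfG x hx⟩) ?_⟩
  rintro x ⟨hxC, hx0⟩
  obtain ⟨z, hz⟩ := hne f hf
  rw [hGg]
  refine ⟨hxC, ?_⟩
  rw [f.proportional g hG.2 hfG (fun w hw => by rw [hGg] at hw; exact hw.2) hz x, hx0, mul_zero]

/-- A closed convex set contains every compact set whose frontier it contains. -/
theorem subset_of_frontier_subset {S C : Set Space} (hS : IsCompact S) (hC : IsClosed C)
    (hCc : Convex ℝ C) (h : frontier S ⊆ C) : S ⊆ C := by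
  intro x hx
  by_contra hxC
  obtain ⟨l, u, h1, h2⟩ := geometric_hahn_banach_closed_point hCc hC hxC
  obtain ⟨y, hy, hmax⟩ := hS.exists_isMaxOn ⟨x, hx⟩ l.continuous.continuousOn
  have hyC : y ∉ C := fun hyC => by
    have := h1 y hyC
    have : l x ≤ l y := hmax hx
    linarith
  have hyi : y ∈ interior S := by
    by_contra hyi
    exact hyC (h ⟨subset_closure hy, hyi⟩)
  have h0 := dual_eq_zero_of_max_interior hyi l (fun z hz => hmax hz)
  by_cases hne : (frontier S).Nonempty
  · obtain ⟨w, hw⟩ := hne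
    have := h1 w (h hw)
    rw [h0] at this h2
    simp at this h2
    linarith
  · rw [Set.not_nonempty_iff_eq_empty] at hne
    have hcl : IsClopen S := isClopen_iff_frontier_eq_empty.2 hne
    rcases isClopen_iff.1 hcl with h3 | h3
    · rw [h3] at hx; exact hx
    · rw [h3] at hS
      exact (NormedSpace.noncompactSpace ℝ Space).noncompact_univ hS

/-! ### Coordinates adapted to a triangular cone -/

section cyclic

theorem add_one_add_one (i : Fin 3) : i + 1 + 1 = i + 2 := by decide +revert
theorem add_one_add_two (i : Fin 3) : i + 1 + 2 = i := by decide +revert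
theorem add_two_add_one (i : Fin 3) : i + 2 + 1 = i := by decide +revert
theorem add_two_add_two (i : Fin 3) : i + 2 + 2 = i + 1 := by decide +revert

theorem eq_or_eq_add (i j : Fin 3) : j = i ∨ j = i + 1 ∨ j = i + 2 := by decide +revert

theorem forall_cyclic (i : Fin 3) {Q : Fin 3 → Prop} (h0 : Q i) (h1 : Q (i + 1))
    (h2 : Q (i + 2)) (j : Fin 3) : Q j := by
  rcases eq_or_eq_add i j with rfl | rfl | rfl <;> assumption

end cyclic

theorem Fn.combo3 (f : Fn) {a b c : ℝ} (h : a + b + c = 1) (x y z : Space) :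
    f (a • x + b • y + c • z) = a * f x + b * f y + c * f z := by
  have hx : a • x + b • y + c • z = (z + a • (x - z)) + b • (y - z) := by
    obtain rfl : c = 1 - a - b := by linarith
    module
  rw [hx, Fn.add_smul_sub, Fn.add_smul_sub]
  obtain rfl : c = 1 - a - b := by linarith
  ring

theorem Fn.combo4 (f : Fn) {a b c d : ℝ} (h : a + b + c + d = 1) (x y z w : Space) :
    f (a • x + b • y + c • z + d • w) = a * f x + b * f y + c * f z + d * f w := by
  have hx : a • x + b • y + c • z + d • w =
      ((w + a • (x - w)) + b • (y - w)) + c • (z - w) := by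
    obtain rfl : d = 1 - a - b - c := by linarith
    module
  rw [hx, Fn.add_smul_sub, Fn.add_smul_sub, Fn.add_smul_sub]
  obtain rfl : d = 1 - a - b - c := by linarith
  ring

theorem mem_convexHull_three {a b c : ℝ} (ha : 0 ≤ a) (hb : 0 ≤ b) (hc : 0 ≤ c)
    (h : a + b + c = 1) {W : Set Space} {x y z : Space} (hx : x ∈ W) (hy : y ∈ W) (hz : z ∈ W) :
    a • x + b • y + c • z ∈ convexHull ℝ W := by
  have := (convex_convexHull ℝ W).sum_mem (t := Finset.univ) (w := ![a, b, c]) (z := ![x, y, z])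
    (by intro i _; fin_cases i <;> simpa) (by simpa [Fin.sum_univ_three] using h)
    (by intro i _; fin_cases i <;> exact subset_convexHull ℝ W (by simpa))
  simpa [Fin.sum_univ_three] using this

theorem mem_convexHull_four {a b c d : ℝ} (ha : 0 ≤ a) (hb : 0 ≤ b) (hc : 0 ≤ c) (hd : 0 ≤ d)
    (h : a + b + c + d = 1) {W : Set Space} {x y z w : Space} (hx : x ∈ W) (hy : y ∈ W)
    (hz : z ∈ W) (hw : w ∈ W) :
    a • x + b • y + c • z + d • w ∈ convexHull ℝ W := by
  have := (convex_convexHull ℝ W).sum_mem (t := Finset.univ) (w := ![a, b, c, d])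
    (z := ![x, y, z, w])
    (by intro i _; fin_cases i <;> simpa) (by simpa [Fin.sum_univ_four] using h)
    (by intro i _; fin_cases i <;> exact subset_convexHull ℝ W (by simpa))
  simpa [Fin.sum_univ_four] using this

theorem affineIndependent_of_fns {T : Fin 3 → Space} (f : Fin 3 → Fn)
    (hd : ∀ i, f i (T i) ≠ 0) (ho : ∀ i j, j ≠ i → f i (T j) = 0) : AffineIndependent ℝ T := by
  rw [affineIndependent_iff]
  intro s w hw hs i hi
  have h1 : ∑ j ∈ s, w j * f i (T j) = 0 := by
    have h2 : ∀ x, f i x = (f i).linear x + f i 0 := fun x => by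
      have := (f i).linear_sub x 0
      rw [sub_zero] at this
      linarith
    have h3 : ∑ j ∈ s, w j * f i (T j) = (f i).linear (∑ j ∈ s, w j • T j) +
        (∑ j ∈ s, w j) * f i 0 := by
      rw [map_sum, Finset.sum_mul, ← Finset.sum_add_distrib]
      refine Finset.sum_congr rfl fun j _ => ?_
      rw [h2 (T j), map_smul, smul_eq_mul]; ring
    rw [h3, hs, hw]; simp
  rw [Finset.sum_eq_single i (fun j _ hj => by rw [ho i j hj, mul_zero])
    (fun h => absurd hi h)] at h1
  exact (mul_eq_zero.1 h1).resolve_right (hd i)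

/-- An affine coordinate system with apex `p` and axes `e`, and the parameters of a cupola with
skylight `p + eᵢ`: the bottom lies in the plane where the coordinates sum to
`lam = mu * (gam - 2)`. -/
structure Frame where
  p : Space
  e : Module.Basis (Fin 3) ℝ Space
  mu : ℝ
  gam : ℝ
  mu_pos : 0 < mu
  mu_le : mu ≤ 1 / 16
  le_gam : 14 ≤ gam
  lam_le : mu * (gam - 2) - 1 ≤ mu / 4
  le_lam : 1 - mu * (gam - 2) ≤ mu / 4
  lam_ne : mu * (gam - 2) ≠ 1

namespace Frame
variable (D : Frame)

/-- The sum of the coordinates on the bottom plane. -/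
def lam : ℝ := D.mu * (D.gam - 2)

/-- The coordinates of a point. -/
noncomputable def t (i : Fin 3) : Fn :=
  (D.e.coord i).toAffineMap - AffineMap.const ℝ Space (D.e.coord i D.p)

theorem t_apply (i : Fin 3) (x : Space) : D.t i x = D.e.coord i x - D.e.coord i D.p := by
  simp [t]

/-- The height functional, which is `1` on the bottom and `0` on the skylight. -/
noncomputable def h : Fn :=
  (1 - D.lam)⁻¹ • (AffineMap.const ℝ Space 1 - D.t 0 - D.t 1 - D.t 2)

/-- The bottom vertices. -/
noncomputable def A (i : Fin 3) : Space := D.p + (D.lam + D.mu) • D.e i - D.mu • D.e (i + 2)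

/-- The skylight vertices. -/
noncomputable def B (i : Fin 3) : Space := D.p + D.e i

/-- The functional vanishing at `Aᵢ`, `Bᵢ`, `Aᵢ₊₁` with value `1` at `Bᵢ₊₁`. -/
noncomputable def b (i : Fin 3) : Fn :=
  AffineMap.const ℝ Space 1 - D.t i - D.gam • D.t (i + 2) - (1 + D.mu) • D.h

/-- The functional vanishing at `Bᵢ`, `Bᵢ₊₁`, `Aᵢ₊₁` with value `1` at `Aᵢ`. -/
noncomputable def a (i : Fin 3) : Fn := (-D.mu⁻¹) • D.t (i + 2)

/-- The functional vanishing at `Aᵢ`, `Aᵢ₊₁`, `Bᵢ₊₁` with value `1` at `Bᵢ`. -/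
noncomputable def u (i : Fin 3) : Fn := AffineMap.const ℝ Space 1 - D.h - D.b i

/-- The functional vanishing at `Aᵢ`, `Bᵢ`, `Bᵢ₊₁` with value `1` at `Aᵢ₊₁`. -/
noncomputable def v (i : Fin 3) : Fn := D.h - D.a i

theorem b_apply (i : Fin 3) (x : Space) :
    D.b i x = 1 - D.t i x - D.gam * D.t (i + 2) x - (1 + D.mu) * D.h x := by simp [b]

theorem a_apply (i : Fin 3) (x : Space) : D.a i x = -D.mu⁻¹ * D.t (i + 2) x := by simp [a]

theorem u_apply (i : Fin 3) (x : Space) : D.u i x = 1 - D.h x - D.b i x := by simp [u]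

theorem v_apply (i : Fin 3) (x : Space) : D.v i x = D.h x - D.a i x := by simp [v]

theorem one_sub_lam_ne : 1 - D.lam ≠ 0 := sub_ne_zero.2 (Ne.symm D.lam_ne)

theorem mul_a (i : Fin 3) (x : Space) : D.t (i + 2) x = -D.mu * D.a i x := by
  rw [a_apply]; field_simp [D.mu_pos.ne']

theorem sum_t (i : Fin 3) (x : Space) :
    D.t i x + D.t (i + 1) x + D.t (i + 2) x = 1 - (1 - D.lam) * D.h x := by
  have h0 : D.t 0 x + D.t 1 x + D.t 2 x = 1 - (1 - D.lam) * D.h x := by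
    simp only [h, AffineMap.coe_smul, AffineMap.coe_sub, Pi.smul_apply, Pi.sub_apply,
      AffineMap.const_apply, smul_eq_mul]
    rw [mul_inv_cancel_left₀ D.one_sub_lam_ne]; ring
  fin_cases i
  · exact h0
  · change D.t 1 x + D.t 2 x + D.t 0 x = _; linarith
  · change D.t 2 x + D.t 0 x + D.t 1 x = _; linarith

theorem ext_t {x y : Space} (h : ∀ i, D.t i x = D.t i y) : x = y := by
  apply D.e.ext_elem
  intro i
  have := h i
  simp only [t_apply, Module.Basis.coord_apply] at this
  linarith

theorem t_A (j i : Fin 3) :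
    D.t j (D.A i) = (if j = i then D.lam + D.mu else 0) - (if j = i + 2 then D.mu else 0) := by
  simp only [t_apply, A, map_sub, map_add, map_smul, Module.Basis.coord_apply,
    Module.Basis.repr_self, Finsupp.single_apply, smul_eq_mul, eq_comm (a := j)]
  split_ifs <;> (simp; try ring)

theorem t_B (j i : Fin 3) : D.t j (D.B i) = if j = i then 1 else 0 := by
  simp [t_apply, B, Finsupp.single_apply, eq_comm (a := j)]

@[simp] theorem t_A00 (i : Fin 3) : D.t i (D.A i) = D.lam + D.mu := by
  rw [t_A]; fin_cases i <;> simp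
@[simp] theorem t_A10 (i : Fin 3) : D.t (i + 1) (D.A i) = 0 := by
  rw [t_A]; fin_cases i <;> simp
@[simp] theorem t_A20 (i : Fin 3) : D.t (i + 2) (D.A i) = -D.mu := by
  rw [t_A]; fin_cases i <;> simp
@[simp] theorem t_A01 (i : Fin 3) : D.t i (D.A (i + 1)) = -D.mu := by
  rw [t_A]; fin_cases i <;> simp
@[simp] theorem t_A21 (i : Fin 3) : D.t (i + 2) (D.A (i + 1)) = 0 := by
  rw [t_A]; fin_cases i <;> simp
@[simp] theorem t_A02 (i : Fin 3) : D.t i (D.A (i + 2)) = 0 := by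
  rw [t_A]; fin_cases i <;> simp
@[simp] theorem t_B00 (i : Fin 3) : D.t i (D.B i) = 1 := by simp [t_B]
@[simp] theorem t_B10 (i : Fin 3) : D.t (i + 1) (D.B i) = 0 := by
  rw [t_B]; fin_cases i <;> simp
@[simp] theorem t_B20 (i : Fin 3) : D.t (i + 2) (D.B i) = 0 := by
  rw [t_B]; fin_cases i <;> simp
@[simp] theorem t_B01 (i : Fin 3) : D.t i (D.B (i + 1)) = 0 := by
  rw [t_B]; fin_cases i <;> simp
@[simp] theorem t_B21 (i : Fin 3) : D.t (i + 2) (D.B (i + 1)) = 0 := by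
  rw [t_B]; fin_cases i <;> simp
@[simp] theorem t_B02 (i : Fin 3) : D.t i (D.B (i + 2)) = 0 := by
  rw [t_B]; fin_cases i <;> simp
@[simp] theorem t_B12 (i : Fin 3) : D.t (i + 1) (D.B (i + 2)) = 0 := by
  rw [t_B]; fin_cases i <;> simp

@[simp] theorem h_A (i : Fin 3) : D.h (D.A i) = 1 := by
  have := D.sum_t i (D.A i)
  simp only [t_A00, t_A10, t_A20] at this
  have h2 := D.one_sub_lam_ne
  have : (1 - D.lam) * (D.h (D.A i) - 1) = 0 := by linarith
  have := (mul_eq_zero.1 this).resolve_left h2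
  linarith

@[simp] theorem h_B (i : Fin 3) : D.h (D.B i) = 0 := by
  have := D.sum_t i (D.B i)
  simp only [t_B00, t_B10, t_B20] at this
  have h2 := D.one_sub_lam_ne
  have : (1 - D.lam) * (D.h (D.B i)) = 0 := by linarith
  exact (mul_eq_zero.1 this).resolve_left h2

@[simp] theorem b_A00 (i : Fin 3) : D.b i (D.A i) = 0 := by simp [b_apply, lam]; ring
@[simp] theorem b_A01 (i : Fin 3) : D.b i (D.A (i + 1)) = 0 := by simp [b_apply]
@[simp] theorem b_A02 (i : Fin 3) :
    D.b i (D.A (i + 2)) = -(D.mu * (D.gam * (D.gam - 1) + 1)) := by simp [b_apply, lam]; ring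
@[simp] theorem b_A10 (i : Fin 3) :
    D.b (i + 1) (D.A i) = -(D.mu * (D.gam * (D.gam - 1) + 1)) := by
  simpa [add_one_add_two] using D.b_A02 (i + 1)
@[simp] theorem b_A12 (i : Fin 3) : D.b (i + 1) (D.A (i + 2)) = 0 := by
  simpa [add_one_add_one] using D.b_A01 (i + 1)
@[simp] theorem b_A20 (i : Fin 3) : D.b (i + 2) (D.A i) = 0 := by
  simpa [add_two_add_one] using D.b_A01 (i + 2)
@[simp] theorem b_A21 (i : Fin 3) :
    D.b (i + 2) (D.A (i + 1)) = -(D.mu * (D.gam * (D.gam - 1) + 1)) := by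
  simpa [add_two_add_two] using D.b_A02 (i + 2)
@[simp] theorem b_B00 (i : Fin 3) : D.b i (D.B i) = 0 := by simp [b_apply]
@[simp] theorem b_B01 (i : Fin 3) : D.b i (D.B (i + 1)) = 1 := by simp [b_apply]
@[simp] theorem b_B02 (i : Fin 3) : D.b i (D.B (i + 2)) = 1 - D.gam := by simp [b_apply]
@[simp] theorem b_B10 (i : Fin 3) : D.b (i + 1) (D.B i) = 1 - D.gam := by
  simpa [add_one_add_two] using D.b_B02 (i + 1)
@[simp] theorem b_B12 (i : Fin 3) : D.b (i + 1) (D.B (i + 2)) = 1 := by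
  simpa [add_one_add_one] using D.b_B01 (i + 1)
@[simp] theorem b_B20 (i : Fin 3) : D.b (i + 2) (D.B i) = 1 := by
  simpa [add_two_add_one] using D.b_B01 (i + 2)

@[simp] theorem a_A00 (i : Fin 3) : D.a i (D.A i) = 1 := by simp [a_apply, D.mu_pos.ne']
@[simp] theorem a_A01 (i : Fin 3) : D.a i (D.A (i + 1)) = 0 := by simp [a_apply]
@[simp] theorem a_A02 (i : Fin 3) : D.a i (D.A (i + 2)) = -(D.gam - 1) := by
  simp [a_apply, lam]; field_simp [D.mu_pos.ne']; ring
@[simp] theorem a_B00 (i : Fin 3) : D.a i (D.B i) = 0 := by simp [a_apply]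
@[simp] theorem a_B01 (i : Fin 3) : D.a i (D.B (i + 1)) = 0 := by simp [a_apply]
@[simp] theorem a_B02 (i : Fin 3) : D.a i (D.B (i + 2)) = -D.mu⁻¹ := by simp [a_apply]

/-- The barycentric representation of a point in the tetrahedron `Aᵢ Bᵢ₊₁ Bᵢ Aᵢ₊₁`. -/
theorem tetra (i : Fin 3) (x : Space) :
    D.a i x • D.A i + D.b i x • D.B (i + 1) + D.u i x • D.B i + D.v i x • D.A (i + 1) = x := by
  have hs : D.a i x + D.b i x + D.u i x + D.v i x = 1 := by rw [u_apply, v_apply]; ring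
  have h0 : ∀ f : Fn, f (D.a i x • D.A i + D.b i x • D.B (i + 1) + D.u i x • D.B i +
      D.v i x • D.A (i + 1)) = _ := fun f => f.combo4 hs _ _ _ _
  have e0 : D.t (i + 2) (D.a i x • D.A i + D.b i x • D.B (i + 1) + D.u i x • D.B i +
      D.v i x • D.A (i + 1)) = D.t (i + 2) x := by
    rw [h0, D.mul_a i x]; simp; ring
  have e1 : D.h (D.a i x • D.A i + D.b i x • D.B (i + 1) + D.u i x • D.B i +
      D.v i x • D.A (i + 1)) = D.h x := by
    rw [h0]; simp [v_apply]
  have e2 : D.b i (D.a i x • D.A i + D.b i x • D.B (i + 1) + D.u i x • D.B i +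
      D.v i x • D.A (i + 1)) = D.b i x := by
    rw [h0]; simp
  generalize D.a i x • D.A i + D.b i x • D.B (i + 1) + D.u i x • D.B i +
      D.v i x • D.A (i + 1) = y at *
  rw [b_apply, b_apply, e0, e1] at e2
  have s1 := D.sum_t i x
  have s2 := D.sum_t i y
  rw [e1] at s2
  apply D.ext_t
  refine forall_cyclic i (Q := fun j => D.t j y = D.t j x) ?_ ?_ ?_ <;> linarith

theorem lam_pos : 15 / 16 ≤ D.lam := by
  have := D.le_lam; have := D.mu_le; rw [lam]; linarith

theorem lam_lt : D.lam ≤ 17 / 16 := by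
  have := D.lam_le; have := D.mu_le; rw [lam]; linarith

end Frame

namespace Frame
variable (D : Frame)

/-! ### The Schönhardt polytope of a frame -/

/-- The solid bounded by the eight triangles of `schonhardtFacets D.A D.B`. -/
def solid : Set Space := {x | 0 ≤ D.h x ∧ D.h x ≤ 1 ∧ ∀ i, D.b i x ≤ 0 ∨ 0 ≤ D.t (i + 2) x}

/-- The interior of `solid`. -/
def core : Set Space := {x | 0 < D.h x ∧ D.h x < 1 ∧ ∀ i, D.b i x < 0 ∨ 0 < D.t (i + 2) x}

theorem b_add_one (i : Fin 3) (x : Space) :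
    D.b (i + 1) x = 1 - D.t (i + 1) x - D.gam * D.t i x - (1 + D.mu) * D.h x := by
  rw [b_apply, add_one_add_two]

theorem b_add_two (i : Fin 3) (x : Space) :
    D.b (i + 2) x = 1 - D.t (i + 2) x - D.gam * D.t (i + 1) x - (1 + D.mu) * D.h x := by
  rw [b_apply, add_two_add_two]

theorem bA_pos : 0 < D.mu * (D.gam * (D.gam - 1) + 1) := by
  have := D.mu_pos
  have := D.le_gam
  have : 0 < D.gam - 1 := by linarith
  positivity

theorem triangle_subset {W : Set Space} (hW : W ∈ (fun T => convexHull ℝ (Set.range T)) ''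
    schonhardtFacets D.A D.B) :
    W ⊆ ⋃ T ∈ schonhardtFacets D.A D.B, convexHull ℝ (Set.range T) := by
  obtain ⟨T, hT, rfl⟩ := hW
  exact Set.subset_biUnion_of_mem (u := fun T => convexHull ℝ (Set.range T)) hT

theorem bottom_mem : D.A ∈ schonhardtFacets D.A D.B := Or.inl (Or.inl (Or.inl rfl))
theorem skylight_mem : D.B ∈ schonhardtFacets D.A D.B := Or.inl (Or.inl (Or.inr rfl))
theorem slope_mem (i : Fin 3) : ![D.A i, D.B i, D.A (i + 1)] ∈ schonhardtFacets D.A D.B :=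
  Or.inl (Or.inr ⟨i, rfl⟩)
theorem wall_mem (i : Fin 3) : ![D.B i, D.A (i + 1), D.B (i + 1)] ∈ schonhardtFacets D.A D.B :=
  Or.inr ⟨i, rfl⟩

theorem mem_skylight {x : Space} (h0 : D.h x = 0) (ht : ∀ i, 0 ≤ D.t i x) :
    x ∈ convexHull ℝ (Set.range D.B) := by
  have hs := D.sum_t 0 x
  simp only [zero_add, h0, mul_zero, sub_zero] at hs
  have hx : x = D.t 0 x • D.B 0 + D.t 1 x • D.B 1 + D.t 2 x • D.B 2 := by
    apply D.ext_t
    intro i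
    rw [Fn.combo3 _ hs]
    fin_cases i <;> simp [t_B]
  rw [hx]
  exact mem_convexHull_three (ht 0) (ht 1) (ht 2) hs ⟨0, rfl⟩ ⟨1, rfl⟩ ⟨2, rfl⟩

theorem mem_bottom {x : Space} (h1 : D.h x = 1) (hb : ∀ i, D.b i x ≤ 0) :
    x ∈ convexHull ℝ (Set.range D.A) := by
  have hK := D.bA_pos
  set K := D.mu * (D.gam * (D.gam - 1) + 1) with hKdef
  have hs := D.sum_t 0 x
  have b0 := D.b_apply 0 x
  have b1 := D.b_add_one 0 x
  have b2 := D.b_add_two 0 x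
  simp only [zero_add, h1, mul_one, sub_sub_cancel] at hs b0 b1 b2
  have hsum : -D.b 1 x / K + -D.b 2 x / K + -D.b 0 x / K = 1 := by
    rw [← add_div, ← add_div, div_eq_one_iff_eq hK.ne', b0, b1, b2, hKdef]
    rw [lam] at hs
    linear_combination (1 + D.gam) * hs
  have hx : x = (-D.b 1 x / K) • D.A 0 + (-D.b 2 x / K) • D.A 1 + (-D.b 0 x / K) • D.A 2 := by
    apply D.ext_t
    intro i
    rw [Fn.combo3 _ hsum]
    have e0 : K * D.t i x = -D.b 1 x * D.t i (D.A 0) + -D.b 2 x * D.t i (D.A 1) +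
        -D.b 0 x * D.t i (D.A 2) := by
      rw [b0, b1, b2, hKdef]
      rw [lam] at hs
      fin_cases i <;> simp [t_A, lam] <;> linear_combination D.mu * hs
    field_simp
    linarith
  rw [hx]
  exact mem_convexHull_three (div_nonneg (neg_nonneg.2 (hb 1)) hK.le)
    (div_nonneg (neg_nonneg.2 (hb 2)) hK.le) (div_nonneg (neg_nonneg.2 (hb 0)) hK.le) hsum
    ⟨0, rfl⟩ ⟨1, rfl⟩ ⟨2, rfl⟩

theorem mem_slope {i : Fin 3} {x : Space} (hb : D.b i x = 0) (ha : 0 ≤ D.a i x)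
    (hu : 0 ≤ D.u i x) (hv : 0 ≤ D.v i x) :
    x ∈ convexHull ℝ (Set.range ![D.A i, D.B i, D.A (i + 1)]) := by
  have h := D.tetra i x
  rw [hb, zero_smul, add_zero] at h
  rw [← h]
  refine mem_convexHull_three ha hu hv ?_ ⟨0, rfl⟩ ⟨1, rfl⟩ ⟨2, rfl⟩
  rw [u_apply, v_apply, hb]; ring

theorem mem_wall {i : Fin 3} {x : Space} (ha : D.a i x = 0) (hb : 0 ≤ D.b i x)
    (hu : 0 ≤ D.u i x) (hv : 0 ≤ D.v i x) :
    x ∈ convexHull ℝ (Set.range ![D.B i, D.A (i + 1), D.B (i + 1)]) := by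
  have h := D.tetra i x
  rw [ha, zero_smul, zero_add] at h
  rw [← h]
  have : D.b i x • D.B (i + 1) + D.u i x • D.B i + D.v i x • D.A (i + 1) =
      D.u i x • D.B i + D.v i x • D.A (i + 1) + D.b i x • D.B (i + 1) := by abel
  rw [this]
  refine mem_convexHull_three hu hv hb ?_ ⟨0, rfl⟩ ⟨1, rfl⟩ ⟨2, rfl⟩
  rw [u_apply, v_apply, ha]; ring

/-- A condition of `solid` read off at the three consecutive indices. -/
theorem solid_cond {x : Space} (hx : x ∈ D.solid) (i : Fin 3) :
    (D.b i x ≤ 0 ∨ 0 ≤ D.t (i + 2) x) ∧ (D.b (i + 1) x ≤ 0 ∨ 0 ≤ D.t i x) ∧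
      (D.b (i + 2) x ≤ 0 ∨ 0 ≤ D.t (i + 1) x) := by
  have h1 := hx.2.2 (i + 1)
  have h2 := hx.2.2 (i + 2)
  rw [add_one_add_two] at h1
  rw [add_two_add_two] at h2
  exact ⟨hx.2.2 i, h1, h2⟩

theorem t_nonneg_of_h_eq_zero {x : Space} (hx : x ∈ D.solid) (h0 : D.h x = 0) (i : Fin 3) :
    0 ≤ D.t i x := by
  suffices H : ∀ i, 0 ≤ D.t (i + 2) x by
    have := H (i + 1)
    rwa [add_one_add_two] at this
  intro i
  by_contra! hn
  obtain ⟨c0, c1, c2⟩ := D.solid_cond hx i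
  have hs := D.sum_t i x
  rw [D.b_apply] at c0
  rw [D.b_add_two] at c2
  have hg := D.le_gam
  simp only [h0, mul_zero, sub_zero] at hs c0 c2
  have c0 := c0.resolve_right (not_le.2 hn)
  have h1 : D.t (i + 1) x < 0 := by nlinarith
  have c2 := c2.resolve_right (not_le.2 h1)
  nlinarith

theorem b_nonpos_of_h_eq_one {x : Space} (hx : x ∈ D.solid) (h0 : D.h x = 1) (i : Fin 3) :
    D.b i x ≤ 0 := by
  by_contra! hn
  obtain ⟨c0, c1, c2⟩ := D.solid_cond hx i
  have hs := D.sum_t i x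
  have hg := D.le_gam
  have hm := D.mu_pos
  rw [D.b_add_one] at c1
  have c0 := c0.resolve_left (not_le.2 hn)
  rw [D.b_apply] at hn
  simp only [h0, lam] at hs hn c1
  have h1 : 0 ≤ D.gam * D.t (i + 2) x := by positivity
  have h2 : D.t i x < 0 := by linarith
  have c1 := c1.resolve_right (not_le.2 h2)
  nlinarith

theorem mem_triangle_of_not_mem_core {x : Space} (hx : x ∈ D.solid) (hc : x ∉ D.core) :
    x ∈ ⋃ T ∈ schonhardtFacets D.A D.B, convexHull ℝ (Set.range T) := by
  by_cases h0 : D.h x = 0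
  · exact D.triangle_subset ⟨_, D.skylight_mem, rfl⟩
      (D.mem_skylight h0 (D.t_nonneg_of_h_eq_zero hx h0))
  by_cases h1 : D.h x = 1
  · exact D.triangle_subset ⟨_, D.bottom_mem, rfl⟩
      (D.mem_bottom h1 (D.b_nonpos_of_h_eq_one hx h1))
  obtain ⟨i, hi⟩ : ∃ i, ¬(D.b i x < 0 ∨ 0 < D.t (i + 2) x) := by
    by_contra! h
    exact hc ⟨lt_of_le_of_ne hx.1 (Ne.symm h0), lt_of_le_of_ne hx.2.1 h1, h⟩
  push Not at hi
  obtain ⟨hb, ht⟩ := hi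
  obtain ⟨c0, c1, c2⟩ := D.solid_cond hx i
  have hs := D.sum_t i x
  have hg := D.le_gam
  have hm := D.mu_pos
  have hh := hx.1
  have hh1 := hx.2.1
  have ha : 0 ≤ D.a i x := by
    rw [a_apply]
    have : 0 < D.mu⁻¹ := by positivity
    nlinarith
  have hbx := D.b_apply i x
  rcases c0 with c0 | c0
  · have hb0 : D.b i x = 0 := le_antisymm c0 hb
    have hu : 0 ≤ D.u i x := by rw [u_apply, hb0]; linarith
    refine D.triangle_subset ⟨_, D.slope_mem i, rfl⟩ (D.mem_slope hb0 ha hu ?_)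
    have hta := D.mul_a i x
    rw [v_apply]
    rw [hb0] at hbx
    rw [D.b_add_two] at c2
    by_contra! hv
    rw [lam] at hs
    have hy : D.t (i + 2) x + D.mu * D.h x < 0 := by rw [hta]; nlinarith
    have ht1 : D.t (i + 1) x = (D.gam - 1) * (D.t (i + 2) x + D.mu * D.h x) := by
      linear_combination hs - hbx
    have ht1' : D.t (i + 1) x < 0 := by rw [ht1]; nlinarith
    have c2 := c2.resolve_right (not_le.2 ht1')
    nlinarith
  · have ht0 : D.t (i + 2) x = 0 := le_antisymm ht c0
    have ha0 : D.a i x = 0 := by rw [a_apply, ht0, mul_zero]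
    have hv : 0 ≤ D.v i x := by rw [v_apply, ha0]; linarith
    refine D.triangle_subset ⟨_, D.wall_mem i, rfl⟩ (D.mem_wall ha0 hb ?_ hv)
    rw [u_apply]
    rw [ht0] at hbx hs
    rw [D.b_add_one] at c1
    rw [lam] at hs
    by_contra! hu
    have hu' : D.t i x + D.mu * D.h x < 0 := by linarith
    have hti : D.t i x < 0 := by nlinarith
    have c1 := c1.resolve_right (not_le.2 hti)
    nlinarith

end Frame

namespace Frame
variable (D : Frame)

theorem lam_add_mu_pos : 0 < D.lam + D.mu := by
  have := D.lam_pos; have := D.mu_pos; linarith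

/-- A functional that is nonnegative on the vertices of a triangle is nonnegative on it. -/
theorem nonneg_of_mem_triangle (f : Fn) {T : Fin 3 → Space} (h : ∀ j, 0 ≤ f (T j)) {x : Space}
    (hx : x ∈ convexHull ℝ (Set.range T)) : 0 ≤ f x :=
  f.nonneg_of_mem_convexHull (by rintro _ ⟨j, rfl⟩; exact h j) hx

theorem nonpos_of_mem_triangle (f : Fn) {T : Fin 3 → Space} (h : ∀ j, f (T j) ≤ 0) {x : Space}
    (hx : x ∈ convexHull ℝ (Set.range T)) : f x ≤ 0 := by
  have := nonneg_of_mem_triangle (-f) (T := T) (by simpa using h) hx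
  simpa using this

theorem nonneg_of_mem_three (f : Fn) {x P Q R : Space}
    (hx : x ∈ convexHull ℝ (Set.range ![P, Q, R])) (hP : 0 ≤ f P) (hQ : 0 ≤ f Q)
    (hR : 0 ≤ f R) : 0 ≤ f x :=
  nonneg_of_mem_triangle f (T := ![P, Q, R]) (by intro j; fin_cases j <;> assumption) hx

theorem nonpos_of_mem_three (f : Fn) {x P Q R : Space}
    (hx : x ∈ convexHull ℝ (Set.range ![P, Q, R])) (hP : f P ≤ 0) (hQ : f Q ≤ 0)
    (hR : f R ≤ 0) : f x ≤ 0 :=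
  nonpos_of_mem_triangle f (T := ![P, Q, R]) (by intro j; fin_cases j <;> assumption) hx

theorem le_one_of_mem_three (f : Fn) {x P Q R : Space}
    (hx : x ∈ convexHull ℝ (Set.range ![P, Q, R])) (hP : f P ≤ 1) (hQ : f Q ≤ 1)
    (hR : f R ≤ 1) : f x ≤ 1 := by
  have := nonpos_of_mem_three (f - AffineMap.const ℝ Space 1) hx (by simpa) (by simpa) (by simpa)
  simpa using this

theorem mem_solid_of_mem_triangle {T : Fin 3 → Space} (hT : T ∈ schonhardtFacets D.A D.B)
    {x : Space} (hx : x ∈ convexHull ℝ (Set.range T)) : x ∈ D.solid ∧ x ∉ D.core := by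
  have hK := D.bA_pos
  have hg := D.le_gam
  have hl := D.lam_add_mu_pos
  have hm := D.mu_pos
  rcases hT with ((rfl | rfl) | ⟨i, rfl⟩) | ⟨i, rfl⟩
  · have h1 : D.h x = 1 := le_antisymm
      (by have := nonpos_of_mem_triangle (D.h - AffineMap.const ℝ Space 1) (by simp) hx
          simpa using this)
      (by have := nonneg_of_mem_triangle (D.h - AffineMap.const ℝ Space 1) (by simp) hx
          simpa using this)
    refine ⟨⟨by linarith, by linarith, fun i => Or.inl ?_⟩, fun h => by
      have := h.2.1; linarith⟩
    refine nonpos_of_mem_triangle _ (forall_cyclic i ?_ ?_ ?_) hx <;> simp [hK.le]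
  · have h1 : D.h x = 0 := le_antisymm
      (nonpos_of_mem_triangle D.h (by simp) hx) (nonneg_of_mem_triangle D.h (by simp) hx)
    refine ⟨⟨by linarith, by linarith, fun i => Or.inr ?_⟩, fun h => by
      have := h.1; linarith⟩
    refine nonneg_of_mem_triangle _ (fun j => ?_) hx
    rw [t_B]; split_ifs <;> simp
  · have h0 : 0 ≤ D.h x := nonneg_of_mem_three _ hx (by simp) (by simp) (by simp)
    have h1 : D.h x ≤ 1 := le_one_of_mem_three _ hx (by simp) (by simp) (by simp)
    have hb0 : D.b i x = 0 := le_antisymm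
      (nonpos_of_mem_three _ hx (by simp) (by simp) (by simp))
      (nonneg_of_mem_three _ hx (by simp) (by simp) (by simp))
    have ht : D.t (i + 2) x ≤ 0 :=
      nonpos_of_mem_three _ hx (by simp [hm.le]) (by simp) (by simp)
    refine ⟨⟨h0, h1, forall_cyclic i (Or.inl hb0.le) (Or.inl ?_) (Or.inr ?_)⟩, ?_⟩
    · exact nonpos_of_mem_three _ hx (by simp [hK.le]) (by simp; linarith) (by simp)
    · rw [add_two_add_two]
      exact nonneg_of_mem_three _ hx (by simp) (by simp)
        (by simp [hl.le])
    · intro h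
      rcases h.2.2 i with h | h <;> linarith
  · have h0 : 0 ≤ D.h x := nonneg_of_mem_three _ hx (by simp) (by simp) (by simp)
    have h1 : D.h x ≤ 1 := le_one_of_mem_three _ hx (by simp) (by simp) (by simp)
    have hb0 : 0 ≤ D.b i x :=
      nonneg_of_mem_three _ hx (by simp) (by simp) (by simp)
    have ht : D.t (i + 2) x = 0 := le_antisymm
      (nonpos_of_mem_three _ hx (by simp) (by simp) (by simp))
      (nonneg_of_mem_three _ hx (by simp) (by simp) (by simp))
    refine ⟨⟨h0, h1, forall_cyclic i (Or.inr ht.ge) (Or.inl ?_) (Or.inr ?_)⟩, ?_⟩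
    · exact nonpos_of_mem_three _ hx (by simp; linarith) (by simp) (by simp)
    · rw [add_two_add_two]
      exact nonneg_of_mem_three _ hx (by simp) (by simp [hl.le])
        (by simp)
    · intro h
      rcases h.2.2 i with h | h <;> linarith

theorem isOpen_core : IsOpen D.core := by
  have : D.core = {x | 0 < D.h x} ∩ {x | D.h x < 1} ∩
      ⋂ i, ({x | D.b i x < 0} ∪ {x | 0 < D.t (i + 2) x}) := by
    ext x; simp [core, and_assoc]
  rw [this]
  refine ((isOpen_lt continuous_const D.h.cont).inter
    (isOpen_lt D.h.cont continuous_const)).inter (isOpen_iInter_of_finite fun i => ?_)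
  exact (isOpen_lt (D.b i).cont continuous_const).union
    (isOpen_lt continuous_const (D.t (i + 2)).cont)

theorem isClosed_solid : IsClosed D.solid := by
  have : D.solid = {x | 0 ≤ D.h x} ∩ {x | D.h x ≤ 1} ∩
      ⋂ i, ({x | D.b i x ≤ 0} ∪ {x | 0 ≤ D.t (i + 2) x}) := by
    ext x; simp [solid, and_assoc]
  rw [this]
  refine ((isClosed_le continuous_const D.h.cont).inter
    (isClosed_le D.h.cont continuous_const)).inter (isClosed_iInter fun i => ?_)
  exact (isClosed_le (D.b i).cont continuous_const).union
    (isClosed_le continuous_const (D.t (i + 2)).cont)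

theorem core_subset_solid : D.core ⊆ D.solid := fun _ hx =>
  ⟨hx.1.le, hx.2.1.le, fun i => (hx.2.2 i).imp le_of_lt le_of_lt⟩

theorem exists_add_smul_mem_of_mem_interior {S : Set Space} {x : Space} (hx : x ∈ interior S)
    (w : Space) : ∃ s : ℝ, 0 < s ∧ x + s • w ∈ S := by
  have hc : Filter.Tendsto (fun s : ℝ => x + s • w) (𝓝[>] 0) (𝓝 x) := by
    have : Continuous (fun s : ℝ => x + s • w) := by fun_prop
    have h := this.tendsto 0
    simp only [zero_smul, add_zero] at h
    exact h.mono_left nhdsWithin_le_nhds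
  obtain ⟨s, h1, h2⟩ := ((hc.eventually (mem_interior_iff_mem_nhds.1 hx)).and
    self_mem_nhdsWithin).exists
  exact ⟨s, h2, h1⟩

theorem interior_solid : interior D.solid = D.core := by
  apply subset_antisymm _ (interior_maximal D.core_subset_solid D.isOpen_core)
  intro x hx
  have hs := interior_subset hx
  refine ⟨lt_of_le_of_ne hs.1 fun h0 => ?_, lt_of_le_of_ne hs.2.1 fun h1 => ?_, fun i => ?_⟩
  · obtain ⟨s, h, hs⟩ := exists_add_smul_mem_of_mem_interior hx (D.B 0 - D.A 0)
    have := hs.1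
    rw [Fn.add_smul_sub, ← h0] at this
    simp at this; linarith
  · obtain ⟨s, h, hs⟩ := exists_add_smul_mem_of_mem_interior hx (D.A 0 - D.B 0)
    have := hs.2.1
    rw [Fn.add_smul_sub, h1] at this
    simp at this; linarith
  · by_contra! hc
    obtain ⟨s, h, hs⟩ := exists_add_smul_mem_of_mem_interior hx
      ((D.A i - D.B i) + (D.B (i + 1) - D.B i))
    rw [smul_add, ← add_assoc] at hs
    have := hs.2.2 i
    rw [Fn.add_smul_sub, Fn.add_smul_sub, Fn.add_smul_sub, Fn.add_smul_sub] at this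
    have hm := mul_pos h D.mu_pos
    simp at this
    rcases this with this | this <;> linarith

theorem frontier_solid :
    frontier D.solid = ⋃ T ∈ schonhardtFacets D.A D.B, convexHull ℝ (Set.range T) := by
  rw [frontier, D.isClosed_solid.closure_eq, interior_solid]
  apply subset_antisymm
  · rintro x ⟨hx, hc⟩
    exact D.mem_triangle_of_not_mem_core hx hc
  · intro x hx
    simp only [Set.mem_iUnion] at hx
    obtain ⟨T, hT, hx⟩ := hx
    exact D.mem_solid_of_mem_triangle hT hx

/-- A point of the kernel of `solid`. -/
noncomputable def center : Space :=
  (1 / 2 : ℝ) • ((1 / 3 : ℝ) • D.B 0 + (1 / 3 : ℝ) • D.B 1 + (1 / 3 : ℝ) • D.B 2) +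
    (1 / 2 : ℝ) • ((1 / 3 : ℝ) • D.A 0 + (1 / 3 : ℝ) • D.A 1 + (1 / 3 : ℝ) • D.A 2)

theorem apply_center (f : Fn) : f D.center =
    (f (D.B 0) + f (D.B 1) + f (D.B 2) + f (D.A 0) + f (D.A 1) + f (D.A 2)) / 6 := by
  rw [center, f.combo (by norm_num), f.combo3 (by norm_num), f.combo3 (by norm_num)]
  ring

theorem sum_cyclic (i : Fin 3) (g : Fin 3 → ℝ) : g 0 + g 1 + g 2 = g i + g (i + 1) + g (i + 2) := by
  fin_cases i
  · rfl
  · change _ = g 1 + g 2 + g 0; ring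
  · change _ = g 2 + g 0 + g 1; ring

theorem h_center : D.h D.center = 1 / 2 := by
  rw [apply_center]; simp; norm_num

theorem t_center (i : Fin 3) : 0 < D.t i D.center := by
  have h1 := sum_cyclic i (fun j => D.t i (D.A j))
  have h2 := sum_cyclic i (fun j => D.t i (D.B j))
  simp at h1 h2
  have := D.lam_pos
  rw [apply_center]
  linarith

theorem b_center (i : Fin 3) : D.b i D.center < 0 := by
  have h1 := sum_cyclic i (fun j => D.b i (D.A j))
  have h2 := sum_cyclic i (fun j => D.b i (D.B j))
  simp at h1 h2
  have := D.bA_pos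
  have := D.le_gam
  rw [apply_center]
  linarith

theorem combo_center_mem_core {x : Space} (hx : x ∈ D.solid) {r s : ℝ} (hr : 0 ≤ r) (hs : 0 < s)
    (h : r + s = 1) : r • x + s • D.center ∈ D.core := by
  refine ⟨?_, ?_, fun i => ?_⟩
  · rw [Fn.combo _ h, h_center]; have := mul_nonneg hr hx.1; positivity
  · rw [Fn.combo _ h, h_center]; nlinarith [hx.2.1]
  · rw [Fn.combo _ h, Fn.combo _ h]
    rcases hx.2.2 i with h1 | h1
    · left; nlinarith [D.b_center i]
    · right; nlinarith [D.t_center (i + 2), mul_nonneg hr h1, mul_pos hs (D.t_center (i + 2))]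

theorem center_mem_core : D.center ∈ D.core :=
  ⟨by rw [h_center]; norm_num, by rw [h_center]; norm_num, fun i => Or.inl (D.b_center i)⟩

theorem isConnected_core : IsConnected D.core := by
  have h : StarConvex ℝ D.center D.core := by
    intro x hx r s hr hs h
    rcases hr.eq_or_lt with rfl | hr
    · have : s = 1 := by linarith
      subst this; simpa
    · rw [add_comm]
      exact D.combo_center_mem_core (D.core_subset_solid hx) hs hr (by linarith)
  exact (h.isPathConnected D.center_mem_core).isConnected

theorem closure_core : closure D.core = D.solid := by
  apply subset_antisymm (closure_minimal D.core_subset_solid D.isClosed_solid)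
  intro x hx
  have hc : Filter.Tendsto (fun s : ℝ => (1 - s) • x + s • D.center) (𝓝[>] 0) (𝓝 x) := by
    have : Continuous (fun s : ℝ => (1 - s) • x + s • D.center) := by fun_prop
    have h := this.tendsto 0
    simp only [zero_smul, add_zero, sub_zero, one_smul] at h
    exact h.mono_left nhdsWithin_le_nhds
  refine mem_closure_of_tendsto hc ?_
  filter_upwards [Ioo_mem_nhdsGT (show (0 : ℝ) < 1 by norm_num)] with s hs
  exact D.combo_center_mem_core hx (by linarith [hs.2]) hs.1 (by ring)

theorem abs_t_le_of_mem_solid {x : Space} (hx : x ∈ D.solid) (i : Fin 3) : |D.t i x| ≤ 4 := by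
  have hg := D.le_gam
  have hm := D.mu_pos
  have hm1 := D.mu_le
  have hl := D.lam_pos
  have hl1 := D.lam_lt
  have h0 := hx.1
  have h1 := hx.2.1
  have low : ∀ i, -1 ≤ D.t (i + 2) x := by
    intro i
    by_contra! hn
    obtain ⟨c0, c1, c2⟩ := D.solid_cond hx i
    have hs := D.sum_t i x
    rw [D.b_apply] at c0
    rw [D.b_add_one] at c1
    rw [D.b_add_two] at c2
    have c0 := c0.resolve_right (by linarith)
    have hp : D.gam * D.t (i + 2) x ≤ 14 * D.t (i + 2) x := by nlinarith
    have hmh : (1 + D.mu) * D.h x ≤ 17 / 16 := by nlinarith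
    have hlh : -1 ≤ (1 - D.lam) * D.h x := by nlinarith
    have hx0 : 13 ≤ D.t i x := by linarith
    have hx1 : D.t (i + 1) x < 0 := by linarith
    have c2 := c2.resolve_right (by linarith)
    have hp1 : D.gam * D.t (i + 1) x ≤ 14 * D.t (i + 1) x := by nlinarith
    linarith
  have low' : ∀ i, -1 ≤ D.t i x := fun i => by
    have := low (i + 1); rwa [add_one_add_two] at this
  have hs := D.sum_t i x
  have hlh : -1 ≤ (1 - D.lam) * D.h x := by nlinarith
  have := low' i
  have := low' (i + 1)
  have := low' (i + 2)
  rw [abs_le]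
  constructor <;> linarith

theorem isCompact_solid : IsCompact D.solid := by
  refine Metric.isCompact_of_isClosed_isBounded D.isClosed_solid ?_
  refine (Metric.isBounded_closedBall (x := D.p) (r := ∑ i, 4 * ‖D.e i‖)).subset ?_
  intro x hx
  rw [mem_closedBall_iff_norm]
  have h : x - D.p = ∑ i, D.t i x • D.e i := by
    rw [← D.e.sum_repr (x - D.p)]
    refine Finset.sum_congr rfl fun i _ => ?_
    rw [t_apply, map_sub]
    simp
  rw [h]
  refine (norm_sum_le _ _).trans (Finset.sum_le_sum fun i _ => ?_)
  rw [norm_smul]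
  exact mul_le_mul_of_nonneg_right (D.abs_t_le_of_mem_solid hx i) (norm_nonneg _)

end Frame

namespace Frame
variable (D : Frame)

/-! ### The boundary complex and the angles -/

/-- The convex hulls of two vertex families meet in the hull of the common vertices. -/
def MeetsInFace (T T' : Fin 3 → Space) : Prop :=
  convexHull ℝ (Set.range T) ∩ convexHull ℝ (Set.range T') =
    convexHull ℝ (Set.range T ∩ Set.range T')

theorem MeetsInFace.symm {T T' : Fin 3 → Space} (h : MeetsInFace T T') : MeetsInFace T' T := by
  rw [MeetsInFace, Set.inter_comm, h, Set.inter_comm]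

theorem meetsInFace_self (T : Fin 3 → Space) : MeetsInFace T T := by simp [MeetsInFace]

theorem meetsInFace_of_separates (f : Fn) {T T' : Fin 3 → Space} (h : ∀ j, 0 ≤ f (T j))
    (h' : ∀ j, f (T' j) ≤ 0) (h0 : ∀ j, f (T' j) = 0 → T' j ∈ Set.range T) :
    MeetsInFace T T' := by
  apply f.convexHull_inter_of_separates
  · rintro _ ⟨j, rfl⟩; exact h j
  · rintro _ ⟨j, rfl⟩; exact h' j
  · rintro _ ⟨j, rfl⟩; exact h0 j

theorem forall_nonneg (f : Fn) {P Q R : Space} (hP : 0 ≤ f P) (hQ : 0 ≤ f Q) (hR : 0 ≤ f R)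
    (j : Fin 3) : 0 ≤ f (![P, Q, R] j) := by
  fin_cases j <;> assumption

theorem forall_nonpos (f : Fn) {P Q R : Space} (hP : f P ≤ 0) (hQ : f Q ≤ 0) (hR : f R ≤ 0)
    (j : Fin 3) : f (![P, Q, R] j) ≤ 0 := by
  fin_cases j <;> assumption

theorem forall_zero_mem (f : Fn) {P Q R : Space} {W : Set Space} (hP : f P = 0 → P ∈ W)
    (hQ : f Q = 0 → Q ∈ W) (hR : f R = 0 → R ∈ W) (j : Fin 3) (h : f (![P, Q, R] j) = 0) :
    ![P, Q, R] j ∈ W := by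
  fin_cases j
  · exact hP h
  · exact hQ h
  · exact hR h

/-- The slope triangle at index `i`. -/
noncomputable def slope (i : Fin 3) : Fin 3 → Space := ![D.A i, D.B i, D.A (i + 1)]

/-- The wall triangle at index `i`. -/
noncomputable def wall (i : Fin 3) : Fin 3 → Space := ![D.B i, D.A (i + 1), D.B (i + 1)]

theorem meets_bottom_skylight : MeetsInFace D.A D.B := by
  refine meetsInFace_of_separates (D.h - AffineMap.const ℝ Space (1 / 2)) ?_ ?_ ?_ <;> intro j <;>
    norm_num

theorem meets_bottom_slope (i : Fin 3) : MeetsInFace D.A (D.slope i) := by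
  refine meetsInFace_of_separates (D.h - AffineMap.const ℝ Space 1) (by simp)
    (forall_nonpos _ (by simp) (by simp) (by simp)) (forall_zero_mem _ (by simp) (by simp) (by simp))

theorem meets_bottom_wall (i : Fin 3) : MeetsInFace D.A (D.wall i) := by
  refine meetsInFace_of_separates (D.h - AffineMap.const ℝ Space 1) (by simp)
    (forall_nonpos _ (by simp) (by simp) (by simp)) (forall_zero_mem _ (by simp) (by simp) (by simp))

theorem meets_skylight_slope (i : Fin 3) : MeetsInFace D.B (D.slope i) := by
  refine meetsInFace_of_separates (-D.h) (by simp)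
    (forall_nonpos _ (by simp) (by simp) (by simp)) (forall_zero_mem _ (by simp) (by simp) (by simp))

theorem meets_skylight_wall (i : Fin 3) : MeetsInFace D.B (D.wall i) := by
  refine meetsInFace_of_separates (-D.h) (by simp)
    (forall_nonpos _ (by simp) (by simp) (by simp)) (forall_zero_mem _ (by simp) (by simp) (by simp))

theorem meets_slope_slope (i : Fin 3) : MeetsInFace (D.slope (i + 1)) (D.slope i) := by
  have hK := D.bA_pos
  have hg := D.le_gam
  refine meetsInFace_of_separates (D.b (i + 1)) ?_ ?_ ?_
  · rw [slope, add_one_add_one]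
    exact forall_nonneg _ (by simp) (by simp) (by simp)
  · exact forall_nonpos _ (by simp [hK.le]) (by simp; linarith) (by simp)
  · refine forall_zero_mem _ (fun h => ?_) (fun h => ?_) (fun _ => ⟨0, rfl⟩)
    · simp at h; rcases h with h | h <;> nlinarith [D.mu_pos]
    · simp at h; linarith

theorem meets_wall_wall (i : Fin 3) : MeetsInFace (D.wall i) (D.wall (i + 1)) := by
  have hl := D.lam_add_mu_pos
  have e : D.t (i + 2) (D.A (i + 2)) = D.lam + D.mu := D.t_A00 (i + 2)
  have e' : D.t (i + 2) (D.B (i + 2)) = 1 := D.t_B00 (i + 2)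
  refine meetsInFace_of_separates (-D.t (i + 2)) ?_ ?_ ?_
  · exact forall_nonneg _ (by simp) (by simp) (by simp)
  · rw [wall, add_one_add_one]
    exact forall_nonpos _ (by simp) (by simp; linarith) (by simp)
  · rw [wall, add_one_add_one]
    refine forall_zero_mem _ (fun _ => ⟨2, rfl⟩) (fun h => ?_) (fun h => ?_)
    · simp at h; linarith
    · simp at h

theorem meets_slope_wall (i : Fin 3) : MeetsInFace (D.slope i) (D.wall i) := by
  refine meetsInFace_of_separates (-D.b i) ?_ ?_ ?_
  · exact forall_nonneg _ (by simp) (by simp) (by simp)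
  · exact forall_nonpos _ (by simp) (by simp) (by simp)
  · refine forall_zero_mem _ (fun _ => ⟨1, rfl⟩) (fun _ => ⟨2, rfl⟩) (fun h => ?_)
    simp at h

theorem meets_wall_slope (i : Fin 3) : MeetsInFace (D.wall (i + 1)) (D.slope i) := by
  have hK := D.bA_pos
  have hg := D.le_gam
  have hm := D.mu_pos
  have hm1 := D.mu_le
  have hl := D.lam_lt
  have hK' : 10 * D.mu ≤ D.mu * (D.gam * (D.gam - 1) + 1) - (D.lam + D.mu) := by
    rw [lam]
    have : 10 ≤ D.gam * (D.gam - 1) + 1 - (D.gam - 2 + 1) := by nlinarith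
    nlinarith
  refine meetsInFace_of_separates (D.b (i + 1) + D.t i + AffineMap.const ℝ Space (D.mu / 2))
    ?_ ?_ ?_
  · rw [wall, add_one_add_one]
    have e : D.b (i + 1) (D.B (i + 1)) = 0 := D.b_B00 (i + 1)
    exact forall_nonneg _ (by simp; linarith) (by simp; linarith) (by simp; linarith)
  · exact forall_nonpos _ (by simp; linarith) (by simp; linarith)
      (by simp; linarith)
  · refine forall_zero_mem _ (fun h => ?_) (fun h => ?_) (fun h => ?_) <;> simp at h <;> linarith

theorem meets_slope_wall_add_two (i : Fin 3) : MeetsInFace (D.wall (i + 2)) (D.slope i) := by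
  have hl := D.lam_add_mu_pos
  have e : D.t (i + 1) (D.A (i + 1)) = D.lam + D.mu := D.t_A00 (i + 1)
  refine meetsInFace_of_separates (-D.t (i + 1)) ?_ ?_ ?_
  · rw [wall, add_two_add_one]
    exact forall_nonneg _ (by simp) (by simp) (by simp)
  · exact forall_nonpos _ (by simp) (by simp) (by simp; linarith)
  · rw [wall, add_two_add_one]
    refine forall_zero_mem _ (fun _ => ⟨1, rfl⟩) (fun _ => ⟨2, rfl⟩) (fun h => ?_)
    simp at h; linarith

theorem meetsInFace {T T' : Fin 3 → Space} (hT : T ∈ schonhardtFacets D.A D.B)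
    (hT' : T' ∈ schonhardtFacets D.A D.B) : MeetsInFace T T' := by
  have ss : ∀ i j, MeetsInFace (D.slope i) (D.slope j) := by
    intro i j
    rcases eq_or_eq_add i j with rfl | rfl | rfl
    · exact meetsInFace_self _
    · exact (D.meets_slope_slope i).symm
    · have := D.meets_slope_slope (i + 2)
      rwa [add_two_add_one] at this
  have ww : ∀ i j, MeetsInFace (D.wall i) (D.wall j) := by
    intro i j
    rcases eq_or_eq_add i j with rfl | rfl | rfl
    · exact meetsInFace_self _
    · exact D.meets_wall_wall i
    · have := D.meets_wall_wall (i + 2)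
      rw [add_two_add_one] at this
      exact this.symm
  have sw : ∀ i j, MeetsInFace (D.slope i) (D.wall j) := by
    intro i j
    rcases eq_or_eq_add i j with rfl | rfl | rfl
    · exact D.meets_slope_wall _
    · exact (D.meets_wall_slope i).symm
    · exact (D.meets_slope_wall_add_two i).symm
  rcases hT with ((rfl | rfl) | ⟨i, rfl⟩) | ⟨i, rfl⟩ <;>
    rcases hT' with ((rfl | rfl) | ⟨j, rfl⟩) | ⟨j, rfl⟩
  · exact meetsInFace_self _
  · exact D.meets_bottom_skylight
  · exact D.meets_bottom_slope j
  · exact D.meets_bottom_wall j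
  · exact D.meets_bottom_skylight.symm
  · exact meetsInFace_self _
  · exact D.meets_skylight_slope j
  · exact D.meets_skylight_wall j
  · exact (D.meets_bottom_slope i).symm
  · exact (D.meets_skylight_slope i).symm
  · exact ss i j
  · exact sw i j
  · exact (D.meets_bottom_wall i).symm
  · exact (D.meets_skylight_wall i).symm
  · exact (sw j i).symm
  · exact ww i j

theorem affineIndependent_bottom : AffineIndependent ℝ D.A := by
  have hK := D.bA_pos
  refine affineIndependent_of_fns (fun i => D.b (i + 1)) (fun i => ?_) (fun i j hj => ?_)
  · rw [b_A10, neg_ne_zero]; exact hK.ne'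
  · rcases eq_or_eq_add i j with rfl | rfl | rfl
    · exact absurd rfl hj
    · exact D.b_A00 (i + 1)
    · simp

theorem affineIndependent_skylight : AffineIndependent ℝ D.B :=
  affineIndependent_of_fns D.t (fun i => by simp) (fun i j hj => by simp [t_B, hj.symm])

theorem affineIndependent_slope (i : Fin 3) : AffineIndependent ℝ (D.slope i) := by
  refine affineIndependent_of_fns ![D.a i, D.u i, D.v i] (fun j => ?_) (fun j k hjk => ?_)
  · fin_cases j <;> simp [slope, u_apply, v_apply]
  · fin_cases j <;> fin_cases k <;> simp [slope, u_apply, v_apply] at hjk ⊢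

theorem affineIndependent_wall (i : Fin 3) : AffineIndependent ℝ (D.wall i) := by
  refine affineIndependent_of_fns ![D.u i, D.v i, D.b i] (fun j => ?_) (fun j k hjk => ?_)
  · fin_cases j <;> simp [wall, u_apply, v_apply]
  · fin_cases j <;> fin_cases k <;> simp [wall, u_apply, v_apply] at hjk ⊢

theorem eventually_pos (f : Fn) {P Q c d x : Space} (hx : x ∈ openSegment ℝ P Q)
    (hP : 0 ≤ f P) (hQ : 0 ≤ f Q) (h : 0 < f P + f Q ∨ 0 < f c + f d) :
    ∀ᶠ s in 𝓝[>] (0 : ℝ), 0 < f (x + s • ((c - x) + (d - x))) := by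
  obtain ⟨r, r', hr, hr', hrr, rfl⟩ := hx
  have hfx := f.combo hrr P Q
  generalize r • P + r' • Q = x at *
  rcases h with h | h
  · have hx1 : 0 < f x := by
      rw [hfx]
      rcases hP.eq_or_lt with h0 | h0
      · rw [← h0] at h ⊢; nlinarith
      · have := mul_pos hr h0
        have := mul_nonneg hr'.le hQ
        linarith
    have hc : Filter.Tendsto (fun s : ℝ => f (x + s • ((c - x) + (d - x)))) (𝓝[>] 0)
        (𝓝 (f x)) := by
      have : Continuous (fun s : ℝ => f (x + s • ((c - x) + (d - x)))) :=
        f.cont.comp (by fun_prop)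
      have h := this.tendsto 0
      simp only [zero_smul, add_zero] at h
      exact h.mono_left nhdsWithin_le_nhds
    exact hc.eventually (lt_mem_nhds hx1)
  · have hx0 : 0 ≤ f x := by rw [hfx]; positivity
    filter_upwards [Ioo_mem_nhdsGT (show (0 : ℝ) < 1 / 2 by norm_num)] with s hs
    rw [smul_add, ← add_assoc, Fn.add_smul_sub, Fn.add_smul_sub]
    have := mul_pos hs.1 h
    have := mul_nonneg (show 0 ≤ 1 - 2 * s by linarith [hs.2]) hx0
    linarith

theorem eventually_neg (f : Fn) {P Q c d x : Space} (hx : x ∈ openSegment ℝ P Q)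
    (hP : f P ≤ 0) (hQ : f Q ≤ 0) (h : f P + f Q < 0 ∨ f c + f d < 0) :
    ∀ᶠ s in 𝓝[>] (0 : ℝ), f (x + s • ((c - x) + (d - x))) < 0 := by
  have := eventually_pos (-f) (c := c) (d := d) hx (by simpa) (by simpa)
    (by simp only [AffineMap.coe_neg, Pi.neg_apply]; rcases h with h | h
        · left; linarith
        · right; linarith)
  filter_upwards [this] with s hs
  simpa using hs

theorem eventually_lt_one (f : Fn) {P Q c d x : Space} (hx : x ∈ openSegment ℝ P Q)
    (hP : f P ≤ 1) (hQ : f Q ≤ 1) (h : f P + f Q < 2 ∨ f c + f d < 2) :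
    ∀ᶠ s in 𝓝[>] (0 : ℝ), f (x + s • ((c - x) + (d - x))) < 1 := by
  have := eventually_neg (f - AffineMap.const ℝ Space 1) (c := c) (d := d) hx (by simpa) (by simpa)
    (by simp only [AffineMap.coe_sub, Pi.sub_apply, AffineMap.const_apply]; rcases h with h | h
        · left; linarith
        · right; linarith)
  filter_upwards [this] with s hs
  simpa using hs

theorem angleLtPi_of (i : Fin 3) {P Q c d : Space}
    (h : ∀ x ∈ openSegment ℝ P Q,
      (∀ᶠ s in 𝓝[>] (0 : ℝ), 0 < D.h (x + s • ((c - x) + (d - x)))) ∧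
      (∀ᶠ s in 𝓝[>] (0 : ℝ), D.h (x + s • ((c - x) + (d - x))) < 1) ∧
      ((∀ᶠ s in 𝓝[>] (0 : ℝ), D.b i (x + s • ((c - x) + (d - x))) < 0) ∨
        ∀ᶠ s in 𝓝[>] (0 : ℝ), 0 < D.t (i + 2) (x + s • ((c - x) + (d - x)))) ∧
      ((∀ᶠ s in 𝓝[>] (0 : ℝ), D.b (i + 1) (x + s • ((c - x) + (d - x))) < 0) ∨
        ∀ᶠ s in 𝓝[>] (0 : ℝ), 0 < D.t i (x + s • ((c - x) + (d - x)))) ∧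
      ((∀ᶠ s in 𝓝[>] (0 : ℝ), D.b (i + 2) (x + s • ((c - x) + (d - x))) < 0) ∨
        ∀ᶠ s in 𝓝[>] (0 : ℝ), 0 < D.t (i + 1) (x + s • ((c - x) + (d - x))))) :
    AngleLtPi D.solid P Q c d := by
  intro x hx
  obtain ⟨h1, h2, h3, h4, h5⟩ := h x hx
  have key : ∀ j, ∀ᶠ s in 𝓝[>] (0 : ℝ), D.b j (x + s • ((c - x) + (d - x))) < 0 ∨
      0 < D.t (j + 2) (x + s • ((c - x) + (d - x))) := by
    refine forall_cyclic i ?_ ?_ ?_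
    · exact h3.elim (fun h => h.mono fun _ => Or.inl) (fun h => h.mono fun _ => Or.inr)
    · rw [add_one_add_two]
      exact h4.elim (fun h => h.mono fun _ => Or.inl) (fun h => h.mono fun _ => Or.inr)
    · rw [add_two_add_two]
      exact h5.elim (fun h => h.mono fun _ => Or.inl) (fun h => h.mono fun _ => Or.inr)
  filter_upwards [h1, h2, Filter.eventually_all.2 key] with s e1 e2 e3
  rw [interior_solid]
  exact ⟨e1, e2, e3⟩

theorem angle_bottom (i : Fin 3) :
    AngleLtPi D.solid (D.A i) (D.A (i + 1)) (D.A (i + 2)) (D.B i) := by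
  have hK := D.bA_pos
  have hg := D.le_gam
  refine D.angleLtPi_of i fun x hx => ⟨?_, ?_, Or.inl ?_, Or.inl ?_, Or.inl ?_⟩
  · apply eventually_pos _ hx <;> simp
  · apply eventually_lt_one _ hx <;> simp
  · apply eventually_neg _ hx <;> simp [hK]
  · apply eventually_neg _ hx <;> simp [hK, hK.le]
  · apply eventually_neg _ hx <;> simp [hK, hK.le]

theorem angle_skylight (i : Fin 3) :
    AngleLtPi D.solid (D.B i) (D.B (i + 1)) (D.B (i + 2)) (D.A (i + 1)) := by
  have hl := D.lam_add_mu_pos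
  have e : ∀ i, D.t i (D.B i) = 1 := D.t_B00
  have e' : ∀ i, D.t i (D.A i) = D.lam + D.mu := D.t_A00
  have hm := D.mu_le
  refine D.angleLtPi_of i fun x hx => ⟨?_, ?_, Or.inr ?_, Or.inr ?_, Or.inr ?_⟩
  · apply eventually_pos _ hx <;> simp
  · apply eventually_lt_one _ hx <;> simp
  · apply eventually_pos _ hx <;> simp
  · apply eventually_pos _ hx <;> simp
  · apply eventually_pos _ hx <;> simp

theorem angle_side (i : Fin 3) :
    AngleLtPi D.solid (D.A i) (D.B i) (D.A (i + 1)) (D.B (i + 2)) := by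
  have hK := D.bA_pos
  have hg := D.le_gam
  have hl := D.lam_add_mu_pos
  refine D.angleLtPi_of i fun x hx => ⟨?_, ?_, Or.inl ?_, Or.inl ?_, Or.inr ?_⟩
  · apply eventually_pos _ hx <;> simp
  · apply eventually_lt_one _ hx <;> simp
  · apply eventually_neg _ hx <;> simp; linarith
  · apply eventually_neg _ hx <;> simp [hK.le]
    · linarith
    · left; linarith
  · apply eventually_pos _ hx <;> simp [hl]

theorem angle_diagonal (i : Fin 3) :
    AngleGtPi D.solid (D.B i) (D.A (i + 1)) (D.A i) (D.B (i + 1)) := by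
  intro x hx
  have h1 : ∀ᶠ s in 𝓝[>] (0 : ℝ),
      0 < D.b i (x + s • ((D.A i - x) + (D.B (i + 1) - x))) := by
    apply eventually_pos _ hx <;> simp
  have h2 : ∀ᶠ s in 𝓝[>] (0 : ℝ),
      D.t (i + 2) (x + s • ((D.A i - x) + (D.B (i + 1) - x))) < 0 := by
    apply eventually_neg _ hx <;> simp [D.mu_pos]
  filter_upwards [h1, h2] with s e1 e2 h
  rcases h.2.2 i with h | h <;> linarith

theorem isSchonhardtPolytope : IsSchonhardtPolytope D.solid D.A D.B where
  isCompact := D.isCompact_solid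
  closure_interior := by rw [interior_solid, closure_core]
  isConnected_interior := by rw [interior_solid]; exact D.isConnected_core
  vertices_injective := by
    refine D.affineIndependent_bottom.injective.sumElim D.affineIndependent_skylight.injective ?_
    intro i j h
    have := D.h_A i
    rw [h, h_B] at this
    norm_num at this
  facets_nondegenerate := by
    rintro T (((rfl | rfl) | ⟨i, rfl⟩) | ⟨i, rfl⟩)
    · exact D.affineIndependent_bottom
    · exact D.affineIndependent_skylight
    · exact D.affineIndependent_slope i
    · exact D.affineIndependent_wall i
  facets_inter := fun _ hT _ hT' => D.meetsInFace hT hT'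
  frontier_eq := D.frontier_solid
  angle_bottom := D.angle_bottom
  angle_skylight := D.angle_skylight
  angle_side := D.angle_side
  angle_diagonal := D.angle_diagonal

theorem finrank_vectorSpan_of_affineIndependent {T : Fin 3 → Space} (h : AffineIndependent ℝ T) :
    Module.finrank ℝ (vectorSpan ℝ (Set.range T)) = 2 :=
  h.finrank_vectorSpan (by simp)

/-- The visibility cone is the nonnegative orthant of the coordinates. -/
theorem visibilityCone_eq : visibilityCone D.A D.B = {x | ∀ i, 0 ≤ D.t i x} := by
  have key : ∀ (i : Fin 3) (x : Space),
      (affineSpan ℝ {D.B i, D.B (i + 1), D.A (i + 1)}).WSameSide x (D.B (i + 2)) ↔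
        0 ≤ D.t (i + 2) x := by
    intro i x
    have hr : ({D.B i, D.B (i + 1), D.A (i + 1)} : Set Space) = Set.range (D.wall i) := by
      rw [wall, Matrix.range_cons, Matrix.range_cons, Matrix.range_cons, Matrix.range_empty]
      ext; simp; tauto
    have h2 := finrank_vectorSpan_of_affineIndependent (D.affineIndependent_wall i)
    rw [← hr] at h2
    refine wSameSide_iff_nonneg (D.t (i + 2)) h2 ?_ ?_ x
    · simp
    · rw [t_B00]; norm_num
  ext x
  simp only [visibilityCone, Set.mem_ofPred_eq, key]
  refine ⟨fun h i => ?_, fun h i => h _⟩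
  have := h (i + 1)
  rwa [add_one_add_two] at this

end Frame

/-- A frame with the parameters of the chains of an `m`-cupola: the inner vertices of a chain are
at the parameters `tau` on a parabola of curvature `eta` through `Aᵢ` and `Bᵢ₊₁`. -/
structure Chain (m : ℕ) extends Frame where
  eta : ℝ
  tau : Fin (m + 2) → ℝ
  eta_pos : 0 < eta
  eta_le : eta ≤ mu / 16
  tau_mono : StrictMono tau
  tau_zero : tau 0 = 0
  tau_last : tau (Fin.last (m + 1)) = 1
  tau_le : ∀ k, k ≠ Fin.last (m + 1) → tau k ≤ 1 / 4

namespace Frame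
variable (D : Frame)

@[simp] theorem v_A00 (i : Fin 3) : D.v i (D.A i) = 0 := by simp [v_apply]
@[simp] theorem v_A01 (i : Fin 3) : D.v i (D.A (i + 1)) = 1 := by simp [v_apply]
@[simp] theorem v_A02 (i : Fin 3) : D.v i (D.A (i + 2)) = D.gam := by simp [v_apply]
@[simp] theorem v_B00 (i : Fin 3) : D.v i (D.B i) = 0 := by simp [v_apply]
@[simp] theorem v_B01 (i : Fin 3) : D.v i (D.B (i + 1)) = 0 := by simp [v_apply]
@[simp] theorem v_B02 (i : Fin 3) : D.v i (D.B (i + 2)) = D.mu⁻¹ := by simp [v_apply]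
@[simp] theorem u_A00 (i : Fin 3) : D.u i (D.A i) = 0 := by simp [u_apply]
@[simp] theorem u_A01 (i : Fin 3) : D.u i (D.A (i + 1)) = 0 := by simp [u_apply]
@[simp] theorem u_A02 (i : Fin 3) :
    D.u i (D.A (i + 2)) = D.mu * (D.gam * (D.gam - 1) + 1) := by simp [u_apply]
@[simp] theorem u_B00 (i : Fin 3) : D.u i (D.B i) = 1 := by simp [u_apply]
@[simp] theorem u_B01 (i : Fin 3) : D.u i (D.B (i + 1)) = 0 := by simp [u_apply]
@[simp] theorem u_B02 (i : Fin 3) : D.u i (D.B (i + 2)) = D.gam := by simp [u_apply]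

theorem mu_mul_gam_le : D.mu * D.gam ≤ 5 / 4 := by
  have := D.lam_le; have := D.mu_le; linarith

theorem bA_le : D.mu * (D.gam * (D.gam - 1) + 1) ≤ 5 / 4 * D.gam := by
  have := D.mu_mul_gam_le; have := D.mu_le; have := D.le_gam
  nlinarith

theorem le_bA : D.gam - 1 ≤ D.mu * (D.gam * (D.gam - 1) + 1) := by
  have := D.le_lam; have := D.mu_pos; have := D.le_gam
  have : 1 ≤ D.mu * D.gam := by linarith
  nlinarith

theorem inv_mu_le : D.mu⁻¹ ≤ D.gam := by
  have := D.le_lam; have := D.mu_pos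
  rw [inv_le_iff_one_le_mul₀ D.mu_pos]; linarith

theorem gam_le_inv_mu : D.gam ≤ D.mu⁻¹ + 3 := by
  have := D.lam_le; have h := D.mu_pos
  rw [← mul_le_mul_iff_right₀ h, mul_add, mul_inv_cancel₀ h.ne']; linarith

end Frame

namespace Chain
variable {m : ℕ} (D : Chain m)

theorem tau_nonneg (k : Fin (m + 2)) : 0 ≤ D.tau k := by
  rw [← D.tau_zero]; exact D.tau_mono.monotone (Fin.zero_le k)

theorem tau_le_one (k : Fin (m + 2)) : D.tau k ≤ 1 := by
  rw [← D.tau_last]; exact D.tau_mono.monotone (Fin.le_last k)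

theorem tau_lt (k : Fin (m + 1)) : D.tau k.castSucc < D.tau k.succ :=
  D.tau_mono Fin.castSucc_lt_succ

/-- The bulge of a chain at its `k`-th vertex. -/
def g (k : Fin (m + 2)) : ℝ := D.eta * (D.tau k * (1 - D.tau k))

/-- The chain vertices. -/
noncomputable def q (i : Fin 3) (k : Fin (m + 2)) : Space :=
  (1 - D.tau k + D.g k) • D.A i + (D.tau k + D.g k) • D.B (i + 1) + (-D.g k) • D.B i +
    (-D.g k) • D.A (i + 1)

theorem apply_q (f : Fn) (i : Fin 3) (k : Fin (m + 2)) :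
    f (D.q i k) = (1 - D.tau k + D.g k) * f (D.A i) + (D.tau k + D.g k) * f (D.B (i + 1)) +
      (-D.g k) * f (D.B i) + (-D.g k) * f (D.A (i + 1)) :=
  f.combo4 (by ring) _ _ _ _

theorem q_zero (i : Fin 3) : D.q i 0 = D.A i := by
  simp [q, g, D.tau_zero]

theorem q_last (i : Fin 3) : D.q i (Fin.last (m + 1)) = D.B (i + 1) := by
  simp [q, g, D.tau_last]

theorem g_nonneg (k : Fin (m + 2)) : 0 ≤ D.g k :=
  mul_nonneg D.eta_pos.le (mul_nonneg (D.tau_nonneg k) (sub_nonneg.2 (D.tau_le_one k)))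

theorem g_le (k : Fin (m + 2)) : D.g k ≤ D.eta * (1 / 4) :=
  mul_le_mul_of_nonneg_left (by nlinarith [sq_nonneg (D.tau k - 1 / 2)]) D.eta_pos.le

theorem h_q (i : Fin 3) (k : Fin (m + 2)) : D.h (D.q i k) = 1 - D.tau k := by
  rw [apply_q]; simp

/-- The first coefficient of the facet functionals at the `k`-th edge of a chain. -/
def X (k : Fin (m + 1)) : ℝ := D.eta * (D.tau k.castSucc * D.tau k.succ)

/-- The second coefficient of the facet functionals at the `k`-th edge of a chain. -/
def Y (k : Fin (m + 1)) : ℝ := D.eta * ((1 - D.tau k.castSucc) * (1 - D.tau k.succ))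

theorem X_nonneg (k : Fin (m + 1)) : 0 ≤ D.X k :=
  mul_nonneg D.eta_pos.le (mul_nonneg (D.tau_nonneg _) (D.tau_nonneg _))

theorem Y_nonneg (k : Fin (m + 1)) : 0 ≤ D.Y k :=
  mul_nonneg D.eta_pos.le (mul_nonneg (sub_nonneg.2 (D.tau_le_one _))
    (sub_nonneg.2 (D.tau_le_one _)))

theorem X_le (k : Fin (m + 1)) : D.X k ≤ D.eta :=
  mul_le_of_le_one_right D.eta_pos.le (mul_le_one₀ (D.tau_le_one _) (D.tau_nonneg _)
    (D.tau_le_one _))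

theorem Y_le (k : Fin (m + 1)) : D.Y k ≤ D.eta :=
  mul_le_of_le_one_right D.eta_pos.le (mul_le_one₀ (by linarith [D.tau_nonneg k.castSucc])
    (sub_nonneg.2 (D.tau_le_one _)) (by linarith [D.tau_nonneg k.succ]))

/-- The functional of the facet `Bᵢ, q i k, q i (k + 1)`. -/
noncomputable def lB (i : Fin 3) (k : Fin (m + 1)) : Fn :=
  D.X k • D.h + D.Y k • (D.b i + D.v i) + D.v i

/-- The functional of the facet `Aᵢ₊₁, q i k, q i (k + 1)`. -/
noncomputable def lA (i : Fin 3) (k : Fin (m + 1)) : Fn :=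
  D.X k • (D.a i + D.u i) + D.Y k • (AffineMap.const ℝ Space 1 - D.h) + D.u i

theorem lB_apply (i : Fin 3) (k : Fin (m + 1)) (x : Space) :
    D.lB i k x = D.X k * D.h x + D.Y k * (D.b i x + D.v i x) + D.v i x := by
  simp [lB, mul_add]

theorem lA_apply (i : Fin 3) (k : Fin (m + 1)) (x : Space) :
    D.lA i k x = D.X k * (D.a i x + D.u i x) + D.Y k * (1 - D.h x) + D.u i x := by
  simp [lA, mul_add]

theorem lB_q (i : Fin 3) (k : Fin (m + 1)) (l : Fin (m + 2)) :
    D.lB i k (D.q i l) = D.eta * ((D.tau l - D.tau k.castSucc) * (D.tau l - D.tau k.succ)) := by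
  simp only [lB_apply, apply_q]
  simp [g, X, Y]; ring

theorem lA_q (i : Fin 3) (k : Fin (m + 1)) (l : Fin (m + 2)) :
    D.lA i k (D.q i l) = D.eta * ((D.tau l - D.tau k.castSucc) * (D.tau l - D.tau k.succ)) := by
  simp only [lA_apply, apply_q]
  simp [g, X, Y]; ring

theorem eta_mul_gam_le : D.eta * D.gam ≤ 5 / 64 := by
  have := D.eta_le; have := D.mu_mul_gam_le; have := D.le_gam
  nlinarith

theorem eta_small : D.eta ≤ 1 / 256 := by
  have := D.eta_le; have := D.mu_le; linarith

theorem lB_q_add_one (i : Fin 3) (k : Fin (m + 1)) (l : Fin (m + 2)) :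
    0 < D.lB i k (D.q (i + 1) l) := by
  have hX := D.X_nonneg k
  have hY := D.Y_nonneg k
  have hX1 := D.X_le k
  have hY1 := D.Y_le k
  have he := D.eta_pos
  have he1 := D.eta_small
  have heg := D.eta_mul_gam_le
  have hg0 := D.g_nonneg l
  have hg1 := D.g_le l
  have hs0 := D.tau_nonneg l
  have hs1 := D.tau_le_one l
  have hK := D.bA_le
  have hK1 := D.le_bA
  have hgam := D.le_gam
  have hi := D.inv_mu_le
  have hi' := D.gam_le_inv_mu
  rw [apply_q, add_one_add_one]
  simp only [lB_apply]
  simp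
  set K := D.mu * (D.gam * (D.gam - 1) + 1)
  have e1 : 1 ≤ D.X k + D.Y k + 1 := by linarith
  have e2 : 1 ≤ D.Y k * (1 - D.gam + D.mu⁻¹) + D.mu⁻¹ := by nlinarith
  have e3 : D.X k + D.Y k * (-K + D.gam) + D.gam ≤ 3 * D.gam := by nlinarith
  have e4 : D.g l * D.gam ≤ 1 / 48 := by nlinarith
  have e5 : D.g l * (D.X k + D.Y k * (-K + D.gam) + D.gam) ≤ 1 / 16 := by
    nlinarith [mul_le_mul_of_nonneg_left e3 hg0]
  have e6 : D.g l * D.Y k ≤ 1 / 16 := by nlinarith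
  have e7 := mul_le_mul_of_nonneg_left e1 (show 0 ≤ 1 - D.tau l + D.g l by linarith)
  have e8 := mul_le_mul_of_nonneg_left e2 (show 0 ≤ D.tau l + D.g l by linarith)
  linarith

theorem lB_q_add_two (i : Fin 3) (k : Fin (m + 1)) (l : Fin (m + 2)) (hl : D.tau l < 1) :
    0 < D.lB i k (D.q (i + 2) l) := by
  have hX := D.X_nonneg k
  have hY := D.Y_nonneg k
  have hX1 := D.X_le k
  have hY1 := D.Y_le k
  have he := D.eta_pos
  have he1 := D.eta_small
  have heg := D.eta_mul_gam_le
  have hs0 := D.tau_nonneg l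
  have hK := D.bA_le
  have hK1 := D.le_bA
  have hgam := D.le_gam
  have hi := D.inv_mu_le
  have hi' := D.gam_le_inv_mu
  rw [apply_q, add_two_add_one]
  simp only [lB_apply]
  simp
  set K := D.mu * (D.gam * (D.gam - 1) + 1)
  have e2 : D.Y k * (1 - D.gam + D.mu⁻¹) + D.mu⁻¹ ≤ 2 * D.gam := by nlinarith
  have e3 : 10 ≤ D.X k + D.Y k * (-K + D.gam) + D.gam := by nlinarith
  have e5 : D.eta * D.tau l * (D.Y k * (1 - D.gam + D.mu⁻¹) + D.mu⁻¹) ≤ 1 := by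
    have : D.eta * D.tau l ≤ D.eta := by nlinarith
    have h0 : 0 ≤ D.eta * D.tau l := by positivity
    nlinarith [mul_le_mul_of_nonneg_left e2 h0]
  have e6 : D.eta * D.tau l * D.X k ≤ 1 := by
    have : D.eta * D.tau l ≤ D.eta := by nlinarith
    have h0 : 0 ≤ D.eta * D.tau l := by positivity
    nlinarith
  have e7 : 0 < (1 - D.tau l) * ((1 + D.eta * D.tau l) *
      (D.X k + D.Y k * (-K + D.gam) + D.gam) -
      D.eta * D.tau l * (D.Y k * (1 - D.gam + D.mu⁻¹) + D.mu⁻¹) - D.eta * D.tau l * D.X k) := by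
    apply mul_pos (by linarith)
    have h0 : 0 ≤ D.eta * D.tau l := by positivity
    nlinarith [mul_nonneg h0 (show 0 ≤ D.X k + D.Y k * (-K + D.gam) + D.gam by linarith)]
  rw [← sub_pos]
  refine e7.trans_le (le_of_eq ?_)
  rw [g]; ring

theorem lA_q_add_two (i : Fin 3) (k : Fin (m + 1)) (l : Fin (m + 2)) :
    0 < D.lA i k (D.q (i + 2) l) := by
  have hX := D.X_nonneg k
  have hY := D.Y_nonneg k
  have hX1 := D.X_le k
  have hY1 := D.Y_le k
  have he := D.eta_pos
  have he1 := D.eta_small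
  have heg := D.eta_mul_gam_le
  have hg0 := D.g_nonneg l
  have hg1 := D.g_le l
  have hs0 := D.tau_nonneg l
  have hs1 := D.tau_le_one l
  have hK := D.bA_le
  have hK1 := D.le_bA
  have hgam := D.le_gam
  have hi := D.inv_mu_le
  have hi' := D.gam_le_inv_mu
  rw [apply_q, add_two_add_one]
  simp only [lA_apply]
  simp
  set K := D.mu * (D.gam * (D.gam - 1) + 1)
  have e1 : 1 ≤ D.X k * (1 - D.gam + K) + K := by nlinarith
  have e2 : 1 ≤ D.X k + D.Y k + 1 := by linarith
  have e3 : D.X k * (-D.mu⁻¹ + D.gam) + D.Y k + D.gam ≤ 3 * D.gam := by nlinarith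
  have e4 : D.g l * D.gam ≤ 1 / 48 := by nlinarith
  have e5 : D.g l * (D.X k * (-D.mu⁻¹ + D.gam) + D.Y k + D.gam) ≤ 1 / 16 := by
    nlinarith [mul_le_mul_of_nonneg_left e3 hg0]
  have e6 : D.g l * D.X k ≤ 1 / 16 := by nlinarith
  have e7 := mul_le_mul_of_nonneg_left e1 (show 0 ≤ 1 - D.tau l + D.g l by linarith)
  have e8 := mul_le_mul_of_nonneg_left e2 (show 0 ≤ D.tau l + D.g l by linarith)
  linarith

theorem lA_q_add_one (i : Fin 3) (k : Fin (m + 1)) (l : Fin (m + 2)) (hl : 0 < D.tau l) :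
    0 < D.lA i k (D.q (i + 1) l) := by
  have hX := D.X_nonneg k
  have hY := D.Y_nonneg k
  have hX1 := D.X_le k
  have hY1 := D.Y_le k
  have he := D.eta_pos
  have he1 := D.eta_small
  have heg := D.eta_mul_gam_le
  have hs1 := D.tau_le_one l
  have hK := D.bA_le
  have hK1 := D.le_bA
  have hgam := D.le_gam
  have hi := D.inv_mu_le
  have hi' := D.gam_le_inv_mu
  rw [apply_q, add_one_add_one]
  simp only [lA_apply]
  simp
  set K := D.mu * (D.gam * (D.gam - 1) + 1)
  have e2 : 10 ≤ D.X k * (-D.mu⁻¹ + D.gam) + D.Y k + D.gam := by nlinarith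
  have e3 : D.X k * (1 - D.gam + K) + K ≤ 2 * D.gam := by nlinarith
  have h0 : 0 ≤ D.eta * (1 - D.tau l) := mul_nonneg he.le (by linarith)
  have h1 : D.eta * (1 - D.tau l) ≤ D.eta := by nlinarith
  have e5 : D.eta * (1 - D.tau l) * (D.X k * (1 - D.gam + K) + K) ≤ 1 := by
    nlinarith [mul_le_mul_of_nonneg_left e3 h0]
  have e6 : D.eta * (1 - D.tau l) * D.Y k ≤ 1 := by nlinarith
  have e7 : 0 < D.tau l * ((1 + D.eta * (1 - D.tau l)) *
      (D.X k * (-D.mu⁻¹ + D.gam) + D.Y k + D.gam) -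
      D.eta * (1 - D.tau l) * D.Y k - D.eta * (1 - D.tau l) * (D.X k * (1 - D.gam + K) + K)) := by
    apply mul_pos hl
    nlinarith [mul_nonneg h0 (show 0 ≤ D.X k * (-D.mu⁻¹ + D.gam) + D.Y k + D.gam by linarith)]
  rw [← sub_pos]
  refine e7.trans_le (le_of_eq ?_)
  rw [g]; ring

end Chain

namespace Chain
variable {m : ℕ} (D : Chain m)

/-! ### The cupola of a chain -/

theorem mul_tau_nonneg (k : Fin (m + 1)) (l : Fin (m + 2)) :
    0 ≤ (D.tau l - D.tau k.castSucc) * (D.tau l - D.tau k.succ) := by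
  rcases le_or_gt l k.castSucc with h | h
  · have h1 := D.tau_mono.monotone h
    have h2 := D.tau_lt k
    nlinarith
  · have h1 : k.succ ≤ l := Fin.castSucc_lt_iff_succ_le.1 h
    have h1 := D.tau_mono.monotone h1
    have h2 := D.tau_lt k
    nlinarith

theorem mul_tau_eq_zero {k : Fin (m + 1)} {l : Fin (m + 2)}
    (h : D.eta * ((D.tau l - D.tau k.castSucc) * (D.tau l - D.tau k.succ)) = 0) :
    l = k.castSucc ∨ l = k.succ := by
  rcases mul_eq_zero.1 h with h | h
  · exact absurd h D.eta_pos.ne'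
  rcases mul_eq_zero.1 h with h | h
  · exact Or.inl (D.tau_mono.injective (sub_eq_zero.1 h))
  · exact Or.inr (D.tau_mono.injective (sub_eq_zero.1 h))

theorem tau_lt_one {l : Fin (m + 2)} (hl : l ≠ Fin.last (m + 1)) : D.tau l < 1 := by
  rw [← D.tau_last]; exact D.tau_mono (Fin.lt_last_iff_ne_last.2 hl)

theorem tau_pos {l : Fin (m + 2)} (hl : l ≠ 0) : 0 < D.tau l := by
  rw [← D.tau_zero]; exact D.tau_mono (Fin.pos_iff_ne_zero.2 hl)

theorem lB_nonneg (i : Fin 3) (k : Fin (m + 1)) (j : Fin 3) (l : Fin (m + 2)) :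
    0 ≤ D.lB i k (D.q j l) := by
  rcases eq_or_eq_add i j with rfl | rfl | rfl
  · rw [lB_q]; exact mul_nonneg D.eta_pos.le (D.mul_tau_nonneg k l)
  · exact (D.lB_q_add_one i k l).le
  · by_cases hl : l = Fin.last (m + 1)
    · rw [hl, q_last, add_two_add_one, lB_apply]; simp
    · exact (D.lB_q_add_two i k l (D.tau_lt_one hl)).le

theorem lB_eq_zero {i : Fin 3} {k : Fin (m + 1)} {j : Fin 3} {l : Fin (m + 2)}
    (h : D.lB i k (D.q j l) = 0) :
    (j = i ∧ (l = k.castSucc ∨ l = k.succ)) ∨ (j = i + 2 ∧ l = Fin.last (m + 1)) := by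
  rcases eq_or_eq_add i j with rfl | rfl | rfl
  · rw [lB_q] at h; exact Or.inl ⟨rfl, D.mul_tau_eq_zero h⟩
  · exact absurd h (D.lB_q_add_one i k l).ne'
  · by_cases hl : l = Fin.last (m + 1)
    · exact Or.inr ⟨rfl, hl⟩
    · exact absurd h (D.lB_q_add_two i k l (D.tau_lt_one hl)).ne'

theorem lA_nonneg (i : Fin 3) (k : Fin (m + 1)) (j : Fin 3) (l : Fin (m + 2)) :
    0 ≤ D.lA i k (D.q j l) := by
  rcases eq_or_eq_add i j with rfl | rfl | rfl
  · rw [lA_q]; exact mul_nonneg D.eta_pos.le (D.mul_tau_nonneg k l)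
  · by_cases hl : l = 0
    · rw [hl, q_zero, lA_apply]; simp
    · exact (D.lA_q_add_one i k l (D.tau_pos hl)).le
  · exact (D.lA_q_add_two i k l).le

theorem lA_eq_zero {i : Fin 3} {k : Fin (m + 1)} {j : Fin 3} {l : Fin (m + 2)}
    (h : D.lA i k (D.q j l) = 0) :
    (j = i ∧ (l = k.castSucc ∨ l = k.succ)) ∨ (j = i + 1 ∧ l = 0) := by
  rcases eq_or_eq_add i j with rfl | rfl | rfl
  · rw [lA_q] at h; exact Or.inl ⟨rfl, D.mul_tau_eq_zero h⟩
  · by_cases hl : l = 0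
    · exact Or.inr ⟨rfl, hl⟩
    · exact absurd h (D.lA_q_add_one i k l (D.tau_pos hl)).ne'
  · exact absurd h (D.lA_q_add_two i k l).ne'

/-- The vertex set of the cupola. -/
def verts : Set Space := Set.range fun z : Fin 3 × Fin (m + 2) => D.q z.1 z.2

theorem q_mem_verts (i : Fin 3) (k : Fin (m + 2)) : D.q i k ∈ D.verts := ⟨(i, k), rfl⟩

theorem A_mem_verts (i : Fin 3) : D.A i ∈ D.verts := D.q_zero i ▸ D.q_mem_verts i 0

theorem B_mem_verts (i : Fin 3) : D.B i ∈ D.verts := by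
  have := D.q_last (i + 2)
  rw [add_two_add_one] at this
  exact this ▸ D.q_mem_verts _ _

theorem finite_verts : D.verts.Finite := Set.finite_range _

/-- The cupola. -/
def cup : Set Space := convexHull ℝ D.verts

/-- The functional whose zero plane is the bottom plane. -/
noncomputable def bot : Fn := AffineMap.const ℝ Space 1 - D.h

theorem bot_apply (x : Space) : D.bot x = 1 - D.h x := by simp [bot]

/-- The facet functionals. -/
def fns : Set Fn :=
  {D.bot, D.h} ∪ Set.range (fun z : Fin 3 × Fin (m + 1) => D.lB z.1 z.2) ∪
    Set.range (fun z : Fin 3 × Fin (m + 1) => D.lA z.1 z.2)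

theorem finite_fns : D.fns.Finite :=
  ((Set.toFinite _).union (Set.finite_range _)).union (Set.finite_range _)

theorem bot_q (i : Fin 3) (k : Fin (m + 2)) : D.bot (D.q i k) = D.tau k := by
  rw [bot_apply, h_q]; ring

theorem fns_nonneg {f : Fn} (hf : f ∈ D.fns) {w : Space} (hw : w ∈ D.verts) : 0 ≤ f w := by
  obtain ⟨⟨j, l⟩, rfl⟩ := hw
  rcases hf with ((rfl | rfl) | ⟨⟨i, k⟩, rfl⟩) | ⟨⟨i, k⟩, rfl⟩
  · rw [bot_q]; exact D.tau_nonneg l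
  · rw [h_q]; linarith [D.tau_le_one l]
  · exact D.lB_nonneg i k j l
  · exact D.lA_nonneg i k j l

theorem fns_nonneg_cup {f : Fn} (hf : f ∈ D.fns) {x : Space} (hx : x ∈ D.cup) : 0 ≤ f x :=
  f.nonneg_of_mem_convexHull (fun _ hw => D.fns_nonneg hf hw) hx

theorem bot_mem : D.bot ∈ D.fns := Or.inl (Or.inl (Or.inl rfl))
theorem h_mem : D.h ∈ D.fns := Or.inl (Or.inl (Or.inr rfl))
theorem lB_mem (i : Fin 3) (k : Fin (m + 1)) : D.lB i k ∈ D.fns := Or.inl (Or.inr ⟨(i, k), rfl⟩)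
theorem lA_mem (i : Fin 3) (k : Fin (m + 1)) : D.lA i k ∈ D.fns := Or.inr ⟨(i, k), rfl⟩

theorem zeros_eq {f : Fn} (hf : f ∈ D.fns) :
    {x ∈ D.cup | f x = 0} = convexHull ℝ {w ∈ D.verts | f w = 0} :=
  f.convexHull_inter_zeros fun _ hw => D.fns_nonneg hf hw

theorem bot_zeros : {w ∈ D.verts | D.bot w = 0} = Set.range D.A := by
  ext w
  constructor
  · rintro ⟨⟨⟨j, l⟩, rfl⟩, h⟩
    rw [bot_q] at h
    have : l = 0 := by
      by_contra hl
      exact (D.tau_pos hl).ne' h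
    simp only [this, q_zero]
    exact ⟨j, rfl⟩
  · rintro ⟨j, rfl⟩
    exact ⟨D.A_mem_verts j, by rw [bot_apply, Frame.h_A]; ring⟩

theorem h_zeros : {w ∈ D.verts | D.h w = 0} = Set.range D.B := by
  ext w
  constructor
  · rintro ⟨⟨⟨j, l⟩, rfl⟩, h⟩
    rw [h_q] at h
    have : l = Fin.last (m + 1) := by
      by_contra hl
      have := D.tau_lt_one hl
      linarith
    simp only [this, q_last]
    exact ⟨j + 1, rfl⟩
  · rintro ⟨j, rfl⟩
    exact ⟨D.B_mem_verts j, D.h_B j⟩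

theorem lB_zeros (i : Fin 3) (k : Fin (m + 1)) :
    {w ∈ D.verts | D.lB i k w = 0} = {D.B i, D.q i k.castSucc, D.q i k.succ} := by
  ext w
  constructor
  · rintro ⟨⟨⟨j, l⟩, rfl⟩, h⟩
    rcases D.lB_eq_zero h with ⟨rfl, rfl | rfl⟩ | ⟨rfl, rfl⟩
    · simp
    · simp
    · simp [q_last, add_two_add_one]
  · rintro (rfl | rfl | rfl)
    · exact ⟨D.B_mem_verts i, by rw [lB_apply]; simp⟩
    · exact ⟨D.q_mem_verts _ _, by rw [lB_q]; simp⟩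
    · exact ⟨D.q_mem_verts _ _, by rw [lB_q]; simp⟩

theorem lA_zeros (i : Fin 3) (k : Fin (m + 1)) :
    {w ∈ D.verts | D.lA i k w = 0} = {D.A (i + 1), D.q i k.castSucc, D.q i k.succ} := by
  ext w
  constructor
  · rintro ⟨⟨⟨j, l⟩, rfl⟩, h⟩
    rcases D.lA_eq_zero h with ⟨rfl, rfl | rfl⟩ | ⟨rfl, rfl⟩
    · simp
    · simp
    · simp [q_zero]
  · rintro (rfl | rfl | rfl)
    · exact ⟨D.A_mem_verts _, by rw [lA_apply]; simp⟩
    · exact ⟨D.q_mem_verts _ _, by rw [lA_q]; simp⟩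
    · exact ⟨D.q_mem_verts _ _, by rw [lA_q]; simp⟩

/-- The functional vanishing on the plane of `Bᵢ`, `Aᵢ₊₁` and `q i l`. -/
noncomputable def wedge (i : Fin 3) (l : Fin (m + 2)) : Fn :=
  (D.tau l + D.g l) • D.a i - (1 - D.tau l + D.g l) • D.b i

theorem wedge_apply (i : Fin 3) (l : Fin (m + 2)) (x : Space) :
    D.wedge i l x = (D.tau l + D.g l) * D.a i x - (1 - D.tau l + D.g l) * D.b i x := by
  simp [wedge]

theorem wedge_q (i : Fin 3) (l l' : Fin (m + 2)) :
    D.wedge i l (D.q i l') = (D.tau l - D.tau l') *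
      (1 + D.eta * ((1 - D.tau l) * (1 - D.tau l') + D.tau l * D.tau l')) := by
  rw [wedge_apply, apply_q, apply_q]
  simp [g]; ring

theorem wedge_q_ne {i : Fin 3} {l l' : Fin (m + 2)} (h : l ≠ l') :
    D.wedge i l (D.q i l') ≠ 0 := by
  rw [wedge_q]
  apply mul_ne_zero (sub_ne_zero.2 (D.tau_mono.injective.ne h))
  have := D.eta_pos
  have := mul_nonneg (sub_nonneg.2 (D.tau_le_one l)) (sub_nonneg.2 (D.tau_le_one l'))
  have := mul_nonneg (D.tau_nonneg l) (D.tau_nonneg l')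
  positivity

@[simp] theorem wedge_q_self (i : Fin 3) (l : Fin (m + 2)) : D.wedge i l (D.q i l) = 0 := by
  rw [wedge_q]; simp

@[simp] theorem wedge_B (i : Fin 3) (l : Fin (m + 2)) : D.wedge i l (D.B i) = 0 := by
  rw [wedge_apply]; simp

@[simp] theorem wedge_A (i : Fin 3) (l : Fin (m + 2)) : D.wedge i l (D.A (i + 1)) = 0 := by
  rw [wedge_apply]; simp

theorem castSucc_ne_succ (k : Fin (m + 1)) : k.castSucc ≠ k.succ :=
  (Fin.castSucc_lt_succ (i := k)).ne

theorem affineIndependent_lB (i : Fin 3) (k : Fin (m + 1)) :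
    AffineIndependent ℝ ![D.B i, D.q i k.castSucc, D.q i k.succ] := by
  have h1 : D.lA i k (D.B i) ≠ 0 := by
    have := D.X_nonneg k
    have := D.Y_nonneg k
    rw [lA_apply]; simp; positivity
  have h2 := D.wedge_q_ne (i := i) (castSucc_ne_succ k)
  have h3 := D.wedge_q_ne (i := i) (castSucc_ne_succ k).symm
  refine affineIndependent_of_fns ![D.lA i k, D.wedge i k.succ, D.wedge i k.castSucc]
    (fun j => ?_) (fun j l hl => ?_)
  · fin_cases j <;> assumption
  · fin_cases j <;> fin_cases l <;> simp [lA_q] at hl ⊢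

theorem affineIndependent_lA (i : Fin 3) (k : Fin (m + 1)) :
    AffineIndependent ℝ ![D.A (i + 1), D.q i k.castSucc, D.q i k.succ] := by
  have h1 : D.lB i k (D.A (i + 1)) ≠ 0 := by
    have := D.X_nonneg k
    have := D.Y_nonneg k
    rw [lB_apply]; simp; positivity
  have h2 := D.wedge_q_ne (i := i) (castSucc_ne_succ k)
  have h3 := D.wedge_q_ne (i := i) (castSucc_ne_succ k).symm
  refine affineIndependent_of_fns ![D.lB i k, D.wedge i k.succ, D.wedge i k.castSucc]
    (fun j => ?_) (fun j l hl => ?_)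
  · fin_cases j <;> assumption
  · fin_cases j <;> fin_cases l <;> simp [lB_q] at hl ⊢

theorem range_three (x y z : Space) : Set.range ![x, y, z] = {x, y, z} := by
  rw [Matrix.range_cons, Matrix.range_cons, Matrix.range_cons, Matrix.range_empty]
  ext; simp; tauto

theorem vectorSpan_convexHull (W : Set Space) :
    vectorSpan ℝ (convexHull ℝ W) = vectorSpan ℝ W := by
  rw [← direction_affineSpan, affineSpan_convexHull, direction_affineSpan]

theorem finrank_zeros {f : Fn} (hf : f ∈ D.fns) :
    Module.finrank ℝ (vectorSpan ℝ {x ∈ D.cup | f x = 0}) = 2 := by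
  rw [D.zeros_eq hf, vectorSpan_convexHull]
  rcases hf with ((rfl | rfl) | ⟨⟨i, k⟩, rfl⟩) | ⟨⟨i, k⟩, rfl⟩
  · rw [bot_zeros]; exact Frame.finrank_vectorSpan_of_affineIndependent D.affineIndependent_bottom
  · rw [h_zeros]; exact Frame.finrank_vectorSpan_of_affineIndependent D.affineIndependent_skylight
  · rw [show {w ∈ D.verts | D.lB i k w = 0} = _ from D.lB_zeros i k, ← range_three]
    exact Frame.finrank_vectorSpan_of_affineIndependent (D.affineIndependent_lB i k)
  · rw [show {w ∈ D.verts | D.lA i k w = 0} = _ from D.lA_zeros i k, ← range_three]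
    exact Frame.finrank_vectorSpan_of_affineIndependent (D.affineIndependent_lA i k)

theorem isFacet_zeros {f : Fn} (hf : f ∈ D.fns) : IsFacet D.cup {x ∈ D.cup | f x = 0} :=
  ⟨isExposed_of_fn f fun _ hx => D.fns_nonneg_cup hf hx, D.finrank_zeros hf⟩

theorem convex_cup : Convex ℝ D.cup := convex_convexHull ℝ _

theorem isCompact_cup : IsCompact D.cup := D.finite_verts.isCompact_convexHull (𝕜 := ℝ)

theorem solid_subset_cup : D.solid ⊆ D.cup := by
  refine subset_of_frontier_subset D.isCompact_solid D.isCompact_cup.isClosed D.convex_cup ?_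
  rw [D.frontier_solid]
  refine Set.iUnion₂_subset fun T hT => convexHull_mono ?_
  rintro _ ⟨j, rfl⟩
  rcases hT with ((rfl | rfl) | ⟨i, rfl⟩) | ⟨i, rfl⟩
  · exact D.A_mem_verts j
  · exact D.B_mem_verts j
  · fin_cases j
    exacts [D.A_mem_verts _, D.B_mem_verts _, D.A_mem_verts _]
  · fin_cases j
    exacts [D.B_mem_verts _, D.A_mem_verts _, D.B_mem_verts _]

theorem interior_cup_nonempty : (interior D.cup).Nonempty := by
  refine ⟨D.center, interior_mono D.solid_subset_cup ?_⟩
  rw [D.interior_solid]; exact D.center_mem_core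

theorem exists_sign_change {n : ℕ} (c : Fin (n + 2) → ℝ) (h0 : c 0 ≤ 0)
    (h1 : 0 ≤ c (Fin.last (n + 1))) : ∃ k : Fin (n + 1), c k.castSucc ≤ 0 ∧ 0 ≤ c k.succ := by
  by_contra! h
  have : ∀ k : Fin (n + 2), k ≠ Fin.last (n + 1) → c k ≤ 0 := by
    intro k
    induction k using Fin.induction with
    | zero => exact fun _ => h0
    | succ k ih => exact fun _ => (h k (ih (Fin.castSucc_lt_last k).ne)).le
  have h2 := h (Fin.last n) (this _ (Fin.castSucc_lt_last _).ne)
  rw [Fin.succ_last] at h2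
  linarith

theorem mem_cup_of_wedge {x : Space} {i : Fin 3} (ha : 0 ≤ D.a i x) (hb : 0 ≤ D.b i x)
    (hB : ∀ k, 0 ≤ D.lB i k x) (hA : ∀ k, 0 ≤ D.lA i k x) : x ∈ D.cup := by
  obtain ⟨k, h1, h2⟩ := exists_sign_change (fun l => D.wedge i l x)
    (by simp [wedge_apply, D.tau_zero, g, hb]) (by simp [wedge_apply, D.tau_last, g, ha])
  have hB := hB k
  have hA := hA k
  have hX := D.X_nonneg k
  have hY := D.Y_nonneg k
  have hlt := D.tau_lt k
  have hN : 0 < 1 + D.X k + D.Y k := by linarith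
  have hd : 0 < D.tau k.succ - D.tau k.castSucc := by linarith
  have key : x = (D.wedge i k.succ x / ((D.tau k.succ - D.tau k.castSucc) * (1 + D.X k + D.Y k))) •
      D.q i k.castSucc + (-D.wedge i k.castSucc x /
        ((D.tau k.succ - D.tau k.castSucc) * (1 + D.X k + D.Y k))) • D.q i k.succ +
      (D.lA i k x / (1 + D.X k + D.Y k)) • D.B i +
      (D.lB i k x / (1 + D.X k + D.Y k)) • D.A (i + 1) := by
    conv_lhs => rw [← D.tetra i x]
    simp only [q]
    match_scalars
    all_goals
      simp only [lA_apply, lB_apply, wedge_apply, Frame.u_apply, Frame.v_apply]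
      field_simp
      simp only [X, Y, g]
      ring
  rw [key]
  refine mem_convexHull_four (div_nonneg h2 (by positivity))
    (div_nonneg (by simpa using h1) (by positivity)) (div_nonneg hA hN.le) (div_nonneg hB hN.le) ?_
    (D.q_mem_verts _ _) (D.q_mem_verts _ _) (D.B_mem_verts _) (D.A_mem_verts _)
  simp only [lA_apply, lB_apply, wedge_apply, Frame.u_apply, Frame.v_apply]
  field_simp
  simp only [X, Y, g]
  ring

theorem cup_eq : D.cup = {x | ∀ f ∈ D.fns, 0 ≤ f x} := by
  apply subset_antisymm (fun x hx f hf => D.fns_nonneg_cup hf hx)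
  intro x hx
  by_cases h : ∃ i, 0 ≤ D.a i x ∧ 0 ≤ D.b i x
  · obtain ⟨i, ha, hb⟩ := h
    exact D.mem_cup_of_wedge ha hb (fun k => hx _ (D.lB_mem i k)) (fun k => hx _ (D.lA_mem i k))
  · push Not at h
    refine D.solid_subset_cup ⟨hx _ D.h_mem, ?_, fun i => ?_⟩
    · have := hx _ D.bot_mem
      rw [bot_apply] at this; linarith
    · by_cases ha : 0 ≤ D.a i x
      · exact Or.inl (h i ha).le
      · right
        rw [D.mul_a]
        have := D.mu_pos
        nlinarith

end Chain

/-- A functional cutting out a facet does not vanish identically. -/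
theorem exists_ne_zero_of_isFacet {C G : Set Space} (hC : (interior C).Nonempty)
    (hG : IsFacet C G) {f : Fn} (h : G = {x ∈ C | f x = 0}) : ∃ y, f y ≠ 0 := by
  by_contra! h0
  have : G = C := by rw [h]; ext x; simp [h0]
  have h3 := hG.2
  rw [this, finrank_vectorSpan_of_interior hC] at h3
  omega

/-- Two nonnegative functionals cutting out the same facet are positive multiples. -/
theorem pos_proportional_of_isFacet {C G : Set Space} (hC : (interior C).Nonempty)
    (hG : IsFacet C G) {f g : Fn} (hf : ∀ x ∈ C, 0 ≤ f x) (hg : ∀ x ∈ C, 0 ≤ g x)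
    (hGf : G = {x ∈ C | f x = 0}) (hGg : G = {x ∈ C | g x = 0}) :
    ∃ k : ℝ, 0 < k ∧ ∀ x, g x = k * f x := by
  obtain ⟨y, hy⟩ := exists_ne_zero_of_isFacet hC hG hGf
  obtain ⟨z, hz⟩ := exists_ne_zero_of_isFacet hC hG hGg
  exact f.pos_proportional g hC hG.2 hf hg (fun x hx => by rw [hGf] at hx; exact hx.2)
    (fun x hx => by rw [hGg] at hx; exact hx.2) hy hz

namespace Chain
variable {m : ℕ} (D : Chain m)

theorem exists_fn_vertex (i : Fin 3) (k : Fin (m + 2)) : ∃ F : Fn, (∀ w ∈ D.verts, 0 ≤ F w) ∧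
    F (D.q i k) = 0 ∧ ∀ j l, F (D.q j l) = 0 → j = i ∧ l = k := by
  have aux : ∀ f ∈ D.fns, ∀ f' ∈ D.fns, f (D.q i k) = 0 → f' (D.q i k) = 0 →
      (∀ j l, f (D.q j l) = 0 → f' (D.q j l) = 0 → j = i ∧ l = k) →
      ∃ F : Fn, (∀ w ∈ D.verts, 0 ≤ F w) ∧
        F (D.q i k) = 0 ∧ ∀ j l, F (D.q j l) = 0 → j = i ∧ l = k := by
    intro f hf f' hf' h h' H
    refine ⟨f + f', fun w hw => ?_, by simp [h, h'], fun j l h0 => ?_⟩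
    · have := D.fns_nonneg hf hw
      have := D.fns_nonneg hf' hw
      simp only [AffineMap.coe_add, Pi.add_apply]
      linarith
    · have h1 := D.fns_nonneg hf (D.q_mem_verts j l)
      have h2 := D.fns_nonneg hf' (D.q_mem_verts j l)
      simp only [AffineMap.coe_add, Pi.add_apply] at h0
      exact H j l (by linarith) (by linarith)
  have hne : ∀ i : Fin 3, i + 2 ≠ i ∧ i + 1 ≠ i ∧ i + 2 ≠ i + 1 := by decide
  rcases eq_or_ne k 0 with rfl | hk
  · refine aux _ D.bot_mem _ (D.lB_mem i 0) ?_ ?_ fun j l h h' => ?_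
    · rw [bot_q, D.tau_zero]
    · rw [lB_q]; simp
    · rw [bot_q] at h
      have hl : l = 0 := by
        by_contra hl
        exact (D.tau_pos hl).ne' h
      rcases D.lB_eq_zero h' with ⟨hj, _⟩ | ⟨_, h2⟩
      · exact ⟨hj, hl⟩
      · rw [hl] at h2
        exact absurd h2 (Fin.last_pos).ne
  rcases eq_or_ne k (Fin.last (m + 1)) with rfl | hk'
  · refine aux _ D.h_mem _ (D.lA_mem i (Fin.last m)) ?_ ?_ fun j l h h' => ?_
    · rw [h_q, D.tau_last]; ring
    · rw [lA_q]; simp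
    · rw [h_q] at h
      have hl : l = Fin.last (m + 1) := by
        by_contra hl
        have := D.tau_lt_one hl
        linarith
      rcases D.lA_eq_zero h' with ⟨hj, _⟩ | ⟨_, h2⟩
      · exact ⟨hj, hl⟩
      · rw [hl] at h2
        exact absurd h2 (Fin.last_pos).ne'
  · obtain ⟨k₁, rfl⟩ := Fin.exists_succ_eq.2 hk
    obtain ⟨k₂, hk₂⟩ := Fin.exists_castSucc_eq.2 hk'
    refine aux _ (D.lB_mem i k₁) _ (D.lA_mem i k₂) ?_ ?_ fun j l h h' => ?_
    · rw [lB_q]; simp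
    · rw [lA_q, hk₂]; simp
    · rcases D.lB_eq_zero h with ⟨hj, h1⟩ | ⟨hj, h1⟩ <;>
        rcases D.lA_eq_zero h' with ⟨hj', h2⟩ | ⟨hj', h2⟩
      · refine ⟨hj, ?_⟩
        rcases h1 with h1 | h1
        · rcases h2 with h2 | h2
          · rw [h2, hk₂]
          · exfalso
            have e1 := Fin.castSucc_lt_succ (i := k₁)
            have e2 := Fin.castSucc_lt_succ (i := k₂)
            rw [hk₂, ← h2, h1] at e2
            exact lt_asymm e1 e2
        · exact h1
      · exact absurd (hj'.symm.trans hj) (hne i).2.1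
      · exact absurd (hj.symm.trans hj') (hne i).1
      · exact absurd (hj.symm.trans hj') (hne i).2.2

theorem q_injective : Function.Injective fun z : Fin 3 × Fin (m + 2) => D.q z.1 z.2 := by
  rintro ⟨j, l⟩ ⟨i, k⟩ h
  obtain ⟨F, _, h0, h1⟩ := D.exists_fn_vertex i k
  simp only at h
  rw [← h] at h0
  obtain ⟨rfl, rfl⟩ := h1 j l h0
  rfl

theorem extremePoints_cup : D.cup.extremePoints ℝ = D.verts := by
  apply subset_antisymm extremePoints_convexHull_subset
  rintro _ ⟨⟨i, k⟩, rfl⟩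
  obtain ⟨F, hF, h0, h1⟩ := D.exists_fn_vertex i k
  have h2 : {w ∈ D.verts | F w = 0} = {D.q i k} := by
    ext w
    constructor
    · rintro ⟨⟨⟨j, l⟩, rfl⟩, h⟩
      obtain ⟨rfl, rfl⟩ := h1 j l h
      rfl
    · rintro rfl
      exact ⟨D.q_mem_verts i k, h0⟩
  have h3 := isExposed_of_fn (C := D.cup) F fun x hx => F.nonneg_of_mem_convexHull hF hx
  rw [cup, F.convexHull_inter_zeros hF, h2, convexHull_singleton] at h3
  exact isExtreme_singleton.1 h3.isExtreme

theorem facets_cup : {G | IsFacet D.cup G} =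
    {convexHull ℝ (Set.range D.A), convexHull ℝ (Set.range D.B)} ∪
      {G | ∃ (i : Fin 3) (k : Fin (m + 1)),
        G = convexHull ℝ {D.B i, D.q i k.castSucc, D.q i k.succ} ∨
        G = convexHull ℝ {D.A (i + 1), D.q i k.castSucc, D.q i k.succ}} := by
  have hA := D.zeros_eq D.bot_mem
  have hB := D.zeros_eq D.h_mem
  have hlB := fun i k => D.zeros_eq (D.lB_mem i k)
  have hlA := fun i k => D.zeros_eq (D.lA_mem i k)
  rw [bot_zeros] at hA
  rw [h_zeros] at hB
  simp only [lB_zeros] at hlB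
  simp only [lA_zeros] at hlA
  ext G
  constructor
  · intro hG
    obtain ⟨f, hf, rfl⟩ := isFacet_eq_of_inequalities D.finite_fns D.cup_eq
      D.interior_cup_nonempty (fun f hf => exists_ne_zero_of_isFacet D.interior_cup_nonempty
        (D.isFacet_zeros hf) rfl) hG
    rcases hf with ((rfl | rfl) | ⟨⟨i, k⟩, rfl⟩) | ⟨⟨i, k⟩, rfl⟩
    · exact Or.inl (Or.inl hA)
    · exact Or.inl (Or.inr hB)
    · exact Or.inr ⟨i, k, Or.inl (hlB i k)⟩
    · exact Or.inr ⟨i, k, Or.inr (hlA i k)⟩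
  · rintro ((rfl | rfl) | ⟨i, k, rfl | rfl⟩)
    · rw [← hA]; exact D.isFacet_zeros D.bot_mem
    · rw [← hB]; exact D.isFacet_zeros D.h_mem
    · rw [← hlB]; exact D.isFacet_zeros (D.lB_mem i k)
    · rw [← hlA]; exact D.isFacet_zeros (D.lA_mem i k)

theorem chain_side (i : Fin 3) (k : Fin (m + 2)) (hk : k ≠ Fin.last (m + 1)) :
    (affineSpan ℝ {D.B i, D.A (i + 1), D.B (i + 2)}).SOppSide (D.q i k) (D.B (i + 1)) := by
  have e : D.t (i + 1) (D.A (i + 1)) = D.lam + D.mu := D.t_A00 (i + 1)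
  have e' : D.t (i + 1) (D.B (i + 1)) = 1 := D.t_B00 (i + 1)
  have e2 : D.t (i + 2) (D.B (i + 2)) = 1 := D.t_B00 (i + 2)
  have hind : AffineIndependent ℝ ![D.B i, D.A (i + 1), D.B (i + 2)] := by
    refine affineIndependent_of_fns ![D.t i + D.mu • D.h, D.h, D.t (i + 2)]
      (fun j => ?_) (fun j l hl => ?_)
    · fin_cases j <;> simp [e2]
    · fin_cases j <;> fin_cases l <;> simp at hl ⊢
  have h2 := Frame.finrank_vectorSpan_of_affineIndependent hind
  rw [range_three] at h2
  refine sOppSide_of_neg_of_pos (D.t (i + 1) - (D.lam + D.mu) • D.h) h2 ?_ ?_ ?_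
  · simp [e]
  · rw [apply_q]
    simp [e, e']
    have h1 := D.tau_le k hk
    have h3 := D.lam_pos
    have h4 := D.lam_lt
    have h5 := D.mu_pos
    have h6 := D.g_nonneg k
    have h7 := D.g_le k
    have h8 := D.eta_small
    nlinarith
  · simp [e']

theorem isCupola : IsCupola m D.cup D.A D.B D.q where
  isPolytope3 := ⟨⟨D.verts, D.finite_verts, rfl⟩, D.interior_cup_nonempty⟩
  chain_zero := D.q_zero
  chain_last := D.q_last
  vertices := by
    rw [extremePoints_cup]
    apply subset_antisymm
    · rintro _ ⟨⟨i, k⟩, rfl⟩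
      exact Or.inr (Set.mem_iUnion.2 ⟨i, k, rfl⟩)
    · rintro _ ((⟨i, rfl⟩ | ⟨i, rfl⟩) | h)
      · exact D.A_mem_verts i
      · exact D.B_mem_verts i
      · obtain ⟨i, k, rfl⟩ := Set.mem_iUnion.1 h
        exact D.q_mem_verts i k
  ncard_vertices := by
    rw [extremePoints_cup, verts, ← Nat.card_coe_set_eq, Nat.card_range_of_injective D.q_injective]
    simp; ring
  schonhardt := ⟨D.solid, D.isSchonhardtPolytope⟩
  facets := D.facets_cup
  chain_side := fun i k _ hk => D.chain_side i k hk

/-- A criterion for a point to be beyond the bottom facet of the cupola. -/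
theorem isBeyond_bottom {x : Space} (hbot : D.bot x < 0) (hpos : ∀ f ∈ D.fns, f ≠ D.bot → 0 < f x) :
    IsBeyond D.cup (convexHull ℝ (Set.range D.A)) x := by
  intro G hG l c hl hGl
  obtain ⟨f, hf, hGf⟩ := isFacet_eq_of_inequalities D.finite_fns D.cup_eq
    D.interior_cup_nonempty (fun f hf => exists_ne_zero_of_isFacet D.interior_cup_nonempty
      (D.isFacet_zeros hf) rfl) hG
  obtain ⟨k, hk, hkf⟩ := pos_proportional_of_isFacet D.interior_cup_nonempty hG
    (f := f) (g := -Fn.ofDual l c) (fun x hx => D.fns_nonneg_cup hf hx)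
    (fun x hx => by simpa using hl x hx) hGf
    (by rw [hGl]; ext x
        simp only [Set.mem_ofPred_eq, AffineMap.coe_neg, Pi.neg_apply, Fn.ofDual_apply,
          neg_eq_zero, sub_eq_zero])
  have hx : c - l x = k * f x := by simpa using hkf x
  have hbotA : {x ∈ D.cup | D.bot x = 0} = convexHull ℝ (Set.range D.A) := by
    rw [D.zeros_eq D.bot_mem, bot_zeros]
  constructor
  · intro hsub
    have hfA : ∀ j, f (D.A j) = 0 := fun j => by
      have := hsub (subset_convexHull ℝ _ ⟨j, rfl⟩)
      rw [hGf] at this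
      exact this.2
    have : f = D.bot := by
      rcases hf with ((rfl | rfl) | ⟨⟨i, k⟩, rfl⟩) | ⟨⟨i, k⟩, rfl⟩
      · rfl
      · have := hfA 0
        rw [Frame.h_A] at this
        norm_num at this
      · have := hfA (i + 1)
        rw [← q_zero] at this
        exact absurd this (D.lB_q_add_one i k 0).ne'
      · have := hfA (i + 2)
        rw [← q_zero] at this
        exact absurd this (D.lA_q_add_two i k 0).ne'
    rw [this] at hx
    nlinarith
  · intro hsub
    have : f ≠ D.bot := by
      rintro rfl
      exact hsub (by rw [hGf, hbotA])
    have := mul_pos hk (hpos f hf this)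
    linarith

end Chain

/-! ### The cupola placed over a facet -/

/-- The coordinates with respect to the origin `p` and the basis `e`. -/
noncomputable def coordFn (p : Space) (e : Module.Basis (Fin 3) ℝ Space) (i : Fin 3) : Fn :=
  (e.coord i).toAffineMap - AffineMap.const ℝ Space (e.coord i p)

theorem coordFn_apply (p : Space) (e : Module.Basis (Fin 3) ℝ Space) (i : Fin 3) (x : Space) :
    coordFn p e i x = e.coord i x - e.coord i p := by simp [coordFn]

/-- One minus the sum of the coordinates. -/
noncomputable def coSumFn (p : Space) (e : Module.Basis (Fin 3) ℝ Space) : Fn :=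
  AffineMap.const ℝ Space 1 - coordFn p e 0 - coordFn p e 1 - coordFn p e 2

theorem coSumFn_apply (p : Space) (e : Module.Basis (Fin 3) ℝ Space) (x : Space) :
    coSumFn p e x = 1 - (coordFn p e 0 x + coordFn p e 1 x + coordFn p e 2 x) := by
  simp [coSumFn]; ring

theorem eq_add_sum_coordFn (p : Space) (e : Module.Basis (Fin 3) ℝ Space) (x : Space) :
    x = p + ∑ i, coordFn p e i x • e i := by
  have h : x - p = ∑ i, coordFn p e i x • e i := by
    rw [← e.sum_repr (x - p)]
    refine Finset.sum_congr rfl fun i _ => ?_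
    rw [coordFn_apply, map_sub]
    simp
  rw [← h]; simp

/-- The affine expansion of a functional in coordinates. -/
theorem Fn.apply_coord (f : Fn) (p : Space) (e : Module.Basis (Fin 3) ℝ Space) (x : Space) :
    f x = coSumFn p e x * f p + (coordFn p e 0 x * f (p + e 0) + coordFn p e 1 x * f (p + e 1) +
      coordFn p e 2 x * f (p + e 2)) := by
  have h : x = ((p + coordFn p e 0 x • ((p + e 0) - p)) + coordFn p e 1 x • ((p + e 1) - p)) +
      coordFn p e 2 x • ((p + e 2) - p) := by
    conv_lhs => rw [eq_add_sum_coordFn p e x, Fin.sum_univ_three]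
    simp only [add_sub_cancel_left]
    abel
  conv_lhs => rw [h]
  rw [Fn.add_smul_sub, Fn.add_smul_sub, Fn.add_smul_sub, coSumFn_apply]
  ring

/-- The parameters of the inner chain vertices. -/
noncomputable def chainParam (m : ℕ) (k : Fin (m + 2)) : ℝ :=
  if k = Fin.last (m + 1) then 1 else (k : ℕ) / (4 * (m + 1))

theorem chainParam_le {m : ℕ} (k : Fin (m + 2)) (hk : k ≠ Fin.last (m + 1)) :
    chainParam m k ≤ 1 / 4 := by
  rw [chainParam, if_neg hk, div_le_iff₀ (by positivity)]
  have : (k : ℕ) ≤ m + 1 := Nat.lt_succ_iff.1 k.2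
  have : ((k : ℕ) : ℝ) ≤ m + 1 := by exact_mod_cast this
  linarith

theorem chainParam_strictMono (m : ℕ) : StrictMono (chainParam m) := by
  intro k l hkl
  have hk : k ≠ Fin.last (m + 1) := (hkl.trans_le (Fin.le_last l)).ne
  by_cases hl : l = Fin.last (m + 1)
  · have := chainParam_le k hk
    have h1 : chainParam m l = 1 := by rw [chainParam, if_pos hl]
    linarith
  · rw [chainParam, chainParam, if_neg hk, if_neg hl]
    have : ((k : ℕ) : ℝ) < (l : ℕ) := by exact_mod_cast hkl
    gcongr

/-- The scale of the skylight. -/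
def scale (s z : ℝ) : ℝ := 1 + s * (z + z ^ 5)

theorem scale_bounds {s z : ℝ} (hs : s = 1 ∨ s = -1) (hz : 0 < z) (hz1 : z ≤ 1 / 256) :
    1 / 2 ≤ scale s z ∧ scale s z ≤ 2 := by
  have h5 : z ^ 5 ≤ z := pow_le_of_le_one hz.le (by linarith) (by norm_num)
  have h5' : 0 < z ^ 5 := by positivity
  rcases hs with rfl | rfl <;> constructor <;> simp only [scale] <;> linarith

theorem lam_eq {s z : ℝ} (hs : s = 1 ∨ s = -1) (hz : 0 < z) (hz1 : z ≤ 1 / 256) :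
    1 - (1 + s * z) / scale s z = s * z ^ 5 / scale s z := by
  have := (scale_bounds hs hz hz1).1
  have h0 : scale s z ≠ 0 := by linarith
  field_simp
  simp only [scale]; ring

theorem abs_lam_sub {s z : ℝ} (hs : s = 1 ∨ s = -1) (hz : 0 < z) (hz1 : z ≤ 1 / 256) :
    |1 - (1 + s * z) / scale s z| ≤ z / 4 := by
  have hb := (scale_bounds hs hz hz1).1
  have h0 : 0 < scale s z := by linarith
  have h5 : z ^ 5 ≤ z / 8 := by
    have : z ^ 4 ≤ 1 / 8 := by
      calc z ^ 4 ≤ (1 / 256) ^ 4 := by gcongr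
        _ ≤ 1 / 8 := by norm_num
    calc z ^ 5 = z * z ^ 4 := by ring
      _ ≤ z * (1 / 8) := by gcongr
      _ = z / 8 := by ring
  have hs1 : |s| = 1 := by rcases hs with rfl | rfl <;> simp
  rw [lam_eq hs hz hz1, abs_div, abs_mul, hs1, abs_of_pos h0, abs_of_pos (by positivity), one_mul,
    div_le_iff₀ h0]
  nlinarith

/-- The chain of the cupola at height about `z` over the triangle `p + eᵢ`, on the side `s`. -/
noncomputable def placedChain (p : Space) (e : Module.Basis (Fin 3) ℝ Space) (s z : ℝ) (m : ℕ)
    (hs : s = 1 ∨ s = -1) (hz : 0 < z) (hz1 : z ≤ 1 / 256) : Chain m where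
  p := p
  e := e.unitsSMul fun _ => Units.mk0 (scale s z) (by
    have := (scale_bounds hs hz hz1).1
    linarith)
  mu := z
  gam := (1 + s * z) / scale s z / z + 2
  mu_pos := hz
  mu_le := by linarith
  le_gam := by
    have := abs_le.1 (abs_lam_sub hs hz hz1)
    have h1 : 12 ≤ (1 + s * z) / scale s z / z := by
      rw [le_div_iff₀ hz]; linarith
    linarith
  lam_le := by
    have := abs_le.1 (abs_lam_sub hs hz hz1)
    rw [add_sub_cancel_right, mul_div_cancel₀ _ hz.ne']
    linarith
  le_lam := by
    have := abs_le.1 (abs_lam_sub hs hz hz1)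
    rw [add_sub_cancel_right, mul_div_cancel₀ _ hz.ne']
    linarith
  lam_ne := by
    rw [add_sub_cancel_right, mul_div_cancel₀ _ hz.ne']
    have h1 := lam_eq hs hz hz1
    have h2 : s * z ^ 5 / scale s z ≠ 0 := by
      have := (scale_bounds hs hz hz1).1
      have h0 : scale s z ≠ 0 := by linarith
      have : s ≠ 0 := by rcases hs with rfl | rfl <;> norm_num
      positivity
    intro h
    rw [h, sub_self] at h1
    exact h2 h1.symm
  eta := z ^ 2
  tau := chainParam m
  eta_pos := by positivity
  eta_le := by nlinarith
  tau_mono := chainParam_strictMono m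
  tau_zero := by
    rw [chainParam, if_neg (Fin.last_pos).ne]; simp
  tau_last := by simp [chainParam]
  tau_le := chainParam_le

section
variable (p : Space) (e : Module.Basis (Fin 3) ℝ Space) {s z : ℝ} (m : ℕ)
  (hs : s = 1 ∨ s = -1) (hz : 0 < z) (hz1 : z ≤ 1 / 256)

theorem placed_t (i : Fin 3) (x : Space) :
    (placedChain p e s z m hs hz hz1).t i x = coordFn p e i x / scale s z := by
  have h0 : (placedChain p e s z m hs hz hz1).t i x =
    (e.unitsSMul fun _ => Units.mk0 (scale s z) (by
      have := (scale_bounds hs hz hz1).1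
      linarith)).coord i x - (e.unitsSMul fun _ => Units.mk0 (scale s z) (by
      have := (scale_bounds hs hz hz1).1
      linarith)).coord i p := Frame.t_apply _ _ _
  rw [h0, Module.Basis.coord_unitsSMul, coordFn_apply]
  simp [Units.smul_def]
  ring

theorem placed_lam : (placedChain p e s z m hs hz hz1).lam = (1 + s * z) / scale s z := by
  simp only [Frame.lam, placedChain]
  rw [add_sub_cancel_right, mul_div_cancel₀ _ hz.ne']

theorem placed_h (x : Space) :
    z ^ 5 * (placedChain p e s z m hs hz hz1).h x = s * coSumFn p e x + z + z ^ 5 := by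
  have h := (placedChain p e s z m hs hz hz1).sum_t 0 x
  rw [placed_lam, lam_eq hs hz hz1] at h
  simp only [zero_add, placed_t] at h
  have := (scale_bounds hs hz hz1).1
  have h0 : scale s z ≠ 0 := by linarith
  have h2 : s * s = 1 := by rcases hs with rfl | rfl <;> norm_num
  field_simp at h
  rw [coSumFn_apply]
  generalize (placedChain p e s z m hs hz hz1).h x = H at *
  simp only [scale] at h
  linear_combination s * h + (z + z ^ 5 - z ^ 5 * H) * h2

theorem placed_isBeyond_bottom {M : ℝ} {x : Space} (hM : M * z ≤ 1 / 256)
    (hx : ∀ i, |coordFn p e i x| ≤ M) (hside : 0 ≤ s * coSumFn p e x) :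
    IsBeyond (placedChain p e s z m hs hz hz1).cup
      (convexHull ℝ (Set.range (placedChain p e s z m hs hz hz1).A)) x := by
  have hh := placed_h p e m hs hz hz1 x
  have ht : ∀ i, |(placedChain p e s z m hs hz hz1).t i x| ≤ 2 * M := by
    intro i
    have hb := (scale_bounds hs hz hz1).1
    have h0 : 0 < scale s z := by linarith
    rw [placed_t, abs_div, abs_of_pos h0, div_le_iff₀ h0]
    have := hx i
    have := abs_nonneg (coordFn p e i x)
    nlinarith
  have hmu : (placedChain p e s z m hs hz hz1).mu = z := rfl
  have heta : (placedChain p e s z m hs hz hz1).eta = z ^ 2 := rfl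
  generalize placedChain p e s z m hs hz hz1 = D at *
  obtain ⟨w, hw⟩ : ∃ w, w = z⁻¹ := ⟨_, rfl⟩
  have hzw : z * w = 1 := by rw [hw, mul_inv_cancel₀ hz.ne']
  have hw1 : 256 ≤ w := by
    rw [hw, le_inv_comm₀ (by norm_num) hz]; linarith
  have hMw : 2 * M ≤ w / 128 := by
    have : M = M * z * w := by rw [mul_assoc, hzw, mul_one]
    nlinarith
  have hH : w ^ 4 ≤ D.h x := by
    have h1 : z * z ^ 4 ≤ z * (z ^ 4 * D.h x) := by
      have : 0 < z ^ 5 := by positivity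
      nlinarith [pow_le_of_le_one hz.le (by linarith : z ≤ 1) (show 4 ≠ 0 by norm_num)]
    have h2 : z ≤ z * (z ^ 4 * D.h x) := by
      have : 0 < z ^ 5 := by positivity
      linarith
    have h3 : 1 ≤ z ^ 4 * D.h x := by
      by_contra! h
      nlinarith
    calc w ^ 4 = w ^ 4 * 1 := by ring
      _ ≤ w ^ 4 * (z ^ 4 * D.h x) := by gcongr
      _ = (z * w) ^ 4 * D.h x := by ring
      _ = D.h x := by rw [hzw]; ring
  have hw2 : 65536 ≤ w ^ 2 := by nlinarith
  have hHw : 65536 * w ^ 2 ≤ D.h x := by nlinarith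
  have hzH : 256 * w ^ 2 ≤ z * D.h x := by
    have h1 : z * w ^ 4 ≤ z * D.h x := by gcongr
    have h2 : z * w ^ 4 = w * w ^ 2 := by
      calc z * w ^ 4 = (z * w) * (w * w ^ 2) := by ring
        _ = w * w ^ 2 := by rw [hzw, one_mul]
    nlinarith
  have hgam := D.gam_le_inv_mu
  have hgam1 := D.le_gam
  rw [hmu, ← hw] at hgam
  have ht' : ∀ i, -(w / 128) ≤ D.t i x ∧ D.t i x ≤ w / 128 := fun i =>
    abs_le.1 ((ht i).trans hMw)
  have ha : ∀ i, -w ^ 2 ≤ D.a i x ∧ D.a i x ≤ w ^ 2 := by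
    intro i
    obtain ⟨h1, h2⟩ := ht' (i + 2)
    rw [D.a_apply, hmu, ← hw]
    constructor <;> nlinarith
  have hb : ∀ i, -w ^ 2 ≤ D.t i x + D.gam * D.t (i + 2) x ∧
      D.t i x + D.gam * D.t (i + 2) x ≤ w ^ 2 := by
    intro i
    obtain ⟨h1, h2⟩ := ht' (i + 2)
    obtain ⟨h3, h4⟩ := ht' i
    have h5 : D.gam * D.t (i + 2) x ≤ (w + 3) * (w / 128) := by
      calc D.gam * D.t (i + 2) x ≤ D.gam * (w / 128) := by gcongr
        _ ≤ _ := by gcongr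
    have h6 : D.gam * (-D.t (i + 2) x) ≤ (w + 3) * (w / 128) := by
      calc D.gam * (-D.t (i + 2) x) ≤ D.gam * (w / 128) := by gcongr; linarith
        _ ≤ _ := by gcongr
    constructor <;> nlinarith
  have hz2 : z ^ 2 ≤ 1 / 256 := by nlinarith
  have hH0 : 0 ≤ D.h x := by linarith
  apply D.isBeyond_bottom
  · rw [D.bot_apply]; linarith
  · intro f hf hne
    rcases hf with ((rfl | rfl) | ⟨⟨i, k⟩, rfl⟩) | ⟨⟨i, k⟩, rfl⟩
    · exact absurd rfl hne
    · linarith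
    · obtain ⟨a1, a2⟩ := ha i
      obtain ⟨b1, b2⟩ := hb i
      have hX := D.X_nonneg k
      have hY := D.Y_nonneg k
      have hY1 := D.Y_le k
      rw [heta] at hY1
      rw [D.lB_apply, D.v_apply, D.b_apply, hmu]
      have h1 : -D.h x ≤ 1 - D.t i x - D.gam * D.t (i + 2) x - (1 + z) * D.h x +
          (D.h x - D.a i x) := by nlinarith
      have h2 := mul_le_mul_of_nonneg_left h1 hY
      have h3 := mul_nonneg hX hH0
      nlinarith
    · obtain ⟨a1, a2⟩ := ha i
      obtain ⟨b1, b2⟩ := hb i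
      have hX := D.X_nonneg k
      have hY := D.Y_nonneg k
      have hY1 := D.Y_le k
      rw [heta] at hY1
      rw [D.lA_apply, D.u_apply, D.b_apply, hmu]
      have h1 : 0 ≤ D.a i x +
          (1 - D.h x - (1 - D.t i x - D.gam * D.t (i + 2) x - (1 + z) * D.h x)) := by linarith
      have h2 := mul_nonneg hX h1
      have h3 : D.Y k * D.h x ≤ z * D.h x / 256 := by
        have := mul_le_mul_of_nonneg_right hY1 hH0
        have : z ^ 2 * D.h x = z * (z * D.h x) := by ring
        nlinarith
      linarith

theorem Chain.cup_bounds {m : ℕ} (D : Chain m) {x : Space} (hx : x ∈ D.cup) :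
    (∀ i, -(2 * D.mu) ≤ D.t i x) ∧ 0 ≤ D.h x ∧ D.h x ≤ 1 := by
  refine ⟨fun i => ?_, D.fns_nonneg_cup D.h_mem hx, ?_⟩
  · have h := (D.t i + AffineMap.const ℝ Space (2 * D.mu)).nonneg_of_mem_convexHull
      (W := D.verts) ?_ hx
    · simp only [AffineMap.coe_add, Pi.add_apply, AffineMap.const_apply] at h
      linarith
    · rintro _ ⟨⟨j, k⟩, rfl⟩
      simp only [AffineMap.coe_add, Pi.add_apply, AffineMap.const_apply]
      have hl := D.lam_pos
      have hl1 := D.lam_lt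
      have hm := D.mu_pos
      have hm1 := D.mu_le
      have hA : ∀ l, -D.mu ≤ D.t i (D.A l) ∧ D.t i (D.A l) ≤ 2 := fun l => by
        rw [D.t_A]; split_ifs <;> constructor <;> linarith
      have hB : ∀ l, 0 ≤ D.t i (D.B l) ∧ D.t i (D.B l) ≤ 1 := fun l => by
        rw [D.t_B]; split_ifs <;> constructor <;> norm_num
      rw [D.apply_q]
      have hg0 := D.g_nonneg k
      have hg1 := D.g_le k
      have he := D.eta_le
      have hs0 := D.tau_nonneg k
      have hs1 := D.tau_le_one k
      have e1 := mul_le_mul_of_nonneg_left (hA j).1 (show 0 ≤ 1 - D.tau k + D.g k by linarith)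
      have e2 := mul_nonneg (show 0 ≤ D.tau k + D.g k by linarith) (hB (j + 1)).1
      have e3 := mul_le_mul_of_nonneg_left (hB j).2 hg0
      have e4 := mul_le_mul_of_nonneg_left (hA (j + 1)).2 hg0
      nlinarith
  · have := D.fns_nonneg_cup D.bot_mem hx
    rw [D.bot_apply] at this
    linarith

theorem placed_bounds {x : Space} (hx : x ∈ (placedChain p e s z m hs hz hz1).cup) :
    (∀ i, -(4 * z) ≤ coordFn p e i x) ∧ -(2 * z) ≤ s * coSumFn p e x ∧
      s * coSumFn p e x ≤ -z := by
  have hh := placed_h p e m hs hz hz1 x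
  obtain ⟨h1, h2, h3⟩ := (placedChain p e s z m hs hz hz1).cup_bounds hx
  have hmu : (placedChain p e s z m hs hz hz1).mu = z := rfl
  have h5 : z ^ 5 ≤ z := pow_le_of_le_one hz.le (by linarith) (by norm_num)
  have h50 : 0 < z ^ 5 := by positivity
  refine ⟨fun i => ?_, ?_, ?_⟩
  · have hb := scale_bounds hs hz hz1
    have h0 : 0 < scale s z := by linarith
    have := h1 i
    rw [placed_t, hmu, le_div_iff₀ h0] at this
    nlinarith
  · nlinarith
  · nlinarith

/-- Points of the placed cupola satisfy every inequality that is sufficiently strict on the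
triangle `p + eᵢ`. -/
theorem placed_pos {M : ℝ} {x : Space} (hM : M * z ≤ 1 / 256)
    (hx : x ∈ (placedChain p e s z m hs hz hz1).cup) (f : Fn) (hf : ∀ i, 0 < f (p + e i))
    (hfij : ∀ i j, f (p + e j) ≤ M * f (p + e i)) (hfp : ∀ i, |f p| ≤ M * f (p + e i)) :
    0 < f x := by
  obtain ⟨ht, hS2, hS1⟩ := placed_bounds p e m hs hz hz1 hx
  obtain ⟨i, hi⟩ := Finite.exists_min fun i => f (p + e i)
  rw [f.apply_coord p e x]
  have hc := coSumFn_apply p e x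
  have habs : |coSumFn p e x| ≤ 2 * z := by
    rw [abs_le]
    rcases hs with rfl | rfl <;> constructor <;> linarith
  have hE := hf i
  have hp := hfp i
  have hj := hfij i
  set E := f (p + e i)
  have e1 : -(2 * z * (M * E)) ≤ coSumFn p e x * f p := by
    have : |coSumFn p e x * f p| ≤ 2 * z * (M * E) := by
      rw [abs_mul]; gcongr
    exact (abs_le.1 this).1
  have e2 : ∀ j, coordFn p e j x * E + 4 * z * E - 4 * z * (M * E) ≤
      coordFn p e j x * f (p + e j) := by
    intro j
    have a1 := mul_le_mul_of_nonneg_left (hi j) (show 0 ≤ coordFn p e j x + 4 * z by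
      linarith [ht j])
    have a2 := mul_le_mul_of_nonneg_left (hj j) (show 0 ≤ 4 * z by linarith)
    linarith
  have e3 : z * (M * E) ≤ E / 256 := by nlinarith
  have e4 : (coordFn p e 0 x + coordFn p e 1 x + coordFn p e 2 x) * E ≥ (1 - 2 * z) * E := by
    have := (abs_le.1 habs).2
    apply mul_le_mul_of_nonneg_right _ hE.le
    linarith
  have e5 : z * E ≤ E / 256 := by nlinarith
  have := e2 0
  have := e2 1
  have := e2 2
  have : 0 < z * E := by positivity
  linarith

end

/-! ### Relative interiors of facets -/

theorem eventually_mem_of_mem_intrinsicInterior {F : Set Space} {x w : Space}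
    (hx : x ∈ intrinsicInterior ℝ F) (hw : w ∈ vectorSpan ℝ F) :
    ∀ᶠ r in 𝓝 (0 : ℝ), x + r • w ∈ F := by
  obtain ⟨y, hy, rfl⟩ := mem_intrinsicInterior.1 hx
  have hmem : ∀ r : ℝ, (y : Space) + r • w ∈ affineSpan ℝ F := fun r => by
    rw [add_comm]
    exact AffineSubspace.vadd_mem_of_mem_direction
      (by rw [direction_affineSpan]; exact Submodule.smul_mem _ _ hw) y.2
  have hc : Continuous fun r : ℝ => (⟨(y : Space) + r • w, hmem r⟩ : affineSpan ℝ F) := by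
    fun_prop
  have h0 : (⟨(y : Space) + (0 : ℝ) • w, hmem 0⟩ : affineSpan ℝ F) = y := by
    ext1; simp
  have h1 := hc.tendsto 0
  rw [h0] at h1
  exact h1.eventually (mem_interior_iff_mem_nhds.1 hy)

theorem Fn.eq_zero_of_intrinsicInterior (g : Fn) {F : Set Space} (hg : ∀ y ∈ F, 0 ≤ g y)
    {x : Space} (hx : x ∈ intrinsicInterior ℝ F) (h0 : g x = 0) {y : Space} (hy : y ∈ F) :
    g y = 0 := by
  have hw : x - y ∈ vectorSpan ℝ F :=
    vsub_mem_vectorSpan ℝ (intrinsicInterior_subset hx) hy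
  have h1 : ∀ᶠ r in 𝓝[>] (0 : ℝ), x + r • (x - y) ∈ F :=
    (eventually_mem_of_mem_intrinsicInterior hx hw).filter_mono nhdsWithin_le_nhds
  obtain ⟨r, h2, h3⟩ := (h1.and self_mem_nhdsWithin).exists
  have h4 := hg _ h2
  rw [g.add_smul_sub, h0] at h4
  have := hg y hy
  have h3 : 0 < r := h3
  nlinarith

/-- A convex set meeting the plane of a closed set `F`, and meeting `F` only in its relative
interior, meets the plane only in `F`. -/
theorem mem_of_meets_intrinsicInterior {F V : Set Space} (hF : IsClosed F) (hV : Convex ℝ V)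
    (hFV : F ∩ V ⊆ intrinsicInterior ℝ F) {x y : Space} (hx : x ∈ F ∩ V)
    (hy : y ∈ affineSpan ℝ F) (hyV : y ∈ V) : y ∈ F := by
  have hw : y - x ∈ vectorSpan ℝ F := by
    rw [← direction_affineSpan]
    exact AffineSubspace.vsub_mem_direction hy (subset_affineSpan ℝ F hx.1)
  have hc : Continuous fun r : ℝ => x + r • (y - x) := by fun_prop
  have key : Set.Icc (0 : ℝ) 1 ⊆ (fun r : ℝ => x + r • (y - x)) ⁻¹' F := by
    refine IsClosed.Icc_subset_of_forall_mem_nhdsWithin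
      ((hF.preimage hc).inter isClosed_Icc) (by simpa using hx.1) ?_
    rintro r ⟨hr, hr0, hr1⟩
    have hrV : x + r • (y - x) ∈ V := hV.add_smul_sub_mem hx.2 hyV ⟨hr0, hr1.le⟩
    have h1 := eventually_mem_of_mem_intrinsicInterior (hFV ⟨hr, hrV⟩) hw
    have h2 : Filter.Tendsto (fun r' : ℝ => r' - r) (𝓝[>] r) (𝓝 0) := by
      have : Continuous (fun r' : ℝ => r' - r) := by fun_prop
      have h := this.tendsto r
      rw [sub_self] at h
      exact h.mono_left nhdsWithin_le_nhds
    filter_upwards [h2.eventually h1] with r' hr'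
    rw [add_assoc, ← add_smul] at hr'
    simpa using hr'
  have := key (Set.right_mem_Icc.2 zero_le_one)
  simpa using this

theorem convex_coneOf (p : Space) (r : Fin 3 → Space) : Convex ℝ (coneOf p r) := by
  rintro _ ⟨t, ht, rfl⟩ _ ⟨t', ht', rfl⟩ a b ha hb hab
  refine ⟨fun i => a * t i + b * t' i, fun i => by
    have := ht i; have := ht' i; positivity, ?_⟩
  obtain rfl : b = 1 - a := by linarith
  simp only [Fin.sum_univ_three]
  module

theorem coneOf_eq {p : Space} {r : Fin 3 → Space} {e : Module.Basis (Fin 3) ℝ Space}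
    {d : Fin 3 → ℝ} (hd : ∀ i, 0 < d i) (he : ∀ i, e i = d i • r i) :
    coneOf p r = {x | ∀ i, 0 ≤ coordFn p e i x} := by
  ext x
  constructor
  · rintro ⟨t, ht, rfl⟩ i
    have h : ∑ j, t j • r j = ∑ j, (t j / d j) • e j := by
      refine Finset.sum_congr rfl fun j _ => ?_
      rw [he, smul_smul, div_mul_cancel₀ _ (hd j).ne']
    rw [coordFn_apply, h, map_add, add_sub_cancel_left, Module.Basis.coord_apply,
      e.repr_sum_self]
    exact div_nonneg (ht i) (hd i).le
  · intro hx
    refine ⟨fun i => coordFn p e i x * d i, fun i => mul_nonneg (hx i) (hd i).le, ?_⟩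
    conv_lhs => rw [eq_add_sum_coordFn p e x]
    simp only [he, smul_smul]

/-- The data of a facet `F` of `P` and a cone with apex `p` meeting it in the triangle `p + eᵢ`. -/
structure IsPlaced (P F : Set Space) (p : Space) (e : Module.Basis (Fin 3) ℝ Space) (s : ℝ) :
    Prop where
  sign : s = 1 ∨ s = -1
  side : ∀ x ∈ P, 0 ≤ s * coSumFn p e x
  facet : F = {x ∈ P | coSumFn p e x = 0}
  corner : ∀ i, p + e i ∈ intrinsicInterior ℝ F

theorem IsPolytope3.isCompact {P : Set Space} (hP : IsPolytope3 P) : IsCompact P := by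
  obtain ⟨⟨W, hW, rfl⟩, _⟩ := hP
  exact hW.isCompact_convexHull (𝕜 := ℝ)

theorem IsPolytope3.convex {P : Set Space} (hP : IsPolytope3 P) : Convex ℝ P := by
  obtain ⟨⟨W, hW, rfl⟩, _⟩ := hP
  exact convex_convexHull ℝ _

theorem exists_isPlaced {P F : Set Space} {p : Space} {r : Fin 3 → Space} (hP : IsPolytope3 P)
    (hF : IsFacet P F) (hr : LinearIndependent ℝ r) (hT : IsTriangle (F ∩ coneOf p r))
    (hint : F ∩ coneOf p r ⊆ intrinsicInterior ℝ F) :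
    ∃ (e : Module.Basis (Fin 3) ℝ Space) (d : Fin 3 → ℝ) (s : ℝ), (∀ i, 0 < d i) ∧
      (∀ i, e i = d i • r i) ∧ IsPlaced P F p e s := by
  obtain ⟨f, hf, hFf, y, hy, hfy⟩ := exists_fn_of_isFacet hF hP.2
  have hfF : ∀ x ∈ F, f x = 0 := fun x hx => by rw [hFf] at hx; exact hx.2
  have hFcl : IsClosed F := by
    rw [hFf]
    exact hP.isCompact.isClosed.inter (isClosed_eq f.cont continuous_const)
  have hFb : Bornology.IsBounded F := hP.isCompact.isBounded.subset (by
    rw [hFf]; exact Set.sep_subset _ _)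
  have hVF : ∀ x ∈ F ∩ coneOf p r, ∀ y ∈ coneOf p r, f y = 0 → y ∈ F := fun x hx y hy h0 =>
    mem_of_meets_intrinsicInterior hFcl (convex_coneOf p r) hint hx
      ((affineSpan_eq_zeros f hF.2 hfF hfy.ne' y).2 h0) hy
  obtain ⟨x, hx, hxp⟩ : ∃ x ∈ F ∩ coneOf p r, x ≠ p := by
    obtain ⟨D, hD, hTD⟩ := hT
    have hmem : ∀ i, D i ∈ F ∩ coneOf p r := fun i => by
      rw [hTD]; exact subset_convexHull ℝ _ ⟨i, rfl⟩
    by_cases h : D 0 = p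
    · exact ⟨D 1, hmem 1, fun h1 => by
        have := hD.injective (h.trans h1.symm)
        exact absurd this (by decide)⟩
    · exact ⟨D 0, hmem 0, h⟩
  obtain ⟨t, ht, hxt⟩ := hx.2
  have hlin : ∀ t : Fin 3 → ℝ, f (p + ∑ i, t i • r i) = f p + ∑ i, t i * f.linear (r i) := by
    intro t
    have := f.map_vadd p (∑ i, t i • r i)
    simp only [vadd_eq_add] at this
    rw [add_comm, this, map_sum, add_comm]
    simp
  set α : Fin 3 → ℝ := fun i => f.linear (r i) with hα
  have hno : ∀ c : Fin 3 → ℝ, (∀ i, 0 ≤ c i) → ∑ i, c i * α i = 0 → c = 0 := by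
    intro c hc h0
    by_contra hne
    have hw : ∑ i, c i • r i ≠ 0 := fun h => hne
      (funext (Fintype.linearIndependent_iff.1 hr c h))
    obtain ⟨B, hB⟩ := hFb.exists_norm_le
    have hmem : ∀ k : ℝ, 0 ≤ k → x + k • ∑ i, c i • r i ∈ F := by
      intro k hk
      have hxk : x + k • ∑ i, c i • r i = p + ∑ i, (t i + k * c i) • r i := by
        rw [hxt]
        simp only [Fin.sum_univ_three]; module
      refine hVF x hx _ ?_ ?_
      · exact ⟨fun i => t i + k * c i, fun i => by have := ht i; have := hc i; positivity, hxk⟩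
      · have h1 := hfF x hx.1
        rw [hxt, hlin] at h1
        rw [hxk, hlin]
        simp only [Fin.sum_univ_three] at h0 h1 ⊢
        linear_combination h1 + k * h0
    have hpos : 0 < ‖∑ i, c i • r i‖ := norm_pos_iff.2 hw
    have hB0 : 0 ≤ B := (norm_nonneg x).trans (hB x hx.1)
    have h1 := hB _ (hmem ((2 * B + 1) / ‖∑ i, c i • r i‖) (by positivity))
    have h2 := norm_sub_le (x + ((2 * B + 1) / ‖∑ i, c i • r i‖) • ∑ i, c i • r i) x
    rw [add_sub_cancel_left, norm_smul, Real.norm_of_nonneg (by positivity),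
      div_mul_cancel₀ _ hpos.ne'] at h2
    have h3 := hB x hx.1
    linarith
  have hα0 : ∀ i, α i ≠ 0 := by
    intro i h
    have := hno (fun j => if j = i then 1 else 0) (fun j => by split_ifs <;> norm_num)
      (by simp [h])
    have := congrFun this i
    simp at this
  have hαα : ∀ i j, 0 < α i * α j := by
    intro i j
    by_contra! h
    have hlt : α i * α j < 0 := lt_of_le_of_ne h (mul_ne_zero (hα0 i) (hα0 j))
    have hij : i ≠ j := by
      rintro rfl
      nlinarith [mul_self_nonneg (α i)]
    have hq : 0 < -(α j / α i) := by
      rw [Left.neg_pos_iff]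
      rw [div_neg_iff]
      rcases mul_neg_iff.1 hlt with h | h
      · exact Or.inr ⟨h.2, h.1⟩
      · exact Or.inl ⟨h.2, h.1⟩
    have := hno (fun k => (if k = j then 1 else 0) + (if k = i then -(α j / α i) else 0))
      (fun k => by split_ifs <;> linarith)
      (by simp [add_mul, Finset.sum_add_distrib, hα0 i])
    have := congrFun this j
    simp [hij.symm] at this
  have hfp : ∀ i, f p * α i < 0 := by
    intro i
    have h1 := hfF x hx.1
    rw [hxt, hlin] at h1
    obtain ⟨j, hj⟩ : ∃ j, t j ≠ 0 := by
      by_contra! h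
      exact hxp (by rw [hxt]; simp [h])
    have h2 : 0 < ∑ k, t k * (α k * α i) :=
      Finset.sum_pos' (fun k _ => mul_nonneg (ht k) (hαα k i).le)
        ⟨j, Finset.mem_univ j, mul_pos (lt_of_le_of_ne (ht j) (Ne.symm hj)) (hαα j i)⟩
    have h3 : ∑ k, t k * (α k * α i) = (∑ k, t k * α k) * α i := by
      rw [Finset.sum_mul]; exact Finset.sum_congr rfl fun k _ => by ring
    rw [h3] at h2
    have h4 : f p = -∑ k, t k * α k := by linarith
    rw [h4]; linarith
  have hd : ∀ i, 0 < -f p / α i := by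
    intro i
    have h1 := hfp i
    rw [div_pos_iff]
    rcases mul_neg_iff.1 h1 with h | h
    · exact Or.inr ⟨by linarith [h.1], h.2⟩
    · exact Or.inl ⟨by linarith [h.1], h.2⟩
  have hli : LinearIndependent ℝ fun i => (-f p / α i) • r i := by
    have := hr.units_smul fun i => Units.mk0 _ (hd i).ne'
    exact this
  set e := basisOfLinearIndependentOfCardEqFinrank hli (by simp) with he
  have hei : ∀ i, e i = (-f p / α i) • r i := fun i => by
    rw [he, coe_basisOfLinearIndependentOfCardEqFinrank]
  have hfe : ∀ i, f (p + e i) = 0 := by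
    intro i
    have := f.map_vadd p (e i)
    simp only [vadd_eq_add] at this
    rw [add_comm, this, hei, map_smul, smul_eq_mul]
    change -f p / α i * α i + f p = 0
    rw [div_mul_cancel₀ _ (hα0 i)]; ring
  have hfx : ∀ x, f x = coSumFn p e x * f p := by
    intro x
    rw [f.apply_coord p e x, hfe, hfe, hfe]; ring
  have hfp0 : f p ≠ 0 := fun h => by have := hfp 0; rw [h, zero_mul] at this; exact lt_irrefl _ this
  refine ⟨e, fun i => -f p / α i, if 0 < f p then 1 else -1, hd, hei, ?_, ?_, ?_, ?_⟩
  · split_ifs <;> simp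
  · intro x hx
    have h1 := hf x hx
    rw [hfx] at h1
    split_ifs with h
    · rw [one_mul]; exact nonneg_of_mul_nonneg_left h1 h
    · have : f p < 0 := lt_of_le_of_ne (not_lt.1 h) hfp0
      nlinarith
  · rw [hFf]; ext x
    simp only [Set.mem_ofPred_eq]
    refine and_congr_right fun _ => ?_
    rw [hfx x, mul_eq_zero, or_iff_left hfp0]
  · intro i
    have hV : p + e i ∈ coneOf p r := by
      rw [coneOf_eq hd hei]
      intro j
      rw [coordFn_apply, map_add, add_sub_cancel_left, Module.Basis.coord_apply,
        Module.Basis.repr_self, Finsupp.single_apply]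
      split_ifs <;> norm_num
    exact hint ⟨hVF x hx _ hV (hfe i), hV⟩

/-! ### The plane through three points -/

/-- The normal vector of the plane through three points. -/
def normalVec (w : Fin 3 → Space) : Fin 3 → ℝ :=
  crossProduct (fun i => w 1 i - w 0 i) (fun i => w 2 i - w 0 i)

/-- The functional vanishing on the plane through three points. -/
noncomputable def normalFn (w : Fin 3 → Space) : Fn :=
  Fn.ofDual (∑ i, normalVec w i • EuclideanSpace.proj i) (∑ i, normalVec w i * w 0 i)

theorem normalFn_apply (w : Fin 3 → Space) (x : Space) :
    normalFn w x = ∑ i, normalVec w i * (x i - w 0 i) := by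
  simp only [normalFn, Fn.ofDual_apply, Fin.sum_univ_three]
  simp
  ring

theorem normalFn_vertex (w : Fin 3 → Space) (i : Fin 3) : normalFn w (w i) = 0 := by
  rw [normalFn_apply]
  fin_cases i <;> simp [normalVec, cross_apply, Fin.sum_univ_three] <;> ring

theorem normalVec_ne_zero {w : Fin 3 → Space} (hw : AffineIndependent ℝ w) :
    normalVec w ≠ 0 := by
  have h := (affineIndependent_iff_linearIndependent_vsub ℝ w 0).1 hw
  rw [normalVec, crossProduct_ne_zero_iff_linearIndependent]
  have h1 := h.comp (![⟨1, by decide⟩, ⟨2, by decide⟩] : Fin 2 → {x : Fin 3 // x ≠ 0}) (by decide)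
  have h2 : LinearIndependent ℝ ![w 1 - w 0, w 2 - w 0] := by
    have h3 : ![w 1 - w 0, w 2 - w 0] = (fun i : {x : Fin 3 // x ≠ 0} => w i -ᵥ w 0) ∘
        ![⟨1, by decide⟩, ⟨2, by decide⟩] := by
      ext i j
      fin_cases i <;> rfl
    rw [h3]
    exact h1
  rw [LinearIndependent.pair_iff] at h2 ⊢
  intro a b hab
  refine h2 a b ?_
  ext i
  simpa using congrFun hab i

theorem exists_normalFn_ne_zero {w : Fin 3 → Space} (hw : AffineIndependent ℝ w) :
    ∃ x, normalFn w x ≠ 0 := by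
  by_contra! h
  refine normalVec_ne_zero hw (funext fun i => ?_)
  have := h (w 0 + EuclideanSpace.single i 1)
  rw [normalFn_apply] at this
  simpa [PiLp.single_apply] using this

theorem normalFn_proportional {w : Fin 3 → Space} (hw : AffineIndependent ℝ w) (g : Fn)
    (hg : ∀ i, g (w i) = 0) : ∃ k : ℝ, ∀ x, g x = k * normalFn w x := by
  obtain ⟨y, hy⟩ := exists_normalFn_ne_zero hw
  have hG : Module.finrank ℝ (vectorSpan ℝ (Set.range w)) = 2 :=
    hw.finrank_vectorSpan (by simp)
  refine ⟨_, (normalFn w).proportional g hG ?_ ?_ hy⟩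
  · rintro _ ⟨i, rfl⟩; exact normalFn_vertex w i
  · rintro _ ⟨i, rfl⟩; exact hg i

/-! ### Vertices of facets -/

theorem IsPolytope3.finite_extremePoints {P : Set Space} (hP : IsPolytope3 P) :
    (P.extremePoints ℝ).Finite := by
  obtain ⟨⟨W, hW, rfl⟩, _⟩ := hP
  exact hW.subset extremePoints_convexHull_subset

theorem IsPolytope3.convexHull_extremePoints {P : Set Space} (hP : IsPolytope3 P) :
    convexHull ℝ (P.extremePoints ℝ) = P := by
  have h := closure_convexHull_extremePoints hP.isCompact hP.convex
  rwa [(hP.finite_extremePoints.isCompact_convexHull (𝕜 := ℝ)).isClosed.closure_eq] at h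

theorem IsFacet.exists_affineIndependent {P G : Set Space} (hP : IsPolytope3 P)
    (hG : IsFacet P G) :
    ∃ w : Fin 3 → Space, (∀ i, w i ∈ P.extremePoints ℝ ∧ w i ∈ G) ∧ AffineIndependent ℝ w := by
  obtain ⟨f, hf, hGf, -⟩ := exists_fn_of_isFacet hG hP.2
  have hext : P.extremePoints ℝ ⊆ P := extremePoints_subset
  have h1 : G = convexHull ℝ {w ∈ P.extremePoints ℝ | f w = 0} := by
    rw [← f.convexHull_inter_zeros (fun w hw => hf w (hext hw)), hP.convexHull_extremePoints, hGf]
  have h2 := hG.2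
  rw [h1, Chain.vectorSpan_convexHull] at h2
  obtain ⟨t, hts, hspan, hind⟩ := _root_.exists_affineIndependent ℝ Space
    {w ∈ P.extremePoints ℝ | f w = 0}
  have hfin : t.Finite := hP.finite_extremePoints.subset (hts.trans (Set.sep_subset _ _))
  have := hfin.fintype
  have hne : t.Nonempty := by
    rw [← affineSpan_nonempty (k := ℝ), hspan, affineSpan_nonempty]
    exact nonempty_of_finrank h2
  have := hne.to_subtype
  have h3 := hind.finrank_vectorSpan_add_one
  rw [Subtype.range_coe, ← direction_affineSpan, hspan, direction_affineSpan, h2] at h3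
  have eq := Fintype.equivFinOfCardEq h3.symm
  refine ⟨fun i => (eq.symm i : Space), fun i => ?_, hind.comp_embedding eq.symm.toEmbedding⟩
  have := hts (eq.symm i).2
  refine ⟨this.1, ?_⟩
  rw [hGf]
  exact ⟨hext this.1, this.2⟩

/-! ### Bounds that allow a cupola of small height -/

/-- `M` bounds the coordinates of the vertices of `P` and the ratios of the values at `p` and
`p + eᵢ` of the functionals defining planes through vertices of `P`. -/
structure IsGood (P : Set Space) (p : Space) (e : Module.Basis (Fin 3) ℝ Space) (M : ℝ) :
    Prop where
  coord : ∀ w ∈ P.extremePoints ℝ, ∀ i, |coordFn p e i w| ≤ M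
  ratio : ∀ w : Fin 3 → Space, (∀ i, w i ∈ P.extremePoints ℝ) → ∀ i, normalFn w (p + e i) ≠ 0 →
    ∀ y ∈ insert p (Set.range fun j => p + e j), |normalFn w y| ≤ M * |normalFn w (p + e i)|

theorem exists_isGood {P : Set Space} (hP : IsPolytope3 P) (p : Space)
    (e : Module.Basis (Fin 3) ℝ Space) : ∃ R : ℕ, IsGood P p e (2 ^ R) := by
  have hlim : Filter.Tendsto (fun R : ℕ => (2 : ℝ) ^ R) Filter.atTop Filter.atTop :=
    tendsto_pow_atTop_atTop_of_one_lt (by norm_num)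
  have h1 : ∀ᶠ R : ℕ in Filter.atTop, ∀ w ∈ P.extremePoints ℝ, ∀ i,
      |coordFn p e i w| ≤ 2 ^ R := by
    rw [Filter.eventually_all_finite hP.finite_extremePoints]
    intro w _
    rw [Filter.eventually_all]
    intro i
    exact hlim.eventually_ge_atTop _
  have h2 : ∀ᶠ R : ℕ in Filter.atTop, ∀ w ∈ {w : Fin 3 → Space | ∀ i, w i ∈ P.extremePoints ℝ},
      ∀ i, ∀ y ∈ insert p (Set.range fun j => p + e j), normalFn w (p + e i) ≠ 0 →
      |normalFn w y| ≤ 2 ^ R * |normalFn w (p + e i)| := by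
    rw [Filter.eventually_all_finite (by
      have := Set.Finite.pi' (fun _ : Fin 3 => hP.finite_extremePoints)
      exact this)]
    intro w _
    rw [Filter.eventually_all]
    intro i
    rw [Filter.eventually_all_finite ((Set.finite_range _).insert _)]
    intro y _
    filter_upwards [hlim.eventually_ge_atTop (|normalFn w y| / |normalFn w (p + e i)|)] with R hR h0
    exact (div_le_iff₀ (abs_pos.2 h0)).1 hR
  obtain ⟨R, h1, h2⟩ := (h1.and h2).exists
  exact ⟨R, h1, fun w hw i h0 y hy => h2 w hw i y hy h0⟩

section
variable {P F : Set Space} {p : Space} {e : Module.Basis (Fin 3) ℝ Space} {s z M : ℝ}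

theorem IsGood.abs_coordFn_le (hP : IsPolytope3 P) (h : IsGood P p e M) {x : Space} (hx : x ∈ P)
    (i : Fin 3) : |coordFn p e i x| ≤ M := by
  rw [← hP.convexHull_extremePoints] at hx
  rw [abs_le]
  constructor
  · have := (coordFn p e i + AffineMap.const ℝ Space M).nonneg_of_mem_convexHull
      (fun w hw => by have := (abs_le.1 (h.coord w hw i)).1; simp; linarith) hx
    simp at this; linarith
  · have := Fn.nonneg_of_mem_convexHull (AffineMap.const ℝ Space M - coordFn p e i)
      (fun w hw => by have := (abs_le.1 (h.coord w hw i)).2; simp; linarith) hx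
    simp at this; linarith

theorem IsPlaced.beyond_bottom (hP : IsPolytope3 P) (hpl : IsPlaced P F p e s)
    (hM : IsGood P p e M) (m : ℕ) (hz : 0 < z) (hz1 : z ≤ 1 / 256) (hMz : M * z ≤ 1 / 256)
    {x : Space} (hx : x ∈ P) :
    IsBeyond (placedChain p e s z m hpl.sign hz hz1).cup
      (convexHull ℝ (Set.range (placedChain p e s z m hpl.sign hz hz1).A)) x :=
  placed_isBeyond_bottom p e m hpl.sign hz hz1 hMz (hM.abs_coordFn_le hP hx) (hpl.side x hx)

theorem IsPlaced.isBeyond (hP : IsPolytope3 P) (hF : IsFacet P F) (hpl : IsPlaced P F p e s)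
    (hM : IsGood P p e M) (m : ℕ) (hz : 0 < z) (hz1 : z ≤ 1 / 256) (hMz : M * z ≤ 1 / 256)
    {x : Space} (hx : x ∈ (placedChain p e s z m hpl.sign hz hz1).cup) : IsBeyond P F x := by
  intro G hG l c hlc hGl
  set g : Fn := -Fn.ofDual l c with hg
  have hgx : ∀ y, g y = c - l y := fun y => by simp [hg]
  have hg0 : ∀ y ∈ P, 0 ≤ g y := fun y hy => by rw [hgx]; linarith [hlc y hy]
  have hgG : ∀ y ∈ G, g y = 0 := fun y hy => by
    rw [hGl] at hy; rw [hgx, hy.2, sub_self]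
  obtain ⟨y, hyP, hy⟩ : ∃ y ∈ P, g y ≠ 0 := by
    by_contra! h
    have h1 : G = P := by
      rw [hGl]; ext y
      exact ⟨fun hy => hy.1, fun hy => ⟨hy, by have := h y hy; rw [hgx] at this; linarith⟩⟩
    have h2 := hG.2
    rw [h1, finrank_vectorSpan_of_interior hP.2] at h2
    omega
  have hFP : F ⊆ P := by rw [hpl.facet]; exact Set.sep_subset _ _
  constructor
  · intro hFG
    have hval : ∀ y, (s • coSumFn p e) y = s * coSumFn p e y := fun y => by simp
    have hs0 : s ≠ 0 := by rcases hpl.sign with rfl | rfl <;> norm_num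
    obtain ⟨k, hk, hgk⟩ := (s • coSumFn p e).pos_proportional g hP.2 hF.2
      (fun y hy => by rw [hval]; exact hpl.side y hy) hg0
      (fun y hy => by rw [hpl.facet] at hy; rw [hval, hy.2, mul_zero])
      (fun y hy => hgG y (hFG hy)) (y := p) (by rw [hval, coSumFn_apply]; simp [coordFn_apply, hs0])
      hy
    have h1 := hgk x
    rw [hgx, hval] at h1
    have h2 := (placed_bounds p e m hpl.sign hz hz1 hx).2.2
    nlinarith
  · intro hFG
    have hpos : ∀ i, 0 < g (p + e i) := by
      intro i
      refine lt_of_le_of_ne (hg0 _ (hFP (intrinsicInterior_subset (hpl.corner i)))) fun h0 => ?_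
      refine hFG fun y hyF => ?_
      have := g.eq_zero_of_intrinsicInterior (fun y hy => hg0 y (hFP hy)) (hpl.corner i) h0.symm hyF
      rw [hGl]
      rw [hgx] at this
      exact ⟨hFP hyF, by linarith⟩
    obtain ⟨w, hw, hind⟩ := hG.exists_affineIndependent hP
    obtain ⟨k, hk⟩ := normalFn_proportional hind g fun i => hgG _ (hw i).2
    have hratio : ∀ i, ∀ y ∈ insert p (Set.range fun j => p + e j),
        |g y| ≤ M * g (p + e i) := by
      intro i y hy
      have h1 : normalFn w (p + e i) ≠ 0 := fun h => by
        have := hpos i; rw [hk, h, mul_zero] at this; exact lt_irrefl _ this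
      have h2 := hM.ratio w (fun i => (hw i).1) i h1 y hy
      rw [← abs_of_pos (hpos i), hk, hk (p + e i), abs_mul, abs_mul]
      have := abs_nonneg k
      nlinarith
    have := placed_pos p e m hpl.sign hz hz1 hMz hx g hpos
      (fun i j => (le_abs_self _).trans (hratio i _ (Or.inr ⟨j, rfl⟩)))
      (fun i => hratio i p (Or.inl rfl))
    rw [hgx] at this
    linarith

end

theorem visibilityCone_placed {p : Space} {r : Fin 3 → Space} {e : Module.Basis (Fin 3) ℝ Space}
    {d : Fin 3 → ℝ} (hd : ∀ i, 0 < d i) (he : ∀ i, e i = d i • r i) {s z : ℝ} (m : ℕ)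
    (hs : s = 1 ∨ s = -1) (hz : 0 < z) (hz1 : z ≤ 1 / 256) :
    visibilityCone (placedChain p e s z m hs hz hz1).A (placedChain p e s z m hs hz hz1).B =
      coneOf p r := by
  have hb := (scale_bounds hs hz hz1).1
  have h0 : 0 < scale s z := by linarith
  rw [Frame.visibilityCone_eq, coneOf_eq hd he]
  ext x
  simp only [Set.mem_ofPred_eq, placed_t]
  exact forall_congr' fun i => ⟨fun h => by
    have := mul_nonneg h h0.le
    rwa [div_mul_cancel₀ _ h0.ne'] at this, fun h => div_nonneg h h0.le⟩

/-! ### Rational numbers of bounded size -/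

/-- `x` is a fraction with numerator and denominator at most `2 ^ L`. -/
def RatBound (L : ℕ) (x : ℝ) : Prop :=
  ∃ (n : ℤ) (d : ℕ), 0 < d ∧ d ≤ 2 ^ L ∧ n.natAbs ≤ 2 ^ L ∧ x = n / d

namespace RatBound
variable {L M : ℕ} {x y : ℝ}

theorem mono (h : RatBound L x) (hLM : L ≤ M) : RatBound M x := by
  obtain ⟨n, d, hd, hdL, hn, rfl⟩ := h
  have := Nat.pow_le_pow_right (n := 2) (by norm_num) hLM
  exact ⟨n, d, hd, hdL.trans this, hn.trans this, rfl⟩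

theorem natCast {k : ℕ} (hk : k ≤ 2 ^ L) : RatBound L (k : ℝ) :=
  ⟨k, 1, one_pos, Nat.one_le_two_pow, by simpa using hk, by simp⟩

theorem one : RatBound 0 1 := by simpa using natCast (L := 0) (k := 1) (by simp)

theorem neg (h : RatBound L x) : RatBound L (-x) := by
  obtain ⟨n, d, hd, hdL, hn, rfl⟩ := h
  exact ⟨-n, d, hd, hdL, by simpa using hn, by push_cast; ring⟩

theorem mul (h : RatBound L x) (h' : RatBound M y) : RatBound (L + M) (x * y) := by
  obtain ⟨n, d, hd, hdL, hn, rfl⟩ := h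
  obtain ⟨n', d', hd', hdL', hn', rfl⟩ := h'
  refine ⟨n * n', d * d', Nat.mul_pos hd hd', ?_, ?_, ?_⟩
  · rw [pow_add]; exact Nat.mul_le_mul hdL hdL'
  · rw [pow_add, Int.natAbs_mul]; exact Nat.mul_le_mul hn hn'
  · push_cast; rw [div_mul_div_comm]

theorem add (h : RatBound L x) (h' : RatBound M y) : RatBound (L + M + 1) (x + y) := by
  obtain ⟨n, d, hd, hdL, hn, rfl⟩ := h
  obtain ⟨n', d', hd', hdL', hn', rfl⟩ := h'
  refine ⟨n * d' + d * n', d * d', Nat.mul_pos hd hd', ?_, ?_, ?_⟩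
  · rw [pow_succ, pow_add]
    have := Nat.mul_le_mul hdL hdL'
    omega
  · refine (Int.natAbs_add_le _ _).trans ?_
    rw [Int.natAbs_mul, Int.natAbs_mul, pow_succ, pow_add, Int.natAbs_natCast, Int.natAbs_natCast]
    have := Nat.mul_le_mul hn hdL'
    have := Nat.mul_le_mul hdL hn'
    omega
  · have : (d : ℝ) ≠ 0 := by positivity
    have : (d' : ℝ) ≠ 0 := by positivity
    push_cast
    field_simp

theorem sub (h : RatBound L x) (h' : RatBound M y) : RatBound (L + M + 1) (x - y) := by
  rw [sub_eq_add_neg]; exact h.add h'.neg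

theorem inv (h : RatBound L x) : RatBound L x⁻¹ := by
  obtain ⟨n, d, hd, hdL, hn, rfl⟩ := h
  rcases eq_or_ne n 0 with rfl | h0
  · exact ⟨0, 1, one_pos, Nat.one_le_two_pow, by simp, by simp⟩
  · refine ⟨n.sign * d, n.natAbs, Int.natAbs_pos.2 h0, hn, ?_, ?_⟩
    · rw [Int.natAbs_mul, Int.natAbs_sign_of_ne_zero h0]; simpa using hdL
    · have h1 : (n : ℝ) ≠ 0 := by exact_mod_cast h0
      have h2 : (n.sign : ℝ) * (n.natAbs : ℝ) = n := by
        rw [← Int.cast_natCast, ← Int.cast_mul, Int.sign_mul_natAbs]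
      have h3 : (n.natAbs : ℝ) ≠ 0 := by exact_mod_cast Int.natAbs_ne_zero.2 h0
      have h4 : (n.sign : ℝ) * n.sign = 1 := by
        rcases lt_or_gt_of_ne h0 with h | h
        · rw [Int.sign_eq_neg_one_of_neg h]; norm_num
        · rw [Int.sign_eq_one_of_pos h]; norm_num
      rw [inv_div, div_eq_div_iff h1 h3]
      push_cast
      rw [← h2]
      linear_combination (-(d : ℝ) * (n.natAbs : ℝ)) * h4

theorem div (h : RatBound L x) (h' : RatBound M y) : RatBound (L + M) (x / y) := by
  rw [div_eq_mul_inv]; exact h.mul h'.inv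

theorem pow (h : RatBound L x) (k : ℕ) : RatBound (k * L) (x ^ k) := by
  induction k with
  | zero => simpa using one
  | succ k ih => rw [pow_succ]; exact (ih.mul h).mono (by rw [Nat.succ_mul])

theorem sum_three {f : Fin 3 → ℝ} (h : ∀ i, RatBound L (f i)) :
    RatBound (3 * L + 2) (∑ i, f i) := by
  rw [Fin.sum_univ_three]
  exact (((h 0).add (h 1)).add (h 2)).mono (by omega)

theorem abs_le (h : RatBound L x) : |x| ≤ 2 ^ L := by
  obtain ⟨n, d, hd, hdL, hn, rfl⟩ := h
  have h1 : (1 : ℝ) ≤ d := by exact_mod_cast hd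
  have h2 : |(n : ℝ)| ≤ 2 ^ L := by
    rw [← Int.cast_abs, Int.abs_eq_natAbs]; exact_mod_cast hn
  rw [abs_div, abs_of_pos (by linarith : (0 : ℝ) < d), div_le_iff₀ (by linarith)]
  have := abs_nonneg (n : ℝ)
  nlinarith

theorem abs_le_mul_abs (h : RatBound L x) (h' : RatBound M y) (hy : y ≠ 0) :
    |x| ≤ 2 ^ (L + M) * |y| := by
  have := (h.div h').abs_le
  rwa [abs_div, div_le_iff₀ (abs_pos.2 hy)] at this

theorem of_ratLength (q : ℚ) : RatBound (ratLength q) (q : ℝ) := by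
  have h : ∀ k : ℕ, k.size ≤ ratLength q → k ≤ 2 ^ ratLength q := fun k hk =>
    (Nat.size_le.1 hk).le
  refine ⟨q.num, q.den, q.pos, h _ ?_, h _ ?_, ?_⟩
  · simp only [ratLength]; omega
  · simp only [ratLength]; omega
  · exact_mod_cast (Rat.num_div_den q).symm

theorem exists_rat (h : RatBound L x) : ∃ q : ℚ, (q : ℝ) = x ∧ ratLength q ≤ 2 * L + 3 := by
  obtain ⟨n, d, hd, hdL, hn, rfl⟩ := h
  have hlt : 2 ^ L < 2 ^ (L + 1) := Nat.pow_lt_pow_right (by norm_num) (by omega)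
  refine ⟨Rat.divInt n d, by rw [Rat.divInt_eq_div]; push_cast; rfl, ?_⟩
  have h1 : (Rat.divInt n d).num.natAbs ≤ 2 ^ L := by
    rcases eq_or_ne n 0 with rfl | h0
    · simp
    · have := Int.natAbs_dvd_natAbs.2 (Rat.num_dvd n (b := d) (by exact_mod_cast hd.ne'))
      exact (Nat.le_of_dvd (Int.natAbs_pos.2 h0) this).trans hn
  have h2 : (Rat.divInt n d).den ≤ 2 ^ L := by
    have := Rat.den_dvd n d
    exact (Nat.le_of_dvd hd (by exact_mod_cast this)).trans hdL
  have h3 := Nat.size_le.2 (h1.trans_lt hlt)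
  have h4 := Nat.size_le.2 (h2.trans_lt hlt)
  simp only [ratLength]
  omega

end RatBound

theorem ratBound_ofRat {v : Fin 3 → ℚ} {n : ℕ} (h : vecLength v ≤ n) (i : Fin 3) :
    RatBound n (ofRat v i) := by
  refine (RatBound.of_ratLength (v i)).mono (le_trans ?_ h)
  exact Finset.single_le_sum (f := fun i => ratLength (v i)) (fun _ _ => Nat.zero_le _)
    (Finset.mem_univ i)

theorem exists_ofRat {x : Space} {L : ℕ} (h : ∀ i, RatBound L (x i)) :
    ∃ v : Fin 3 → ℚ, ofRat v = x ∧ vecLength v ≤ 3 * (2 * L + 3) := by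
  choose v hv hvL using fun i => (h i).exists_rat
  refine ⟨v, by ext i; exact hv i, ?_⟩
  simp only [vecLength, Fin.sum_univ_three]
  have := hvL 0; have := hvL 1; have := hvL 2
  omega

theorem ratBound_normalVec {w : Fin 3 → Space} {L : ℕ} (hw : ∀ i j, RatBound L (w i j))
    (i : Fin 3) : RatBound (8 * L + 5) (normalVec w i) := by
  have h : ∀ k l k' l', RatBound (8 * L + 5) ((w 1 k - w 0 k) * (w 2 l - w 0 l) -
      (w 1 k' - w 0 k') * (w 2 l' - w 0 l')) := fun k l k' l' =>
    ((((hw 1 k).sub (hw 0 k)).mul ((hw 2 l).sub (hw 0 l))).sub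
      (((hw 1 k').sub (hw 0 k')).mul ((hw 2 l').sub (hw 0 l')))).mono (by omega)
  fin_cases i <;> simp only [normalVec, cross_apply] <;> exact h _ _ _ _

theorem ratBound_normalFn {w : Fin 3 → Space} {x : Space} {L : ℕ}
    (hw : ∀ i j, RatBound L (w i j)) (hx : ∀ j, RatBound L (x j)) :
    RatBound (30 * L + 20) (normalFn w x) := by
  rw [normalFn_apply]
  exact (RatBound.sum_three fun i =>
    (ratBound_normalVec hw i).mul ((hx i).sub (hw 0 i))).mono (by omega)

theorem coordFn_eq_div (p : Space) (e : Module.Basis (Fin 3) ℝ Space) (i : Fin 3) :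
    ∃ w : Fin 3 → Space, (∀ j, w j ∈ insert p (Set.range fun j => p + e j)) ∧
      ∀ x, coordFn p e i x = normalFn w x / normalFn w (p + e i) := by
  have hpe : ∀ j k, coordFn p e j (p + e k) = if k = j then 1 else 0 := fun j k => by
    rw [coordFn_apply, map_add, add_sub_cancel_left, Module.Basis.coord_apply,
      Module.Basis.repr_self, Finsupp.single_apply]
  have hpp : ∀ j, coordFn p e j p = 0 := fun j => by rw [coordFn_apply, sub_self]
  set w : Fin 3 → Space := ![p, p + e (i + 1), p + e (i + 2)] with hw
  have hind : AffineIndependent ℝ w := by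
    refine affineIndependent_of_fns ![coSumFn p e, coordFn p e (i + 1), coordFn p e (i + 2)] ?_ ?_
    · intro j
      fin_cases j <;> fin_cases i <;> simp [hw, coSumFn_apply, hpe, hpp]
    · intro j k hjk
      fin_cases j <;> fin_cases k <;> fin_cases i <;> simp [hw, coSumFn_apply, hpe, hpp] at hjk ⊢
  have h0 : normalFn w p = 0 := normalFn_vertex w 0
  have h1 : normalFn w (p + e (i + 1)) = 0 := normalFn_vertex w 1
  have h2 : normalFn w (p + e (i + 2)) = 0 := normalFn_vertex w 2
  have hx : ∀ x, normalFn w x = coordFn p e i x * normalFn w (p + e i) := by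
    intro x
    rw [(normalFn w).apply_coord p e x, h0]
    generalize normalFn w = f at *
    fin_cases i
    · change f (p + e 1) = 0 at h1
      change f (p + e 2) = 0 at h2
      simp [h1, h2]
    · change f (p + e 2) = 0 at h1
      change f (p + e 0) = 0 at h2
      simp [h1, h2]
    · change f (p + e 0) = 0 at h1
      change f (p + e 1) = 0 at h2
      simp [h1, h2]
  obtain ⟨y, hy⟩ := exists_normalFn_ne_zero hind
  refine ⟨w, fun j => ?_, fun x => ?_⟩
  · fin_cases j
    · exact Or.inl rfl
    · exact Or.inr ⟨i + 1, rfl⟩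
    · exact Or.inr ⟨i + 2, rfl⟩
  · have : normalFn w (p + e i) ≠ 0 := fun h => hy (by rw [hx, h, mul_zero])
    rw [hx x, mul_div_cancel_right₀ _ this]

section
variable {P F : Set Space} {p : Space} {r : Fin 3 → Space} {e : Module.Basis (Fin 3) ℝ Space}
  {d : Fin 3 → ℝ} {s : ℝ} {n : ℕ}

theorem IsPlaced.ratBound_basis (hP : IsPolytope3 P) (hF : IsFacet P F)
    (hpl : IsPlaced P F p e s) (he : ∀ i, e i = d i • r i) (hp : ∀ j, RatBound n (p j))
    (hr : ∀ i j, RatBound n (r i j)) (hw : ∀ w ∈ P.extremePoints ℝ, ∀ j, RatBound n (w j))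
    (i j : Fin 3) : RatBound (58 * n + 37) (e i j) := by
  obtain ⟨w, hwF, hind⟩ := hF.exists_affineIndependent hP
  have hFz : ∀ y ∈ F, coSumFn p e y = 0 := fun y hy => by rw [hpl.facet] at hy; exact hy.2
  obtain ⟨k, hk⟩ := normalFn_proportional hind (coSumFn p e) fun i => hFz _ (hwF i).2
  have hp1 : coSumFn p e p = 1 := by simp [coSumFn_apply, coordFn_apply]
  have hk0 : k ≠ 0 := fun h => by have := hk p; rw [h, hp1, zero_mul] at this; norm_num at this
  have hNp : normalFn w p ≠ 0 := fun h => by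
    have := hk p; rw [h, hp1, mul_zero] at this; norm_num at this
  have hNe : normalFn w (p + e i) = 0 := by
    have := hk (p + e i)
    rw [hFz _ (intrinsicInterior_subset (hpl.corner i))] at this
    exact (mul_eq_zero.1 this.symm).resolve_left hk0
  have hsplit : normalFn w (p + e i) = normalFn w p + d i * ∑ l, normalVec w l * r i l := by
    rw [normalFn_apply, normalFn_apply, he]
    simp only [Fin.sum_univ_three, PiLp.add_apply, PiLp.smul_apply, smul_eq_mul]
    ring
  have hS0 : ∑ l, normalVec w l * r i l ≠ 0 := fun h => by
    rw [hsplit, h, mul_zero, add_zero] at hNe; exact hNp hNe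
  have hd : d i = -normalFn w p / ∑ l, normalVec w l * r i l := by
    rw [eq_div_iff hS0]; linarith
  have hwn : ∀ i j, RatBound n (w i j) := fun i => hw _ (hwF i).1
  have hS : RatBound (27 * n + 17) (∑ l, normalVec w l * r i l) :=
    (RatBound.sum_three fun l => (ratBound_normalVec hwn l).mul (hr i l)).mono (by omega)
  have : e i j = d i * r i j := by rw [he]; rfl
  rw [this, hd]
  exact ((((ratBound_normalFn hwn hp).neg).div hS).mul (hr i j)).mono (by omega)

theorem IsPlaced.isGood (hP : IsPolytope3 P) (hF : IsFacet P F) (hn : 1 ≤ n)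
    (hpl : IsPlaced P F p e s) (he : ∀ i, e i = d i • r i) (hp : ∀ j, RatBound n (p j))
    (hr : ∀ i j, RatBound n (r i j)) (hw : ∀ w ∈ P.extremePoints ℝ, ∀ j, RatBound n (w j)) :
    IsGood P p e (2 ^ (5860 * n)) := by
  have hy : ∀ y ∈ insert p (Set.range fun j => p + e j), ∀ j, RatBound (97 * n) (y j) := by
    rintro y (rfl | ⟨i, rfl⟩) j
    · exact (hp j).mono (by omega)
    · exact ((hp j).add (hpl.ratBound_basis hP hF he hp hr hw i j)).mono (by omega)
  have hw' : ∀ w ∈ P.extremePoints ℝ, ∀ j, RatBound (97 * n) (w j) := fun w hwP j =>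
    (hw w hwP j).mono (by omega)
  constructor
  · intro w hwP i
    obtain ⟨W, hW, hco⟩ := coordFn_eq_div p e i
    rw [hco]
    exact (((ratBound_normalFn (fun l => hy _ (hW l)) (hw' w hwP)).div
      (ratBound_normalFn (fun l => hy _ (hW l)) (hy _ (Or.inr ⟨i, rfl⟩)))).mono
      (by omega)).abs_le
  · intro w hwP i h0 y hyp
    have h1 : RatBound (2930 * n) (normalFn w y) :=
      (ratBound_normalFn (fun l => hw' _ (hwP l)) (hy y hyp)).mono (by omega)
    have h2 : RatBound (2930 * n) (normalFn w (p + e i)) :=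
      (ratBound_normalFn (fun l => hw' _ (hwP l)) (hy _ (Or.inr ⟨i, rfl⟩))).mono (by omega)
    have := h1.abs_le_mul_abs h2 h0
    rwa [show 2930 * n + 2930 * n = 5860 * n by omega] at this

end

theorem ratBound_chainParam (m : ℕ) (k : Fin (m + 2)) : RatBound (4 * (m + 1)) (chainParam m k) := by
  have h1 : 4 * (m + 1) < 2 ^ (4 * (m + 1)) := Nat.lt_two_pow_self
  have h2 : (k : ℕ) < m + 2 := k.2
  rw [chainParam]
  split_ifs
  · exact RatBound.one.mono (by omega)
  · refine ⟨(k : ℕ), 4 * (m + 1), by omega, h1.le, ?_, by push_cast; rfl⟩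
    simp only [Int.natAbs_natCast]
    omega

theorem ratBound_placed {p : Space} {e : Module.Basis (Fin 3) ℝ Space} {s z : ℝ} (m : ℕ)
    (hs : s = 1 ∨ s = -1) (hz : 0 < z) (hz1 : z ≤ 1 / 256) {K : ℕ} (hK : RatBound K z)
    (hp : ∀ j, RatBound K (p j)) (he : ∀ i j, RatBound K (e i j)) (i : Fin 3) (k : Fin (m + 2))
    (j : Fin 3) :
    RatBound (104 * K + 48 * m + 103) ((placedChain p e s z m hs hz hz1).q i k j) := by
  have hs0 : RatBound 0 s := by
    rcases hs with rfl | rfl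
    · exact RatBound.one
    · exact RatBound.one.neg
  have hscale : RatBound (6 * K + 2) (scale s z) :=
    (RatBound.one.add (hs0.mul (hK.add (hK.pow 5)))).mono (by omega)
  have hlam : RatBound (7 * K + 3) (placedChain p e s z m hs hz hz1).lam := by
    rw [placed_lam]
    exact ((RatBound.one.add (hs0.mul hK)).div hscale).mono (by omega)
  have hmu : RatBound K (placedChain p e s z m hs hz hz1).mu := hK
  have heta : RatBound (2 * K) (placedChain p e s z m hs hz hz1).eta := hK.pow 2
  have htau : RatBound (4 * (m + 1)) ((placedChain p e s z m hs hz hz1).tau k) :=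
    ratBound_chainParam m k
  have hp' : RatBound K ((placedChain p e s z m hs hz hz1).p j) := hp j
  have he' : ∀ l, RatBound (7 * K + 2) ((placedChain p e s z m hs hz hz1).e l j) := by
    intro l
    have : (placedChain p e s z m hs hz hz1).e l j = scale s z * e l j := by
      simp [placedChain, Module.Basis.unitsSMul_apply, Units.smul_def]
    rw [this]
    exact (hscale.mul (he l j)).mono (by omega)
  generalize placedChain p e s z m hs hz hz1 = D at *
  have hA : ∀ l, RatBound (24 * K + 10) (D.A l j) := by
    intro l
    have : D.A l j = D.p j + (D.lam + D.mu) * D.e l j - D.mu * D.e (l + 2) j := by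
      simp [Frame.A]
    rw [this]
    exact ((hp'.add ((hlam.add hmu).mul (he' l))).sub (hmu.mul (he' _))).mono (by omega)
  have hB : ∀ l, RatBound (24 * K + 10) (D.B l j) := by
    intro l
    have : D.B l j = D.p j + D.e l j := by simp [Frame.B]
    rw [this]
    exact (hp'.add (he' l)).mono (by omega)
  have hg : RatBound (2 * K + 8 * (m + 1) + 1) (D.g k) :=
    (heta.mul (htau.mul (RatBound.one.sub htau))).mono (by omega)
  have : D.q i k j = (1 - D.tau k + D.g k) * D.A i j + (D.tau k + D.g k) * D.B (i + 1) j +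
      (-D.g k) * D.B i j + (-D.g k) * D.A (i + 1) j := by
    simp [Chain.q]
  rw [this]
  exact ((((((RatBound.one.sub htau).add hg).mul (hA i)).add
    ((htau.add hg).mul (hB (i + 1)))).add (hg.neg.mul (hB i))).add
      (hg.neg.mul (hA (i + 1)))).mono (by omega)

/-- A polytope whose vertices are finitely many points with bounded rational coordinates. -/
theorem exists_polytopeHasLength {C : Set Space} {ι : Type*} [Fintype ι] {q : ι → Space} {L : ℕ}
    (hC : C.extremePoints ℝ = Set.range q) (hq : ∀ i j, RatBound L (q i j)) :
    ∃ c, PolytopeHasLength C c ∧ c ≤ Fintype.card ι * (3 * (2 * L + 3)) := by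
  classical
  choose v hv hvL using fun i => exists_ofRat (hq i)
  refine ⟨_, ⟨Finset.univ.image v, ?_, rfl⟩, ?_⟩
  · rw [hC, Finset.coe_image, Finset.coe_univ, Set.image_univ, ← Set.range_comp]
    congr 1
    exact funext fun i => (hv i).symm
  · refine (Finset.sum_le_card_nsmul _ _ (3 * (2 * L + 3)) ?_).trans ?_
    · intro x hx
      obtain ⟨i, -, rfl⟩ := Finset.mem_image.1 hx
      exact hvL i
    · rw [smul_eq_mul]
      exact Nat.mul_le_mul_right _ Finset.card_image_le

/-! ### The construction -/

/-- The properties of the cupola to be constructed, apart from its encoding length. -/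
structure IsCupolaBeyond (P F V : Set Space) (m : ℕ) (C : Set Space) (A B : Fin 3 → Space)
    (q : Fin 3 → Fin (m + 2) → Space) : Prop where
  isCupola : IsCupola m C A B q
  beyond : ∀ x ∈ C, IsBeyond P F x
  beyond_bottom : ∀ x ∈ P, IsBeyond C (convexHull ℝ (Set.range A)) x
  visibilityCone_eq : visibilityCone A B = V

theorem inv_two_pow_le (R : ℕ) : ((2 : ℝ) ^ (R + 8))⁻¹ ≤ 1 / 256 := by
  rw [pow_add, one_div]
  have : (1 : ℝ) ≤ 2 ^ R := one_le_pow₀ (by norm_num)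
  exact inv_anti₀ (by norm_num) (by linarith)

theorem IsPlaced.isCupolaBeyond {P F : Set Space} {p : Space} {r : Fin 3 → Space}
    {e : Module.Basis (Fin 3) ℝ Space} {d : Fin 3 → ℝ} {s : ℝ} {R : ℕ} (hP : IsPolytope3 P)
    (hF : IsFacet P F) (hd : ∀ i, 0 < d i) (he : ∀ i, e i = d i • r i)
    (hpl : IsPlaced P F p e s) (hR : IsGood P p e (2 ^ R)) (m : ℕ) :
    let D := placedChain p e s ((2 : ℝ) ^ (R + 8))⁻¹ m hpl.sign (by positivity) (inv_two_pow_le R)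
    IsCupolaBeyond P F (coneOf p r) m D.cup D.A D.B D.q := by
  have hMz : (2 : ℝ) ^ R * ((2 : ℝ) ^ (R + 8))⁻¹ ≤ 1 / 256 := by
    rw [pow_add, mul_inv, mul_inv_cancel_left₀ (by positivity)]
    norm_num
  exact ⟨Chain.isCupola _, fun x hx => hpl.isBeyond hP hF hR m _ _ hMz hx,
    fun x hx => hpl.beyond_bottom hP hR m _ _ hMz hx, visibilityCone_placed hd he m _ _ _⟩

section
variable {P F V : Set Space} (m : ℕ)

theorem exists_isCupolaBeyond (hP : IsPolytope3 P) (hF : IsFacet P F) (hV : IsTriangularCone V)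
    (hT : IsTriangle (F ∩ V)) (hint : F ∩ V ⊆ intrinsicInterior ℝ F) :
    ∃ C A B q, IsCupolaBeyond P F V m C A B q := by
  obtain ⟨p, r, hr, rfl⟩ := hV
  obtain ⟨e, d, s, hd, he, hpl⟩ := exists_isPlaced hP hF hr hT hint
  obtain ⟨R, hR⟩ := exists_isGood hP p e
  exact ⟨_, _, _, _, hpl.isCupolaBeyond hP hF hd he hR m⟩

theorem exists_rational_isCupolaBeyond (hP : IsPolytope3 P) (hF : IsFacet P F)
    (hT : IsTriangle (F ∩ V)) (hint : F ∩ V ⊆ intrinsicInterior ℝ F) {a b : ℕ}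
    (ha : PolytopeHasLength P a) (hb : ConeHasLength V b) :
    ∃ C A B q, IsCupolaBeyond P F V m C A B q ∧ ∃ c, PolytopeHasLength C c ∧
      c ≤ 9 * (a + b + m + 2) * (1240000 * (a + b + m) + 3) := by
  obtain ⟨S, hPS, rfl⟩ := ha
  obtain ⟨p, r, hr, rfl, rfl⟩ := hb
  set n := ∑ v ∈ S, vecLength v + (vecLength p + ∑ i, vecLength (r i)) with hn
  have hn1 : 1 ≤ n := by
    have : 1 ≤ vecLength p := by
      simp only [vecLength, Fin.sum_univ_three, ratLength]; omega
    omega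
  obtain ⟨e, d, s, hd, he, hpl⟩ := exists_isPlaced hP hF hr hT hint
  have hp : ∀ j, RatBound n (ofRat p j) := ratBound_ofRat (by omega)
  have hr' : ∀ i j, RatBound n (ofRat (r i) j) := fun i => ratBound_ofRat (by
    have := Finset.single_le_sum (f := fun i => vecLength (r i)) (fun _ _ => Nat.zero_le _)
      (Finset.mem_univ i)
    omega)
  have hw : ∀ w ∈ P.extremePoints ℝ, ∀ j, RatBound n (w j) := by
    intro w hw
    rw [hPS] at hw
    obtain ⟨v, hv, rfl⟩ := hw
    refine ratBound_ofRat ?_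
    have := Finset.single_le_sum (f := fun v => vecLength v) (fun _ _ => Nat.zero_le _) hv
    omega
  have hR := hpl.isGood hP hF hn1 he hp hr' hw
  refine ⟨_, _, _, _, hpl.isCupolaBeyond hP hF hd he hR m, ?_⟩
  have hz : RatBound (5868 * n) ((2 : ℝ) ^ (5860 * n + 8))⁻¹ := by
    have := (RatBound.natCast (L := 5868 * n) (k := 2 ^ (5860 * n + 8))
      (Nat.pow_le_pow_right (by norm_num) (by omega))).inv
    exact_mod_cast this
  have hq : ∀ (x : Fin 3 × Fin (m + 2)) (j : Fin 3), RatBound (620000 * (n + m))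
      ((placedChain (ofRat p) e s ((2 : ℝ) ^ (5860 * n + 8))⁻¹ m hpl.sign (by positivity)
        (inv_two_pow_le (5860 * n))).q x.1 x.2 j) := fun x j =>
    (ratBound_placed m hpl.sign (by positivity) (inv_two_pow_le _) hz
      (fun j => (hp j).mono (by omega))
      (fun i j => (hpl.ratBound_basis hP hF he hp hr' hw i j).mono (by omega)) x.1 x.2 j).mono
      (by omega)
  obtain ⟨c, hc, hcL⟩ := exists_polytopeHasLength (Chain.extremePoints_cup _) hq
  refine ⟨c, hc, hcL.trans ?_⟩
  rw [Fintype.card_prod, Fintype.card_fin, Fintype.card_fin]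
  calc 3 * (m + 2) * (3 * (2 * (620000 * (n + m)) + 3))
      = 9 * (m + 2) * (1240000 * (n + m) + 3) := by ring
    _ ≤ 9 * (n + m + 2) * (1240000 * (n + m) + 3) := by gcongr; omega

end

end Cupola

theorem mainTheorem8 :
    ∃ f : Polynomial ℕ,
      ∀ (P F V : Set Cupola.Space) (m : ℕ),
        Cupola.IsPolytope3 P → Cupola.IsFacet P F → Cupola.IsTriangularCone V →
        Cupola.IsTriangle (F ∩ V) → F ∩ V ⊆ intrinsicInterior ℝ F → 0 < m →
        ∃ (C : Set Cupola.Space) (A B : Fin 3 → Cupola.Space)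
          (q : Fin 3 → Fin (m + 2) → Cupola.Space),
          Cupola.IsCupola m C A B q ∧
          (∀ x ∈ C, Cupola.IsBeyond P F x) ∧
          (∀ x ∈ P, Cupola.IsBeyond C (convexHull ℝ (Set.range A)) x) ∧
          Cupola.visibilityCone A B = V ∧
          ∀ a b : ℕ, Cupola.PolytopeHasLength P a → Cupola.ConeHasLength V b →
            ∃ c : ℕ, Cupola.PolytopeHasLength C c ∧ c ≤ f.eval (a + b + m) := by
  classical
  refine ⟨9 * (Polynomial.X + 2) * (1240000 * Polynomial.X + 3), ?_⟩
  intro P F V m hP hF hV hT hint _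
  by_cases h : (∃ a, Cupola.PolytopeHasLength P a) ∧ ∃ b, Cupola.ConeHasLength V b
  · obtain ⟨ha, hb⟩ := h
    obtain ⟨C, A, B, q, hC, c, hc, hcL⟩ := Cupola.exists_rational_isCupolaBeyond m hP hF hT hint
      (Nat.find_spec ha) (Nat.find_spec hb)
    refine ⟨C, A, B, q, hC.isCupola, hC.beyond, hC.beyond_bottom, hC.visibilityCone_eq, ?_⟩
    intro a b ha' hb'
    refine ⟨c, hc, hcL.trans ?_⟩
    have h1 : Nat.find ha ≤ a := Nat.find_min' ha ha'
    have h2 : Nat.find hb ≤ b := Nat.find_min' hb hb'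
    simp only [Polynomial.eval_mul, Polynomial.eval_add, Polynomial.eval_X, Polynomial.eval_ofNat]
    gcongr
  · obtain ⟨C, A, B, q, hC⟩ := Cupola.exists_isCupolaBeyond m hP hF hV hT hint
    exact ⟨C, A, B, q, hC.isCupola, hC.beyond, hC.beyond_bottom, hC.visibilityCone_eq,
      fun a b ha hb => absurd ⟨⟨a, ha⟩, ⟨b, hb⟩⟩ h⟩
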